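/- Let $d\in\{1,2,3\}$. Let either $\Omega\subset\mathbb R^d$ be a bounded convex domain (for instance a convex polygonal one), with Dirichlet or Neumann boundary conditions, or let $\Omega$ be the torus $\prod_{n=1}^d[0,L_n)$, $L_n>0$ (periodic boundary conditions). Put $H=L^2(\Omega)$, $V=W^{1,2}_0(\Omega)$ in the Dirichlet case and $V=W^{1,2}(\Omega)$ otherwise, identify $H=H'$, and let $A,A_0:V\to V'$, $\langle Aw,z\rangle=(\nabla w,\nabla z)_{L^2}+(w,z)_{L^2}$, $A_0=A-\mathbf 1$. Let $\mathrm D(A)=\{v\in V: Av\in H\}$, $\mathrm D(A^{3/2})=\{v\in \mathrm D(A): Av\in V\}$, $\|v\|_V^2=\langle Av,v\rangle$, $\|v\|_{\mathrm D(A)}=\|Av\|_H$; $A_0$ is extended to $H\to \mathrm D(A)'$ by $\langle A_0w,v\rangle=(w,A_0v)_H$. Product spaces carry the Euclidean combination of the norms. For nonlinearities $f:\mathbb R\to\mathbb R$ and $g$ (possibly depending on $x\in\Omega$) and a target $y_{1r}:(0,\infty)\times\Omega\to\mathbb R$, consider the following assumptions. (fgV) $f=F'$ with $F\ge0$ and $F(z)\in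 L^1(\Omega)$ for all $z\in \mathrm D(A^{3/2})$; and there are $C_{f*},C_{g*}\ge0$ such that for all $v\in \mathrm D(A)$ $$\|f(v)\|_{V'}^2\le C_{f*}\|v\|_V^2(1+\|v\|_H^2\|v\|_V^2),\qquad -\langle A_0f(v),v\rangle_{\mathrm D(A)',\mathrm D(A)}\le C_{f*}\|v\|_{\mathrm D(A)}\|v\|_V,$$ $$\|g(v)\|_{V'}^2\le C_{g*}\|v\|_V^2(1+\|v\|_H^2\|v\|_V^2),\qquad -\langle g(v),v\rangle_{\mathrm D(A)',\mathrm D(A)}\le C_{g*}\|v\|_{\mathrm D(A)}\|v\|_V$$ (in particular $f(v),g(v)\in V'$ and $f(v)\in H$). (N-dif) There are constants $\underline C_{f*},\underline C_{g*}\ge0$ such that for all $v,w\in \mathrm D(A^{3/2})$ one has $f(v)-f(w)\in V$, $g(v)-g(w)\in V'$ and, with $B(v,w)=(1+\|(v,w)\|_{V\times V})(1+\|(v,w)\|_{\mathrm D(A)\times \mathrm D(A)})\|v-w\|_V$, $$\|A_0(f(v)-f(w))\|_{V'}\le\underline C_{f*}B(v,w),\qquad \|g(v)-g(w)\|_{V'}\le\underline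 C_{g*}B(v,w).$$ (NfNg) With $N_f(t,z)=f(y_{1r}(t)+z)-f(y_{1r}(t))$ and $N_g(t,z)=g(y_{1r}(t)+z)-g(y_{1r}(t))$ there are an integer $n\ge1$ and nonnegative constants $C_f,C_g,\zeta_i^f,\eta_i^f,\zeta_i^g,\eta_i^g$ ($1\le i\le n$), with $\eta_i^f,\eta_i^g<2$ and $\zeta_i^f+\eta_i^f\ge2$, $\zeta_i^g+\eta_i^g\ge2$, such that for almost every $t>0$ and all $z\in \mathrm D(A)$ one has $N_f(t,z)\in H$, $N_g(t,z)\in \mathrm D(A)'$ and $$-\langle A_0N_f(t,z),z\rangle_{\mathrm D(A)',\mathrm D(A)}\le C_f\sum_{i=1}^n\|z\|_H^{\zeta_i^f}\|z\|_{\mathrm D(A)}^{\eta_i^f},\qquad -\langle N_g(t,z),z\rangle_{\mathrm D(A)',\mathrm D(A)}\le C_g\sum_{i=1}^n\|z\|_H^{\zeta_i^g}\|z\|_{\mathrm D(A)}^{\eta_i^g}.$$ (yr-bdd) $y_{1r}\in L^\infty((0,\infty)\times\Omega)$ and $\nabla y_{1r}\in L^\infty((0,\infty)\times\Omega)^d$.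 Let $\tau>0$, $F(\zeta)=\tau(\zeta^2-1)^2$, $f(\zeta)=F'(\zeta)=4\tau(\zeta^3-\zeta)$. Let $a_0\in L^2(\Omega)$, $a_1,a_2\in L^\infty(\Omega)$ with $a_1>0$ and $a_2>0$ almost everywhere, and $$\overline g(w)=a_1w+a_2w(|w|-1),\qquad g(w)=a_0+\overline g(w).$$ Then: 1. $F$, $f$ and $\overline g$ satisfy (fgV); $f$ and $\overline g$ satisfy (N-dif); and $f$ and $\overline g$ satisfy (NfNg) for every target $y_{1r}$ with (yr-bdd). The part of (NfNg) on $\overline g$ holds for every $y_{1r}\in L^\infty((0,\infty)\times\Omega)$. 2. The statements of 1 on (N-dif) and (NfNg) hold with $g$ in place of $\overline g$. 3. The term $a_0$ can be moved into the external force: for $v\in\mathrm D(A)$ one has $g(v)=a_0+\overline g(v)$ in $V'$ (where $\overline g(v)$ is a functional $\ell\in V'$ if and only if $g(v)$ is the functional $a_0+\ell$), and if $h=(h_1,h_2)\in L^2_{\rm loc}(\mathbb R_+,V'\times V')$, then also $(h_1-a_0,h_2)\in L^2_{\rm loc}(\mathbb R_+,V'\times V')$. Here $h\in L^2_{\rm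 loc}(\mathbb R_+,V'\times V')$ means $h\in L^2((0,T),V'\times V')$ for all $T>0$. -/

import Mathlib

open MeasureTheory Set
open scoped ENNReal ContDiff

noncomputable section

namespace CahnHilliard

/-- The space `ℝ^d` with its Euclidean structure. -/
abbrev E (d : ℕ) : Type := EuclideanSpace ℝ (Fin d)

/-- A spatial domain together with its boundary conditions. In the periodic case the domain is the
torus with periods `L 0, …, L (d-1)`, represented by the box `∏ [0, L i)`. -/
inductive Setting (d : ℕ) : Type
  | dirichlet (Ω : Set (E d)) : Setting d
  | neumann (Ω : Set (E d)) : Setting d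
  | periodic (L : Fin d → ℝ) : Setting d

namespace Setting

variable {d : ℕ}

/-- `Ω` is a (nonempty) bounded convex domain; respectively, the periods are positive. -/
def Admissible : Setting d → Prop
  | dirichlet Ω => Ω.Nonempty ∧ IsOpen Ω ∧ Bornology.IsBounded Ω ∧ Convex ℝ Ω
  | neumann Ω => Ω.Nonempty ∧ IsOpen Ω ∧ Bornology.IsBounded Ω ∧ Convex ℝ Ω
  | periodic L => ∀ i, 0 < L i

/-- The spatial domain, as a subset of `ℝ^d`. -/
def dom : Setting d → Set (E d)
  | dirichlet Ω => Ω
  | neumann Ω => Ω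
  | periodic L => {x | ∀ i, 0 ≤ x i ∧ x i < L i}

/-- Lebesgue measure on the spatial domain. -/
def mu (S : Setting d) : Measure (E d) := volume.restrict S.dom

/-- Test functions: `C_c^∞(Ω)` for a domain `Ω ⊆ ℝ^d`, and `C^∞` of the torus (that is, smooth
periodic functions) in the periodic case. -/
def IsTest : Setting d → (E d → ℝ) → Prop
  | dirichlet Ω, φ => ContDiff ℝ ∞ φ ∧ HasCompactSupport φ ∧ tsupport φ ⊆ Ω
  | neumann Ω, φ => ContDiff ℝ ∞ φ ∧ HasCompactSupport φ ∧ tsupport φ ⊆ Ω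
  | periodic L, φ => ContDiff ℝ ∞ φ ∧ ∀ i x, φ (x + EuclideanSpace.single i (L i)) = φ x

/-- The classical partial derivative `∂φ/∂x_i`. -/
def partialD (i : Fin d) (φ : E d → ℝ) (x : E d) : ℝ :=
  fderiv ℝ φ x (EuclideanSpace.single i 1)

/-- `(G_0, …, G_{d-1})` is the weak gradient of `u` on the domain (on the torus in the periodic
case). Used for square integrable and for essentially bounded `u`, `G` only. -/
def IsWeakGrad (S : Setting d) (u : E d → ℝ) (G : Fin d → E d → ℝ) : Prop :=
  ∀ φ, S.IsTest φ → ∀ i,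
    ∫ x, u x * partialD i φ x ∂S.mu = - ∫ x, G i x * φ x ∂S.mu

/-- The pivot space `H = L²(Ω)`. -/
abbrev H (S : Setting d) : Type := Lp ℝ 2 S.mu

/-- `L²(Ω) × L²(Ω)^d` with its Hilbert structure. -/
abbrev Pair (S : Setting d) : Type := WithLp 2 (S.H × PiLp 2 (fun _ : Fin d => S.H))

lemma memLp_box (L : Fin d → ℝ) {φ : E d → ℝ} (h : Continuous φ) :
    MemLp φ 2 (mu (periodic L)) := by
  set K : Set (E d) := (EuclideanSpace.equiv (Fin d) ℝ) ⁻¹' (Icc 0 L) with hK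
  have hKc : IsCompact K :=
    (EuclideanSpace.equiv (Fin d) ℝ).toHomeomorph.isCompact_preimage.2 isCompact_Icc
  have hsub : dom (periodic L) ⊆ K := fun x hx =>
    ⟨fun i => (hx i).1, fun i => (hx i).2.le⟩
  obtain ⟨C, hC⟩ := hKc.exists_bound_of_continuousOn h.continuousOn
  have : IsFiniteMeasure (volume.restrict K) := ⟨by simpa using hKc.measure_lt_top⟩
  refine MemLp.mono_measure (Measure.restrict_mono hsub le_rfl) ?_
  refine MemLp.of_bound h.aestronglyMeasurable C ?_
  exact (ae_restrict_iff' hKc.measurableSet).2 (Filter.Eventually.of_forall hC)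

lemma continuous_partialD {φ : E d → ℝ} (h : ContDiff ℝ ∞ φ) (i : Fin d) :
    Continuous (partialD i φ) :=
  (h.continuous_fderiv (by simp)).clm_apply continuous_const

lemma hasCompactSupport_partialD {φ : E d → ℝ} (h : HasCompactSupport φ) (i : Fin d) :
    HasCompactSupport (partialD i φ) :=
  h.fderiv_apply ℝ (EuclideanSpace.single i 1)

lemma IsTest.memLp {S : Setting d} {φ : E d → ℝ} (h : S.IsTest φ) : MemLp φ 2 S.mu := by
  cases S with
  | dirichlet Ω => exact (h.1.continuous.memLp_of_hasCompactSupport h.2.1).restrict _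
  | neumann Ω => exact (h.1.continuous.memLp_of_hasCompactSupport h.2.1).restrict _
  | periodic L => exact memLp_box L h.1.continuous

lemma IsTest.memLp_partialD {S : Setting d} {φ : E d → ℝ} (h : S.IsTest φ) (i : Fin d) :
    MemLp (partialD i φ) 2 S.mu := by
  cases S with
  | dirichlet Ω =>
    exact ((continuous_partialD h.1 i).memLp_of_hasCompactSupport
      (hasCompactSupport_partialD h.2.1 i)).restrict _
  | neumann Ω =>
    exact ((continuous_partialD h.1 i).memLp_of_hasCompactSupport
      (hasCompactSupport_partialD h.2.1 i)).restrict _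
  | periodic L => exact memLp_box L (continuous_partialD h.1 i)

lemma integral_add_mul {S : Setting d} (u v : S.H) {ψ : E d → ℝ} (h : MemLp ψ 2 S.mu) :
    ∫ x, (u + v : S.H) x * ψ x ∂S.mu = ∫ x, u x * ψ x ∂S.mu + ∫ x, v x * ψ x ∂S.mu := by
  have hu : Integrable (fun x => u x * ψ x) S.mu := (Lp.memLp u).integrable_mul h
  have hv : Integrable (fun x => v x * ψ x) S.mu := (Lp.memLp v).integrable_mul h
  rw [← integral_add hu hv]
  refine integral_congr_ae ?_
  filter_upwards [Lp.coeFn_add u v] with x hx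
  rw [hx, Pi.add_apply, add_mul]

lemma integral_smul_mul {S : Setting d} (c : ℝ) (u : S.H) (ψ : E d → ℝ) :
    ∫ x, (c • u : S.H) x * ψ x ∂S.mu = c * ∫ x, u x * ψ x ∂S.mu := by
  rw [← integral_const_mul]
  refine integral_congr_ae ?_
  filter_upwards [Lp.coeFn_smul c u] with x hx
  rw [hx, Pi.smul_apply, smul_eq_mul, mul_assoc]

/-- `W^{1,2}`, as the space of the pairs `(u, ∇u)` with `u ∈ L²` and weak gradient `∇u ∈ (L²)^d`. -/
def W12 (S : Setting d) : Submodule ℝ S.Pair where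
  carrier := {p | S.IsWeakGrad p.fst (fun i => p.snd i)}
  zero_mem' := by
    intro φ hφ i
    have h0 : ∀ ψ : E d → ℝ, ∫ x, ((0 : S.H) : E d → ℝ) x * ψ x ∂S.mu = 0 := fun ψ => by
      have h := integral_smul_mul (S := S) 0 0 ψ
      rwa [zero_smul, zero_mul] at h
    have h1 : ∫ x, ((0 : S.H) : E d → ℝ) x * partialD i φ x ∂S.mu
        = - ∫ x, ((0 : S.H) : E d → ℝ) x * φ x ∂S.mu := by rw [h0, h0, neg_zero]
    exact h1
  add_mem' := by
    intro p q hp hq φ hφ i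
    have h1 := hp φ hφ i
    have h2 := hq φ hφ i
    simp only [WithLp.add_fst, WithLp.add_snd, PiLp.add_apply]
    rw [integral_add_mul _ _ (hφ.memLp_partialD i), integral_add_mul _ _ hφ.memLp, h1, h2]
    ring
  smul_mem' := by
    intro c p hp φ hφ i
    have h1 := hp φ hφ i
    simp only [WithLp.smul_fst, WithLp.smul_snd, PiLp.smul_apply]
    rw [integral_smul_mul, integral_smul_mul, h1]
    ring

/-- `W_0^{1,2}`: the closure in `W^{1,2}` of the space of test functions. -/
def W012 (S : Setting d) : Submodule ℝ S.Pair :=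
  (Submodule.span ℝ {p : S.Pair | ∃ φ, S.IsTest φ ∧ p.fst =ᵐ[S.mu] φ ∧
    ∀ i, p.snd i =ᵐ[S.mu] partialD i φ}).topologicalClosure

/-- The space `V`, as a space of pairs `(u, ∇u)`. Its inner product, inherited from
`L² × (L²)^d`, is `(u, w)_{L²} + (∇u, ∇w)_{L²}`. -/
def Vsub : (S : Setting d) → Submodule ℝ S.Pair
  | dirichlet Ω => W012 (dirichlet Ω)
  | neumann Ω => W12 (neumann Ω)
  | periodic L => W12 (periodic L)

/-- The space `V`; `‖u‖` for `u : S.V` is the norm of `V`. -/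
abbrev V (S : Setting d) : Type := S.Vsub

/-- The continuous dual `V'`, with the dual norm. -/
abbrev V' (S : Setting d) : Type := S.V →L[ℝ] ℝ

/-- The inclusion `V → H`. -/
def inclH (S : Setting d) : S.V →L[ℝ] S.H :=
  (WithLp.fstL 2 ℝ S.H (PiLp 2 (fun _ : Fin d => S.H))).comp S.Vsub.subtypeL

/-- The gradient `V → (L²)^d`. -/
def grad (S : Setting d) : S.V →L[ℝ] PiLp 2 (fun _ : Fin d => S.H) :=
  (WithLp.sndL 2 ℝ S.H (PiLp 2 (fun _ : Fin d => S.H))).comp S.Vsub.subtypeL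

/-- The inclusion `H → V'` given by the pivot space identification `H = H'`. -/
def ofH (S : Setting d) (h : S.H) : S.V' := (innerSL ℝ h).comp S.inclH

/-- The nonshifted Laplacian `A₀ : V → V'`, `⟨A₀ w, z⟩ = (∇w, ∇z)`. -/
def A0 (S : Setting d) (w : S.V) : S.V' := (innerSL ℝ (S.grad w)).comp S.grad

/-- The shifted Laplacian `A : V → V'`, `⟨A w, z⟩ = (∇w, ∇z) + (w, z)`. -/
def A (S : Setting d) (w : S.V) : S.V' := S.A0 w + S.ofH (S.inclH w)

/-- `D(A) = {v | A v ∈ H}`; an element is given by `v ∈ V` together with `A v ∈ H`. -/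
structure DomA (S : Setting d) : Type where
  toV : S.V
  Aval : S.H
  eq : S.A toV = S.ofH Aval

/-- The function on the domain underlying an element of `V`. -/
def V.fn {S : Setting d} (v : S.V) : E d → ℝ := S.inclH v

namespace DomA

variable {S : Setting d}

/-- The function on the domain underlying an element of `D(A)`. -/
def fn (v : S.DomA) : E d → ℝ := V.fn v.toV

def normH (v : S.DomA) : ℝ := ‖S.inclH v.toV‖

def normV (v : S.DomA) : ℝ := ‖v.toV‖

/-- The norm of `D(A)`, `‖A v‖_H`. -/
def normDA (v : S.DomA) : ℝ := ‖v.Aval‖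

/-- `v ∈ D(A^{3/2})`, that is, `A v ∈ D(A^{1/2}) = V`. -/
def MemDomA32 (v : S.DomA) : Prop := ∃ w : S.V, S.inclH w = v.Aval

end DomA

/-- The function `w` is an element of `V'`, namely the functional `ℓ`: `⟨w, z⟩ = ∫ w z`. -/
def Represents (S : Setting d) (w : E d → ℝ) (l : S.V') : Prop :=
  ∀ z : S.V, Integrable (fun x => w x * V.fn z x) S.mu ∧ ∫ x, w x * V.fn z x ∂S.mu = l z

/-- The function `w` is an element of `D(A)'`, acting as `⟨w, z⟩ = ∫ w z`. -/
def MemDomADual (S : Setting d) (w : E d → ℝ) : Prop :=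
  ∃ K : ℝ, ∀ z : S.DomA, Integrable (fun x => w x * z.fn x) S.mu ∧
    |∫ x, w x * z.fn x ∂S.mu| ≤ K * z.normDA

/-- The pairing `⟨A₀ w, v⟩_{D(A)', D(A)}` for `w ∈ H`, where `A₀ : H → D(A)'` is the extension by
duality: `⟨A₀ w, v⟩ = (w, A₀ v)_H` with `A₀ v = A v - v`. -/
def pairA0 (S : Setting d) (w : E d → ℝ) (v : S.DomA) : ℝ :=
  ∫ x, w x * (v.Aval x - v.fn x) ∂S.mu

/-! ### The assumptions

Here `f : ℝ → ℝ`, `F : ℝ → ℝ`, while `g : E d → ℝ → ℝ` may also depend on the point of space;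
`y : ℝ → E d → ℝ` is the first component of the target trajectory. -/

/-- The part of the first assumption that concerns `f`. -/
def GrowthF (S : Setting d) (F f : ℝ → ℝ) : Prop :=
  (∀ s, HasDerivAt F (f s) s) ∧ (∀ s, 0 ≤ F s) ∧
  (∀ z : S.DomA, z.MemDomA32 → Integrable (fun x => F (z.fn x)) S.mu) ∧
  ∃ C : ℝ, 0 ≤ C ∧ ∀ v : S.DomA,
    (∃ l : S.V', S.Represents (fun x => f (v.fn x)) l ∧
      ‖l‖ ^ 2 ≤ C * v.normV ^ 2 * (1 + v.normH ^ 2 * v.normV ^ 2)) ∧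
    MemLp (fun x => f (v.fn x)) 2 S.mu ∧
    -(S.pairA0 (fun x => f (v.fn x)) v) ≤ C * v.normDA * v.normV

/-- The part of the first assumption that concerns `g`. -/
def GrowthG (S : Setting d) (g : E d → ℝ → ℝ) : Prop :=
  ∃ C : ℝ, 0 ≤ C ∧ ∀ v : S.DomA,
    ∃ l : S.V', S.Represents (fun x => g x (v.fn x)) l ∧
      ‖l‖ ^ 2 ≤ C * v.normV ^ 2 * (1 + v.normH ^ 2 * v.normV ^ 2) ∧
      -(l v.toV) ≤ C * v.normDA * v.normV

/-- The growth and monotonicity assumption on `f = F'` and `g`. -/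
def AssumptionFGV (S : Setting d) (F f : ℝ → ℝ) (g : E d → ℝ → ℝ) : Prop :=
  S.GrowthF F f ∧ S.GrowthG g

/-- The factor
`(1 + ‖(v,w)‖_{V×V}) (1 + ‖(v,w)‖_{D(A)×D(A)}) ‖v - w‖_V`. -/
def difBound {S : Setting d} (v w : S.DomA) : ℝ :=
  (1 + √(v.normV ^ 2 + w.normV ^ 2)) * (1 + √(v.normDA ^ 2 + w.normDA ^ 2)) * ‖v.toV - w.toV‖

/-- The part of the second assumption that concerns `f`: here `f(v) - f(w)` is an element `u` of
`V`, and `A₀ u ∈ V'`. -/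
def DifF (S : Setting d) (f : ℝ → ℝ) : Prop :=
  ∃ C : ℝ, 0 ≤ C ∧ ∀ v w : S.DomA, v.MemDomA32 → w.MemDomA32 →
    ∃ u : S.V, V.fn u =ᵐ[S.mu] (fun x => f (v.fn x) - f (w.fn x)) ∧
      ‖S.A0 u‖ ≤ C * difBound v w

/-- The part of the second assumption that concerns `g`. -/
def DifG (S : Setting d) (g : E d → ℝ → ℝ) : Prop :=
  ∃ C : ℝ, 0 ≤ C ∧ ∀ v w : S.DomA, v.MemDomA32 → w.MemDomA32 →
    ∃ l : S.V', S.Represents (fun x => g x (v.fn x) - g x (w.fn x)) l ∧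
      ‖l‖ ≤ C * difBound v w

/-- The local Lipschitz assumption on `f` and `g`. -/
def AssumptionNdif (S : Setting d) (f : ℝ → ℝ) (g : E d → ℝ → ℝ) : Prop :=
  S.DifF f ∧ S.DifG g

/-- The conditions on the exponents in the third assumption. -/
def ExponentsOK {n : ℕ} (ζ η : Fin n → ℝ) : Prop :=
  ∀ i, 0 ≤ ζ i ∧ 0 ≤ η i ∧ η i < 2 ∧ 2 ≤ ζ i + η i

/-- The part of the third assumption that concerns `N_f(t,z) = f(y(t) + z) - f(y(t))`, with `n`
terms in the bound. -/
def BoundNf (S : Setting d) (n : ℕ) (f : ℝ → ℝ) (y : ℝ → E d → ℝ) : Prop :=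
  ∃ (C : ℝ) (ζ η : Fin n → ℝ), 0 ≤ C ∧ ExponentsOK ζ η ∧
    ∀ᵐ t ∂(volume.restrict (Ioi (0 : ℝ))), ∀ z : S.DomA,
      MemLp (fun x => f (y t x + z.fn x) - f (y t x)) 2 S.mu ∧
      -(S.pairA0 (fun x => f (y t x + z.fn x) - f (y t x)) z) ≤
        C * ∑ i, z.normH ^ ζ i * z.normDA ^ η i

/-- The part of the third assumption that concerns `N_g(t,z) = g(y(t) + z) - g(y(t))`, with `n`
terms in the bound. -/
def BoundNg (S : Setting d) (n : ℕ) (g : E d → ℝ → ℝ) (y : ℝ → E d → ℝ) : Prop :=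
  ∃ (C : ℝ) (ζ η : Fin n → ℝ), 0 ≤ C ∧ ExponentsOK ζ η ∧
    ∀ᵐ t ∂(volume.restrict (Ioi (0 : ℝ))), ∀ z : S.DomA,
      S.MemDomADual (fun x => g x (y t x + z.fn x) - g x (y t x)) ∧
      -(∫ x, (g x (y t x + z.fn x) - g x (y t x)) * z.fn x ∂S.mu) ≤
        C * ∑ i, z.normH ^ ζ i * z.normDA ^ η i

/-- The assumption on `N_f` and `N_g` along the target `y`. -/
def AssumptionNfNg (S : Setting d) (f : ℝ → ℝ) (g : E d → ℝ → ℝ) (y : ℝ → E d → ℝ) : Prop :=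
  ∃ n : ℕ, 0 < n ∧ S.BoundNf n f y ∧ S.BoundNg n g y

/-- `y ∈ L^∞((0,∞) × Ω)`. -/
def EssBdd (S : Setting d) (y : ℝ → E d → ℝ) : Prop :=
  MemLp (Function.uncurry y) ∞ ((volume.restrict (Ioi (0 : ℝ))).prod S.mu)

/-- `y ∈ L^∞((0,∞) × Ω)` and `∇y ∈ L^∞((0,∞) × Ω)^d`, with `∇` the weak gradient in space. -/
def AssumptionYrBdd (S : Setting d) (y : ℝ → E d → ℝ) : Prop :=
  S.EssBdd y ∧ ∃ G : Fin d → ℝ → E d → ℝ, (∀ i, S.EssBdd (G i)) ∧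
    ∀ᵐ t ∂(volume.restrict (Ioi (0 : ℝ))), S.IsWeakGrad (y t) (fun i => G i t)

/-- The external force `h = (h₁, h₂)` is in `L²_loc(ℝ₊, V' × V')`. -/
def AssumptionH (S : Setting d) (h : ℝ → S.V' × S.V') : Prop :=
  ∀ T : ℝ, 0 < T → MemLp (fun t => (h t).1) 2 (volume.restrict (Ioo 0 T)) ∧
    MemLp (fun t => (h t).2) 2 (volume.restrict (Ioo 0 T))

end Setting

/-- The double-well potential `F(ζ) = τ (ζ² - 1)²`. -/
def doubleWell (τ : ℝ) (s : ℝ) : ℝ := τ * (s ^ 2 - 1) ^ 2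

/-- The double-well nonlinearity `f(ζ) = 4 τ (ζ³ - ζ)`. -/
def doubleWellNL (τ : ℝ) (s : ℝ) : ℝ := 4 * τ * (s ^ 3 - s)

/-- `g(w) = a₀ + a₁ w + a₂ w (|w| - 1)`, with coefficients depending on the point of space. -/
def gClass {d : ℕ} (a₀ a₁ a₂ : E d → ℝ) (x : E d) (w : ℝ) : ℝ :=
  a₀ x + a₁ x * w + a₂ x * w * (|w| - 1)

/-- The nonlinearity `g(w) - a₀ = a₁ w + a₂ w (|w| - 1)`. -/
def gBar {d : ℕ} (a₁ a₂ : E d → ℝ) (x : E d) (w : ℝ) : ℝ :=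
  a₁ x * w + a₂ x * w * (|w| - 1)

end CahnHilliard

end

/-!
Three facts about `V` and `D(A)` carry the estimates.

* The embedding `V → L⁶` for `d ≤ 3`. On a convex domain every point can be left along `d`
  independent directions that stay in the domain, so the Loomis–Whitney inequality of the slices
  bounds the `L^{d/(d-1)}` norm of a `C¹` function by its `W^{1,1}` norm; applied to `φ⁴` this gives
  the embedding on `C¹` functions. These are dense in `V`: on a convex domain, contract toward an
  interior point and mollify; on the torus, convolve with powers of `∏ cos²(π x_i / L_i)`.
* The Agmon inequality `‖v‖_∞² ≤ K ‖v‖_V ‖v‖_{D(A)}` on `D(A)`. No `H²` regularity is used: testing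
  `A v = h` with truncations of `v` starts a Stampacchia iteration on the superlevel sets of `v`.
* The weighted energy estimate `‖e ∇w‖² ≤ K ‖w‖_V ‖w‖_{D(A)} ‖e‖_V²`, from testing the equation of
  `w ∈ D(A)` with `e² w`. It replaces the missing integrability of `∇w` in the bound of
  `∇(f(v) - f(w)) = f'(v) ∇(v - w) + (f'(v) - f'(w)) ∇w`.

The cubic part of `f` and the quadratic part of `g` are monotone, so `-⟨A₀ v³, v⟩` and
`-⟨a₂ v |v|, v⟩` are nonpositive and only lower-order terms remain in the one-sided bounds.
-/

noncomputable section

open Filter Topology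
open scoped NNReal

namespace CahnHilliard

/-! ### The embedding of `V` into `L⁶` on `C¹` functions -/

section SobolevInequality

variable {X F : Type*} [NormedAddCommGroup X] [NormedSpace ℝ X] [NormedAddCommGroup F]
  [NormedSpace ℝ F]

lemma norm_zero_le_integral_norm_add_norm_deriv [CompleteSpace F] {ξ : ℝ → F}
    (hξ : ContDiff ℝ 1 ξ) : ‖ξ 0‖ ≤ ∫ s in (0 : ℝ)..1, (‖ξ s‖ + ‖deriv ξ s‖) := by
  have hderiv : Continuous (deriv ξ) := hξ.continuous_deriv le_rfl
  have hint : IntervalIntegrable (fun s => ‖ξ s‖) volume 0 1 :=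
    hξ.continuous.norm.intervalIntegrable _ _
  have hpointwise : ∀ s ∈ Icc (0 : ℝ) 1, ‖ξ 0‖ ≤ ‖ξ s‖ + ∫ t in (0 : ℝ)..1, ‖deriv ξ t‖ := by
    intro s hs
    have hftc : ∫ t in (0 : ℝ)..s, deriv ξ t = ξ s - ξ 0 :=
      intervalIntegral.integral_deriv_eq_sub
        (fun x _ => hξ.differentiable one_ne_zero x) (hderiv.intervalIntegrable _ _)
    calc ‖ξ 0‖ = ‖ξ s - ∫ t in (0 : ℝ)..s, deriv ξ t‖ := by rw [hftc, sub_sub_cancel]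
      _ ≤ ‖ξ s‖ + ‖∫ t in (0 : ℝ)..s, deriv ξ t‖ := norm_sub_le _ _
      _ ≤ ‖ξ s‖ + ∫ t in (0 : ℝ)..s, ‖deriv ξ t‖ := by
        gcongr
        exact intervalIntegral.norm_integral_le_integral_norm hs.1
      _ ≤ ‖ξ s‖ + ∫ t in (0 : ℝ)..1, ‖deriv ξ t‖ := by
        gcongr
        exact intervalIntegral.integral_mono_interval le_rfl hs.1 hs.2
          (Eventually.of_forall fun _ => norm_nonneg _) (hderiv.norm.intervalIntegrable _ _)
  calc ‖ξ 0‖ = ∫ _ in (0 : ℝ)..1, ‖ξ 0‖ := by simp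
    _ ≤ ∫ s in (0 : ℝ)..1, (‖ξ s‖ + ∫ t in (0 : ℝ)..1, ‖deriv ξ t‖) :=
      intervalIntegral.integral_mono_on zero_le_one (by simp) (hint.add (by simp)) hpointwise
    _ = ∫ s in (0 : ℝ)..1, (‖ξ s‖ + ‖deriv ξ s‖) := by
      rw [intervalIntegral.integral_add hint (by simp),
        intervalIntegral.integral_add hint (hderiv.norm.intervalIntegrable _ _)]
      simp

/-- The integrand `‖φ‖ + ‖Dφ‖` of the `W^{1,1}` norm, with values in `[0, ∞]` so that Tonelli's
theorem applies without integrability conditions. -/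
def jetENorm (φ : X → F) (x : X) : ℝ≥0∞ := ‖φ x‖ₑ + ‖fderiv ℝ φ x‖ₑ

lemma continuous_jetENorm {φ : X → F} (hφ : ContDiff ℝ 1 φ) : Continuous (jetENorm φ) :=
  hφ.continuous.enorm.add (hφ.continuous_fderiv one_ne_zero).enorm

lemma lintegral_jetENorm [MeasurableSpace X] [OpensMeasurableSpace X] {φ : X → F}
    (hφ : ContDiff ℝ 1 φ) (μ : Measure X) :
    ∫⁻ x, jetENorm φ x ∂μ = eLpNorm φ 1 μ + eLpNorm (fderiv ℝ φ) 1 μ := by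
  simp only [eLpNorm_one_eq_lintegral_enorm, jetENorm]
  exact lintegral_add_left hφ.continuous.enorm.measurable _

lemma jetENorm_comp_continuousLinearMap_le {Y : Type*} [NormedAddCommGroup Y] [NormedSpace ℝ Y]
    {φ : X → F} (hφ : Differentiable ℝ φ) (B : Y →L[ℝ] X) (y : Y) :
    jetENorm (φ ∘ B) y ≤ (1 + ‖B‖ₑ) * jetENorm φ (B y) := by
  have hderiv : ‖fderiv ℝ (φ ∘ B) y‖ₑ ≤ ‖fderiv ℝ φ (B y)‖ₑ * ‖B‖ₑ := by
    rw [fderiv_comp y (hφ (B y)) B.differentiableAt, B.fderiv, ← enorm_norm B,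
      ← enorm_norm (fderiv ℝ φ (B y)), ← enorm_mul]
    exact enorm_le_iff_norm_le.2 (by simpa using ContinuousLinearMap.opNorm_comp_le _ B)
  calc jetENorm (φ ∘ B) y ≤ ‖φ (B y)‖ₑ + ‖fderiv ℝ φ (B y)‖ₑ * ‖B‖ₑ := by
        unfold jetENorm; gcongr; rfl
    _ ≤ (‖φ (B y)‖ₑ + ‖fderiv ℝ φ (B y)‖ₑ * ‖B‖ₑ) +
        (‖φ (B y)‖ₑ * ‖B‖ₑ + ‖fderiv ℝ φ (B y)‖ₑ) := le_self_add
    _ = (1 + ‖B‖ₑ) * jetENorm φ (B y) := by rw [jetENorm]; ring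

lemma enorm_le_lintegral_jetENorm_segment [CompleteSpace F] {φ : X → F} (hφ : ContDiff ℝ 1 φ)
    (x θ : X) :
    ‖φ x‖ₑ ≤ (1 + ‖θ‖ₑ) * ∫⁻ s in Icc (0 : ℝ) 1, jetENorm φ (x + s • θ) := by
  set ξ : ℝ → F := fun s => φ (x + s • θ) with hξ_def
  have hline : ContDiff ℝ 1 fun s : ℝ => x + s • θ := by fun_prop
  have hξ : ContDiff ℝ 1 ξ := hφ.comp hline
  have hderiv : ∀ s, deriv ξ s = fderiv ℝ φ (x + s • θ) θ := fun s =>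
    ((hφ.differentiable one_ne_zero _).hasFDerivAt.comp_hasDerivAt s
      (by simpa using ((hasDerivAt_id s).smul_const θ).const_add x)).deriv
  have hcont : Continuous fun s => ‖ξ s‖ + ‖deriv ξ s‖ :=
    hξ.continuous.norm.add (hξ.continuous_deriv le_rfl).norm
  have hintegral : ‖φ x‖ ≤ ∫ s in Icc (0 : ℝ) 1, (‖ξ s‖ + ‖deriv ξ s‖) := by
    have := norm_zero_le_integral_norm_add_norm_deriv hξ
    rw [intervalIntegral.integral_of_le zero_le_one, ← integral_Icc_eq_integral_Ioc] at this
    simpa [hξ_def] using this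
  have hpointwise : ∀ s, ENNReal.ofReal (‖ξ s‖ + ‖deriv ξ s‖) ≤
      (1 + ‖θ‖ₑ) * jetENorm φ (x + s • θ) := by
    intro s
    rw [ENNReal.ofReal_add (norm_nonneg _) (norm_nonneg _), ofReal_norm, ofReal_norm, hderiv,
      jetENorm, add_mul, one_mul]
    have hop : ‖fderiv ℝ φ (x + s • θ) θ‖ₑ ≤ ‖θ‖ₑ * ‖fderiv ℝ φ (x + s • θ)‖ₑ := by
      rw [mul_comm]; exact ContinuousLinearMap.le_opENorm _ _
    exact add_le_add le_self_add (hop.trans (by gcongr; exact le_add_self))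
  calc ‖φ x‖ₑ = ENNReal.ofReal ‖φ x‖ := (ofReal_norm _).symm
    _ ≤ ∫⁻ s in Icc (0 : ℝ) 1, ENNReal.ofReal (‖ξ s‖ + ‖deriv ξ s‖) := by
      rw [← ofReal_integral_eq_lintegral_ofReal hcont.integrableOn_Icc
        (Eventually.of_forall fun s => by positivity)]
      exact ENNReal.ofReal_le_ofReal hintegral
    _ ≤ ∫⁻ s in Icc (0 : ℝ) 1, (1 + ‖θ‖ₑ) * jetENorm φ (x + s • θ) := lintegral_mono hpointwise
    _ = (1 + ‖θ‖ₑ) * ∫⁻ s in Icc (0 : ℝ) 1, jetENorm φ (x + s • θ) :=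
      lintegral_const_mul _ ((continuous_jetENorm hφ).comp hline.continuous).measurable

lemma eLpNorm_top_le_of_le_lintegral_update {G : Type*} [NormedAddCommGroup G]
    {ψ : (Fin 1 → ℝ) → G} {g : (Fin 1 → ℝ) → ℝ≥0∞}
    {s : Set (Fin 1 → ℝ)} {c : ℝ≥0∞} (hg : Measurable g) (hs : MeasurableSet s)
    (h : ∀ y ∈ s, ‖ψ y‖ₑ ≤ c * ∫⁻ t, g (Function.update y 0 t)) :
    eLpNorm ψ ⊤ (volume.restrict s) ≤ c * ∫⁻ y, g y := by
  have hline : ∀ y : Fin 1 → ℝ, ∫⁻ t, g (Function.update y 0 t) = ∫⁻ y, g y := fun y => by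
    refine (lintegral_congr fun t => congrArg g ?_).trans
      (((volume_preserving_funUnique (Fin 1) ℝ).symm _).lintegral_comp hg)
    ext j
    fin_cases j
    simp
  rw [eLpNorm_exponent_top]
  refine essSup_le_of_ae_le _ ((ae_restrict_iff' hs).2 (Eventually.of_forall fun y hy => ?_))
  exact (h y hy).trans_eq (by rw [hline])

lemma lintegral_rpow_le_of_le_lintegral_update {G : Type*} [NormedAddCommGroup G] {d : ℕ} {p : ℝ}
    (hp : Real.HolderConjugate d p) {ψ : (Fin d → ℝ) → G} {g : (Fin d → ℝ) → ℝ≥0∞}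
    {s : Set (Fin d → ℝ)} {c : ℝ≥0∞} (hc : c ≠ ⊤) (hg : Measurable g) (hs : MeasurableSet s)
    (h : ∀ y ∈ s, ∀ i, ‖ψ y‖ₑ ≤ c * ∫⁻ t, g (Function.update y i t)) :
    ∫⁻ y in s, ‖ψ y‖ₑ ^ p ≤ (c * ∫⁻ y, g y) ^ p := by
  have hd : (0 : ℝ) < (d : ℝ) - 1 := sub_pos.2 hp.lt
  have hp_eq : p = 1 / ((d : ℝ) - 1) * d := by rw [hp.conjugate_eq]; ring
  have hprod : ∀ a : ℝ≥0∞, a ^ p = ∏ _i : Fin d, a ^ ((1 : ℝ) / (d - 1)) := fun a => by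
    rw [Finset.prod_const, Finset.card_univ, Fintype.card_fin, ← ENNReal.rpow_natCast,
      ← ENNReal.rpow_mul, hp_eq]
  calc ∫⁻ y in s, ‖ψ y‖ₑ ^ p
      ≤ ∫⁻ y in s, c ^ p * ∏ i, (∫⁻ t, g (Function.update y i t)) ^ ((1 : ℝ) / (d - 1)) := by
        refine setLIntegral_mono' hs fun y hy => ?_
        rw [hprod, hprod, ← Finset.prod_mul_distrib]
        refine Finset.prod_le_prod' fun i _ => ?_
        rw [← ENNReal.mul_rpow_of_nonneg _ _ (by positivity)]
        exact ENNReal.rpow_le_rpow (h y hy i) (by positivity)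
    _ ≤ ∫⁻ y, c ^ p * ∏ i, (∫⁻ t, g (Function.update y i t)) ^ ((1 : ℝ) / (d - 1)) :=
        setLIntegral_le_lintegral _ _
    _ = c ^ p * ∫⁻ y, ∏ i, (∫⁻ t, g (Function.update y i t)) ^ ((1 : ℝ) / (d - 1)) :=
        lintegral_const_mul' _ _ (ENNReal.rpow_ne_top_of_nonneg hp.symm.nonneg hc)
    _ ≤ c ^ p * (∫⁻ y, g y) ^ p := by
        gcongr
        simpa only [Fintype.card_fin, volume_pi] using lintegral_prod_lintegral_pow_le
          (fun _ : Fin d => (volume : Measure ℝ)) (by simpa using hp) hg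
    _ = (c * ∫⁻ y, g y) ^ p := (ENNReal.mul_rpow_of_nonneg _ _ hp.symm.nonneg).symm

lemma eLpNorm_conjExponent_le_of_le_lintegral_update {G : Type*} [NormedAddCommGroup G] {d : ℕ}
    (hd : 1 ≤ d) {ψ : (Fin d → ℝ) → G} {g : (Fin d → ℝ) → ℝ≥0∞} {s : Set (Fin d → ℝ)} {c : ℝ≥0∞}
    (hc : c ≠ ⊤) (hg : Measurable g) (hs : MeasurableSet s)
    (h : ∀ y ∈ s, ∀ i, ‖ψ y‖ₑ ≤ c * ∫⁻ t, g (Function.update y i t)) :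
    eLpNorm ψ (ENNReal.conjExponent d) (volume.restrict s) ≤ c * ∫⁻ y, g y := by
  rcases hd.eq_or_lt with rfl | hd
  · simpa [ENNReal.conjExponent] using
      eLpNorm_top_le_of_le_lintegral_update hg hs fun y hy => h y hy 0
  · have hd' : (1 : ℝ≥0) < d := by exact_mod_cast hd
    have hconj : NNReal.HolderConjugate d (NNReal.conjExponent d) := .conjExponent hd'
    have hp : ENNReal.conjExponent d = (NNReal.conjExponent d : ℝ≥0) := by
      simpa using (ENNReal.coe_conjExponent hd').symm
    rw [hp, eLpNorm_nnreal_eq_lintegral hconj.symm.ne_zero, one_div,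
      ENNReal.rpow_inv_le_iff (by exact_mod_cast hconj.symm.pos)]
    exact lintegral_rpow_le_of_le_lintegral_update (by simpa using hconj.coe) hc hg hs h

lemma eLpNorm_le_lintegral_jetENorm_of_add_smul_single_mem [CompleteSpace F] {d : ℕ} (hd : 1 ≤ d)
    {s Ω : Set (Fin d → ℝ)} (hs : MeasurableSet s) (hΩ : MeasurableSet Ω)
    (h : ∀ y ∈ s, ∀ i, ∀ t ∈ Icc (0 : ℝ) 1, y + t • Pi.single i 1 ∈ Ω)
    {ψ : (Fin d → ℝ) → F} (hψ : ContDiff ℝ 1 ψ) :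
    eLpNorm ψ (ENNReal.conjExponent d) (volume.restrict s) ≤ 2 * ∫⁻ y in Ω, jetENorm ψ y := by
  rw [← lintegral_indicator hΩ]
  refine eLpNorm_conjExponent_le_of_le_lintegral_update hd ENNReal.ofNat_ne_top
    ((continuous_jetENorm hψ).measurable.indicator hΩ) hs fun y hy i => ?_
  have hupdate : ∀ t, Function.update y i (t + y i) = y + t • Pi.single i 1 := fun t => by
    ext j
    by_cases hj : j = i
    · subst hj; simp [add_comm]
    · simp [hj]
  calc ‖ψ y‖ₑ
      ≤ (1 + ‖(Pi.single i 1 : Fin d → ℝ)‖ₑ) *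
          ∫⁻ t in Icc (0 : ℝ) 1, jetENorm ψ (y + t • Pi.single i 1) :=
        enorm_le_lintegral_jetENorm_segment hψ y _
    _ = 2 * ∫⁻ t in Icc (0 : ℝ) 1, Ω.indicator (jetENorm ψ) (Function.update y i (t + y i)) := by
        congr 1
        · rw [← enorm_norm, Pi.norm_single]; norm_num
        · refine setLIntegral_congr_fun measurableSet_Icc fun t ht => ?_
          rw [hupdate, indicator_of_mem (h y hy i t ht)]
    _ ≤ 2 * ∫⁻ t, Ω.indicator (jetENorm ψ) (Function.update y i (t + y i)) := by
        gcongr; exact Measure.restrict_le_self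
    _ = 2 * ∫⁻ t, Ω.indicator (jetENorm ψ) (Function.update y i t) := by
        rw [lintegral_add_right_eq_self (fun t => Ω.indicator (jetENorm ψ) (Function.update y i t))]

lemma exists_smul_map_eq_of_isAddHaarMeasure {Y : Type*} [NormedAddCommGroup Y] [NormedSpace ℝ Y]
    [FiniteDimensional ℝ X] [MeasurableSpace X] [BorelSpace X] [MeasurableSpace Y] [BorelSpace Y]
    (B : Y ≃L[ℝ] X) (μ : Measure X) [μ.IsAddHaarMeasure] (ν : Measure Y) [ν.IsAddHaarMeasure] :
    ∃ κ : ℝ≥0, κ ≠ 0 ∧ μ = κ • ν.map B := by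
  have : (ν.map B).IsAddHaarMeasure := B.isAddHaarMeasure_map ν
  exact ⟨Measure.addHaarScalarFactor μ (ν.map B),
    (Measure.addHaarScalarFactor_pos_of_isAddHaarMeasure μ _).ne',
    Measure.isAddLeftInvariant_eq_smul _ _⟩

lemma exists_eLpNorm_le_lintegral_jetENorm_of_add_smul_mem [CompleteSpace F] {d : ℕ} (hd : 1 ≤ d)
    {s Ω : Set (E d)} (hs : MeasurableSet s) (hΩ : MeasurableSet Ω) (B : (Fin d → ℝ) ≃L[ℝ] E d)
    (hB : ∀ x ∈ s, ∀ i, ∀ t ∈ Icc (0 : ℝ) 1, x + t • B (Pi.single i 1) ∈ Ω) :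
    ∃ C : ℝ≥0, ∀ φ : E d → F, ContDiff ℝ 1 φ →
      eLpNorm φ (ENNReal.conjExponent d) (volume.restrict s) ≤ C * ∫⁻ x in Ω, jetENorm φ x := by
  obtain ⟨κ, hκ, hvol⟩ := exists_smul_map_eq_of_isAddHaarMeasure B volume volume
  have hBm : Measurable B := B.continuous.measurable
  set p := ENNReal.conjExponent d
  refine ⟨κ ^ (1 / p).toReal * 2 * (1 + ‖(B : (Fin d → ℝ) →L[ℝ] E d)‖₊) * κ⁻¹, fun φ hφ => ?_⟩
  have hcoord : eLpNorm (φ ∘ B) p (volume.restrict (B ⁻¹' s)) ≤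
      2 * ∫⁻ y in B ⁻¹' Ω, jetENorm (φ ∘ B) y :=
    eLpNorm_le_lintegral_jetENorm_of_add_smul_single_mem hd (hBm hs) (hBm hΩ)
      (fun y hy i t ht => by simpa using hB _ hy i t ht) (hφ.comp B.contDiff)
  have hchange : ∫⁻ y in B ⁻¹' Ω, jetENorm φ (B y) = (κ⁻¹ : ℝ≥0) * ∫⁻ x in Ω, jetENorm φ x := by
    rw [hvol, Measure.restrict_smul, Measure.restrict_map hBm hΩ, lintegral_smul_measure,
      lintegral_map (continuous_jetENorm hφ).measurable hBm, ENNReal.smul_def, smul_eq_mul,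
      ← mul_assoc, ← ENNReal.coe_mul, inv_mul_cancel₀ hκ, ENNReal.coe_one,
      one_mul]
  calc eLpNorm φ p (volume.restrict s)
      = κ ^ (1 / p).toReal * eLpNorm (φ ∘ B) p (volume.restrict (B ⁻¹' s)) := by
        rw [hvol, Measure.restrict_smul, Measure.restrict_map hBm hs,
          eLpNorm_smul_measure_of_ne_zero' hκ,
          eLpNorm_map_measure hφ.continuous.aestronglyMeasurable hBm.aemeasurable]
        simp [ENNReal.smul_def, ENNReal.coe_rpow_of_ne_zero hκ]
    _ ≤ κ ^ (1 / p).toReal * (2 * ∫⁻ y in B ⁻¹' Ω,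
          (1 + ‖(B : (Fin d → ℝ) →L[ℝ] E d)‖ₑ) * jetENorm φ (B y)) := by
        gcongr
        refine hcoord.trans ?_
        gcongr with y
        exact jetENorm_comp_continuousLinearMap_le (hφ.differentiable one_ne_zero)
          (B : (Fin d → ℝ) →L[ℝ] E d) y
    _ = _ := by
        rw [lintegral_const_mul' _ _ (by simp), hchange]
        push_cast [ENNReal.coe_rpow_of_ne_zero hκ]
        rw [enorm_eq_nnnorm]
        ring

lemma injective_smul_add_sum_smul {d : ℕ} {ρ : ℝ} (a : E d) (hρ : ρ ≠ 0) (ha : ρ + ∑ i, a i ≠ 0) :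
    Function.Injective (ρ • (WithLp.linearEquiv 2 ℝ (Fin d → ℝ)).symm.toLinearMap +
      (∑ i, LinearMap.proj i : (Fin d → ℝ) →ₗ[ℝ] ℝ).smulRight a) := by
  rw [injective_iff_map_eq_zero]
  intro y hy
  have hcoord : ∀ i, ρ * y i + (∑ j, y j) * a i = 0 := fun i => by
    simpa using congrArg (fun z : E d => z i) hy
  have hsum : ∑ j, y j = 0 := by
    have htotal : ∑ i, (ρ * y i + (∑ j, y j) * a i) = 0 := Finset.sum_eq_zero fun i _ => hcoord i
    rw [Finset.sum_add_distrib, ← Finset.mul_sum, ← Finset.mul_sum] at htotal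
    refine (mul_eq_zero.1 ?_).resolve_left ha
    linear_combination htotal
  ext i
  simpa [hsum, hρ] using hcoord i

lemma exists_equiv_single_eq_add_smul {d : ℕ} (a : E d) {r : ℝ} (hr : 0 < r) :
    ∃ ρ ∈ Ioo 0 r, ∃ B : (Fin d → ℝ) ≃L[ℝ] E d,
      ∀ i, B (Pi.single i 1) = a + ρ • EuclideanSpace.single i 1 := by
  obtain ⟨ρ, ⟨hρ, hρr⟩, hne⟩ : ∃ ρ ∈ Ioo 0 r, ρ + ∑ i, a i ≠ 0 := by
    by_cases h : r / 2 + ∑ i, a i = 0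
    · exact ⟨r / 4, ⟨by linarith, by linarith⟩, fun h' => by linarith⟩
    · exact ⟨r / 2, ⟨by linarith, by linarith⟩, h⟩
  refine ⟨ρ, ⟨hρ, hρr⟩, (LinearEquiv.ofInjectiveOfFinrankEq _
    (injective_smul_add_sum_smul a hρ.ne' hne) (by simp)).toContinuousLinearEquiv, fun i => ?_⟩
  ext j
  change ρ * (Pi.single i 1 : Fin d → ℝ) j + (∑ k, LinearMap.proj k : (Fin d → ℝ) →ₗ[ℝ] ℝ)
    (Pi.single i 1) * a j = _
  simp [Pi.single_apply, add_comm]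

lemma eLpNorm_add_measure_le {α G : Type*} [MeasurableSpace α] [NormedAddCommGroup G] {p : ℝ≥0∞}
    (hp : 1 ≤ p) (f : α → G) (μ ν : Measure α) :
    eLpNorm f p (μ + ν) ≤ eLpNorm f p μ + eLpNorm f p ν := by
  by_cases htop : p = ⊤
  · subst htop
    simp only [eLpNorm_exponent_top]
    refine essSup_le_of_ae_le _ (ae_add_measure_iff.2 ⟨?_, ?_⟩)
    · exact (enorm_ae_le_eLpNormEssSup f μ).mono fun x hx => hx.trans le_self_add
    · exact (enorm_ae_le_eLpNormEssSup f ν).mono fun x hx => hx.trans le_add_self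
  · have hp' : 1 ≤ p.toReal := by simpa using ENNReal.toReal_mono htop hp
    simp only [eLpNorm_eq_lintegral_rpow_enorm_toReal (one_pos.trans_le hp).ne' htop,
      lintegral_add_measure]
    exact ENNReal.rpow_add_le_add_rpow _ _ (by positivity) (div_le_one_of_le₀ hp' (by positivity))

lemma exists_eLpNorm_le_lintegral_jetENorm_inter_ball [CompleteSpace F] {d : ℕ} (hd : 1 ≤ d)
    {Ω : Set (E d)} (ho : IsOpen Ω) (hconv : Convex ℝ Ω) {x₀ : E d} {r : ℝ} (hr : 0 < r)
    (hball : Metric.ball x₀ r ⊆ Ω) (c : E d) :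
    ∃ C : ℝ≥0, ∀ φ : E d → F, ContDiff ℝ 1 φ →
      eLpNorm φ (ENNReal.conjExponent d) (volume.restrict (Ω ∩ Metric.ball c (r / 2))) ≤
        C * ∫⁻ x in Ω, jetENorm φ x := by
  obtain ⟨ρ, ⟨hρ, hρr⟩, B, hB⟩ := exists_equiv_single_eq_add_smul (x₀ - c) (half_pos hr)
  refine exists_eLpNorm_le_lintegral_jetENorm_of_add_smul_mem hd
    (ho.measurableSet.inter measurableSet_ball) ho.measurableSet B fun x hx i s hs => ?_
  refine hconv.add_smul_mem hx.1 (hball ?_) hs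
  have hxc : ‖x - c‖ < r / 2 := by simpa [dist_eq_norm] using hx.2
  have hstep : ‖ρ • (EuclideanSpace.single i 1 : E d)‖ = ρ := by simp [norm_smul, abs_of_pos hρ]
  rw [hB, Metric.mem_ball, dist_eq_norm]
  calc ‖x + (x₀ - c + ρ • EuclideanSpace.single i 1) - x₀‖
      = ‖(x - c) + ρ • EuclideanSpace.single i 1‖ := by congr 1; abel
    _ ≤ ‖x - c‖ + ‖ρ • (EuclideanSpace.single i 1 : E d)‖ := norm_add_le _ _
    _ < r := by linarith

/- Near each point of the closure, `d` independent directions lead into a fixed interior ball, so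
finitely many patches suffice by compactness; no boundary charts are needed. -/
theorem exists_eLpNorm_le_lintegral_jetENorm_of_convex [CompleteSpace F] {d : ℕ} (hd : 1 ≤ d)
    {Ω : Set (E d)} (ho : IsOpen Ω) (hb : Bornology.IsBounded Ω) (hconv : Convex ℝ Ω) :
    ∃ C : ℝ≥0, ∀ φ : E d → F, ContDiff ℝ 1 φ →
      eLpNorm φ (ENNReal.conjExponent d) (volume.restrict Ω) ≤ C * ∫⁻ x in Ω, jetENorm φ x := by
  rcases Ω.eq_empty_or_nonempty with rfl | ⟨x₀, hx₀⟩
  · exact ⟨0, by simp⟩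
  obtain ⟨r, hr, hball⟩ := Metric.isOpen_iff.1 ho x₀ hx₀
  set p := ENNReal.conjExponent d
  suffices h : ∃ C : ℝ≥0, ∀ φ : E d → F, ContDiff ℝ 1 φ →
      eLpNorm φ p (volume.restrict (Ω ∩ closure Ω)) ≤ C * ∫⁻ x in Ω, jetENorm φ x by
    rwa [inter_eq_left.2 subset_closure] at h
  refine hb.isCompact_closure.induction_on (p := fun s => ∃ C : ℝ≥0, ∀ φ : E d → F,
    ContDiff ℝ 1 φ → eLpNorm φ p (volume.restrict (Ω ∩ s)) ≤ C * ∫⁻ x in Ω, jetENorm φ x)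
    ⟨0, by simp⟩ ?_ ?_ ?_
  · rintro s t hst ⟨C, hC⟩
    exact ⟨C, fun φ hφ => (eLpNorm_mono_measure _ (Measure.restrict_mono
      (inter_subset_inter_right _ hst) le_rfl)).trans (hC φ hφ)⟩
  · rintro s t ⟨C, hC⟩ ⟨C', hC'⟩
    refine ⟨C + C', fun φ hφ => ?_⟩
    calc eLpNorm φ p (volume.restrict (Ω ∩ (s ∪ t)))
        ≤ eLpNorm φ p (volume.restrict (Ω ∩ s) + volume.restrict (Ω ∩ t)) := by
          rw [inter_union_distrib_left]
          exact eLpNorm_mono_measure _ (Measure.restrict_union_le _ _)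
      _ ≤ eLpNorm φ p (volume.restrict (Ω ∩ s)) + eLpNorm φ p (volume.restrict (Ω ∩ t)) :=
          eLpNorm_add_measure_le (by simp [p, ENNReal.conjExponent]) _ _ _
      _ ≤ C * (∫⁻ x in Ω, jetENorm φ x) + C' * ∫⁻ x in Ω, jetENorm φ x :=
          add_le_add (hC φ hφ) (hC' φ hφ)
      _ = (C + C' : ℝ≥0) * ∫⁻ x in Ω, jetENorm φ x := by push_cast; rw [add_mul]
  · intro c _
    exact ⟨Metric.ball c (r / 2), mem_nhdsWithin_of_mem_nhds (Metric.ball_mem_nhds _ (half_pos hr)),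
      exists_eLpNorm_le_lintegral_jetENorm_inter_ball hd ho hconv hr hball c⟩

lemma eLpNorm_pow {α : Type*} [MeasurableSpace α] (φ : α → ℝ) {n : ℕ} (hn : n ≠ 0) (p : ℝ≥0∞)
    (μ : Measure α) : eLpNorm (fun x => φ x ^ n) p μ = eLpNorm φ (p * n) μ ^ n := by
  have hnorm := eLpNorm_norm_rpow (p := p) (μ := μ) φ (by positivity : (0 : ℝ) < n)
  simp only [Real.rpow_natCast, ← norm_pow, eLpNorm_norm, ENNReal.ofReal_natCast,
    ENNReal.rpow_natCast] at hnorm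
  exact hnorm

lemma eLpNorm_pow_smul_le {α : Type*} [MeasurableSpace α] {μ : Measure α} {φ : α → ℝ} {h : α → F}
    {n : ℕ} (hn : n ≠ 0) (hφ : AEStronglyMeasurable φ μ) (hh : AEStronglyMeasurable h μ) :
    eLpNorm (fun x => φ x ^ n • h x) 1 μ ≤ eLpNorm φ (2 * n) μ ^ n * eLpNorm h 2 μ := by
  rw [← eLpNorm_pow φ hn]
  exact eLpNorm_smul_le_mul_eLpNorm hh (hφ.pow n)

section PowJet

variable {X : Type*} [NormedAddCommGroup X] [NormedSpace ℝ X] [MeasurableSpace X]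
  [OpensMeasurableSpace X] [SecondCountableTopology X] {φ : X → ℝ} {n : ℕ}

lemma eLpNorm_fderiv_pow_succ_le (hφ : ContDiff ℝ 1 φ) (hn : n ≠ 0) (μ : Measure X) :
    eLpNorm (fderiv ℝ fun x => φ x ^ (n + 1)) 1 μ ≤
      (n + 1) * (eLpNorm φ (2 * n) μ ^ n * eLpNorm (fderiv ℝ φ) 2 μ) := by
  have hfderiv : ∀ x, ‖fderiv ℝ (fun x => φ x ^ (n + 1)) x‖ ≤
      ((n + 1 : ℕ) : ℝ) * ‖φ x ^ n • fderiv ℝ φ x‖ := fun x => by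
    rw [((hφ.differentiable one_ne_zero x).hasFDerivAt.pow (n + 1)).fderiv, Nat.add_sub_cancel,
      nsmul_eq_mul, ← smul_smul, norm_smul, Real.norm_natCast]
  refine (eLpNorm_le_mul_eLpNorm_of_ae_le_mul (Eventually.of_forall hfderiv) 1).trans ?_
  rw [ENNReal.ofReal_natCast, Nat.cast_succ]
  gcongr
  exact eLpNorm_pow_smul_le (φ := φ) (h := fderiv ℝ φ) hn hφ.continuous.aestronglyMeasurable
    (hφ.continuous_fderiv one_ne_zero).aestronglyMeasurable

lemma lintegral_jetENorm_pow_succ_le (hφ : ContDiff ℝ 1 φ) (hn : n ≠ 0) (μ : Measure X) :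
    ∫⁻ x, jetENorm (fun x => φ x ^ (n + 1)) x ∂μ ≤
      (n + 1) * (eLpNorm φ (2 * n) μ ^ n * (eLpNorm φ 2 μ + eLpNorm (fderiv ℝ φ) 2 μ)) := by
  have hφm : AEStronglyMeasurable φ μ := hφ.continuous.aestronglyMeasurable
  have hvalue : eLpNorm (fun x => φ x ^ (n + 1)) 1 μ ≤ eLpNorm φ (2 * n) μ ^ n * eLpNorm φ 2 μ := by
    simpa only [pow_succ, smul_eq_mul] using eLpNorm_pow_smul_le hn hφm hφm
  rw [lintegral_jetENorm (hφ.pow _), mul_add, mul_add]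
  exact add_le_add (hvalue.trans (le_mul_of_one_le_left zero_le le_add_self))
    (eLpNorm_fderiv_pow_succ_le hφ hn μ)

end PowJet

lemma three_halves_le_conjExponent {d : ℕ} (hd : d ≤ 3) :
    3 / 2 ≤ ENNReal.conjExponent d := by
  have hsub : (d : ℝ≥0∞) - 1 ≤ 2 := by
    rw [tsub_le_iff_right]
    exact_mod_cast hd
  calc (3 / 2 : ℝ≥0∞) = 1 + 2⁻¹ := by
        rw [show (3 : ℝ≥0∞) = 2 + 1 by norm_num, ENNReal.add_div,
          ENNReal.div_self two_ne_zero ENNReal.ofNat_ne_top, one_div]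
    _ ≤ ENNReal.conjExponent d := add_le_add le_rfl (ENNReal.inv_le_inv.2 hsub)

lemma memLp_restrict_of_isBounded {G : Type*} [NormedAddCommGroup G] {d : ℕ} {φ : E d → G}
    (hφ : Continuous φ) {s : Set (E d)} (hs : MeasurableSet s) (hb : Bornology.IsBounded s)
    (p : ℝ≥0∞) : MemLp φ p (volume.restrict s) := by
  have : IsFiniteMeasure (volume.restrict s) := ⟨by simpa using hb.measure_lt_top⟩
  obtain ⟨K, hK⟩ := hb.isCompact_closure.exists_bound_of_continuousOn hφ.continuousOn
  exact .of_bound hφ.aestronglyMeasurable K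
    ((ae_restrict_iff' hs).2 (Eventually.of_forall fun x hx => hK x (subset_closure hx)))

/- Apply the embedding of `W^{1,1}` to `φ⁴` and cancel `‖φ‖₆³`. -/
theorem exists_eLpNorm_six_le_of_convex {d : ℕ} (hd : 1 ≤ d) (hd3 : d ≤ 3) {Ω : Set (E d)}
    (ho : IsOpen Ω) (hb : Bornology.IsBounded Ω) (hconv : Convex ℝ Ω) :
    ∃ C : ℝ≥0, ∀ φ : E d → ℝ, ContDiff ℝ 1 φ →
      eLpNorm φ 6 (volume.restrict Ω) ≤ C * (eLpNorm φ 2 (volume.restrict Ω) +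
        eLpNorm (fderiv ℝ φ) 2 (volume.restrict Ω)) := by
  set μ := volume.restrict Ω with hμ
  have : IsFiniteMeasure μ := ⟨by simpa [hμ] using hb.measure_lt_top⟩
  obtain ⟨C, hC⟩ := exists_eLpNorm_le_lintegral_jetENorm_of_convex (F := ℝ) hd ho hb hconv
  set V : ℝ≥0∞ := μ univ ^ (1 / (3 / 2 : ℝ≥0∞).toReal - 1 / (ENNReal.conjExponent d).toReal)
  have hV : V ≠ ⊤ := by
    refine ENNReal.rpow_ne_top_of_nonneg (sub_nonneg.2 ?_) (measure_ne_top _ _)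
    rcases eq_or_ne (ENNReal.conjExponent d) ⊤ with htop | htop
    · norm_num [htop]
    · exact one_div_le_one_div_of_le (by norm_num)
        (ENNReal.toReal_mono htop (three_halves_le_conjExponent hd3))
  refine ⟨C * 4 * V.toNNReal, fun φ hφ => ?_⟩
  have hfin : eLpNorm φ 6 μ ≠ ⊤ :=
    (memLp_restrict_of_isBounded hφ.continuous ho.measurableSet hb 6).eLpNorm_ne_top
  rcases eq_or_ne (eLpNorm φ 6 μ) 0 with hzero | hzero
  · rw [hzero]; exact zero_le
  have hpow : eLpNorm φ 6 μ ^ 4 = eLpNorm (fun x => φ x ^ 4) (3 / 2) μ := by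
    rw [eLpNorm_pow φ four_ne_zero]
    congr 2
    rw [← ENNReal.toReal_eq_toReal_iff' (by simp) (by finiteness)]
    norm_num
  rw [← ENNReal.mul_le_mul_iff_right (pow_ne_zero 3 hzero) (ENNReal.pow_ne_top hfin)]
  calc eLpNorm φ 6 μ ^ 3 * eLpNorm φ 6 μ = eLpNorm (fun x => φ x ^ 4) (3 / 2) μ := by
        rw [← hpow, pow_succ _ 3]
    _ ≤ eLpNorm (fun x => φ x ^ 4) (ENNReal.conjExponent d) μ * V := by
        exact eLpNorm_le_eLpNorm_mul_rpow_measure_univ (three_halves_le_conjExponent hd3)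
          (hφ.continuous.pow 4).aestronglyMeasurable
    _ ≤ C * (∫⁻ x in Ω, jetENorm (fun x => φ x ^ 4) x) * V := by
        gcongr
        exact hC _ (hφ.pow 4)
    _ ≤ C * (4 * (eLpNorm φ 6 μ ^ 3 * (eLpNorm φ 2 μ + eLpNorm (fderiv ℝ φ) 2 μ))) * V := by
        gcongr
        have := lintegral_jetENorm_pow_succ_le hφ three_ne_zero μ
        norm_num at this
        exact this
    _ = eLpNorm φ 6 μ ^ 3 *
        ((C * 4 * V.toNNReal : ℝ≥0) * (eLpNorm φ 2 μ + eLpNorm (fderiv ℝ φ) 2 μ)) := by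
        push_cast
        rw [ENNReal.coe_toNNReal hV]
        ring

end SobolevInequality

/-! ### Approximation by `C¹` functions -/

section SchurTest

variable {α β : Type*} [MeasurableSpace α] [MeasurableSpace β] {μ : Measure α} {ν : Measure β}

lemma eLpNorm_two_sq {G : Type*} [NormedAddCommGroup G] (f : α → G) (μ : Measure α) :
    eLpNorm f 2 μ ^ 2 = ∫⁻ x, ‖f x‖ₑ ^ 2 ∂μ := by
  simpa using eLpNorm_nnreal_pow_eq_lintegral (f := f) (μ := μ) (p := 2) two_ne_zero

lemma sq_lintegral_mul_le {f w : α → ℝ≥0∞} (hf : AEMeasurable f μ) (hw : AEMeasurable w μ) :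
    (∫⁻ x, f x * w x ∂μ) ^ 2 ≤ (∫⁻ x, w x ∂μ) * ∫⁻ x, f x ^ 2 * w x ∂μ := by
  have hsqrt : ∀ a : ℝ≥0∞, (a ^ (1 / 2 : ℝ)) ^ 2 = a := fun a => by
    rw [← ENNReal.rpow_natCast, ← ENNReal.rpow_mul]
    norm_num
  have hsplit : ∀ x, f x * w x = w x ^ (1 / 2 : ℝ) * (f x * w x ^ (1 / 2 : ℝ)) := fun x => by
    conv_lhs => rw [← hsqrt (w x)]
    ring
  have hholder := ENNReal.lintegral_mul_le_Lp_mul_Lq μ Real.HolderConjugate.two_two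
    (hw.pow_const (1 / 2 : ℝ)) (hf.mul (hw.pow_const (1 / 2 : ℝ)))
  simp only [ENNReal.rpow_ofNat, Pi.mul_apply, mul_pow, hsqrt, ← hsplit] at hholder
  calc (∫⁻ x, f x * w x ∂μ) ^ 2
      ≤ ((∫⁻ x, w x ∂μ) ^ (1 / 2 : ℝ) * (∫⁻ x, f x ^ 2 * w x ∂μ) ^ (1 / 2 : ℝ)) ^ 2 := by
        gcongr
    _ = (∫⁻ x, w x ∂μ) * ∫⁻ x, f x ^ 2 * w x ∂μ := by rw [mul_pow, hsqrt, hsqrt]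

theorem eLpNorm_integral_mul_sq_le [SFinite μ] [SFinite ν] {K : α → β → ℝ}
    (hK : Measurable (Function.uncurry K)) {A B : ℝ≥0∞}
    (hrow : ∀ᵐ x ∂μ, ∫⁻ y, ‖K x y‖ₑ ∂ν ≤ A) (hcol : ∀ᵐ y ∂ν, ∫⁻ x, ‖K x y‖ₑ ∂μ ≤ B)
    {f : β → ℝ} (hf : AEStronglyMeasurable f ν) :
    eLpNorm (fun x => ∫ y, f y * K x y ∂ν) 2 μ ^ 2 ≤ A * B * eLpNorm f 2 ν ^ 2 := by
  have hpointwise : ∀ᵐ x ∂μ, ‖∫ y, f y * K x y ∂ν‖ₑ ^ 2 ≤ ∫⁻ y, A * (‖f y‖ₑ ^ 2 * ‖K x y‖ₑ) ∂ν := by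
    filter_upwards [hrow] with x hx
    have hKx : AEMeasurable (fun y => ‖K x y‖ₑ) ν :=
      (hK.comp measurable_prodMk_left).enorm.aemeasurable
    calc ‖∫ y, f y * K x y ∂ν‖ₑ ^ 2 ≤ (∫⁻ y, ‖f y‖ₑ * ‖K x y‖ₑ ∂ν) ^ 2 := by
          gcongr
          simpa only [enorm_mul] using enorm_integral_le_lintegral_enorm fun y => f y * K x y
      _ ≤ (∫⁻ y, ‖K x y‖ₑ ∂ν) * ∫⁻ y, ‖f y‖ₑ ^ 2 * ‖K x y‖ₑ ∂ν := sq_lintegral_mul_le hf.enorm hKx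
      _ ≤ A * ∫⁻ y, ‖f y‖ₑ ^ 2 * ‖K x y‖ₑ ∂ν := by gcongr
      _ = ∫⁻ y, A * (‖f y‖ₑ ^ 2 * ‖K x y‖ₑ) ∂ν :=
          (lintegral_const_mul'' _ ((hf.enorm.pow_const 2).mul hKx)).symm
  rw [eLpNorm_two_sq, eLpNorm_two_sq]
  calc ∫⁻ x, ‖∫ y, f y * K x y ∂ν‖ₑ ^ 2 ∂μ
      ≤ ∫⁻ x, ∫⁻ y, A * (‖f y‖ₑ ^ 2 * ‖K x y‖ₑ) ∂ν ∂μ := lintegral_mono_ae hpointwise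
    _ = ∫⁻ y, ∫⁻ x, A * (‖f y‖ₑ ^ 2 * ‖K x y‖ₑ) ∂μ ∂ν := by
        refine lintegral_lintegral_swap (AEMeasurable.const_mul (AEMeasurable.mul ?_ ?_) A)
        · exact (hf.enorm.pow_const 2).comp_quasiMeasurePreserving
            Measure.quasiMeasurePreserving_snd
        · exact hK.enorm.aemeasurable
    _ = ∫⁻ y, A * (‖f y‖ₑ ^ 2 * ∫⁻ x, ‖K x y‖ₑ ∂μ) ∂ν := by
        refine lintegral_congr fun y => ?_
        have hKy : Measurable fun x => ‖K x y‖ₑ := (hK.comp measurable_prodMk_right).enorm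
        rw [lintegral_const_mul _ (hKy.const_mul _), lintegral_const_mul _ hKy]
    _ ≤ ∫⁻ y, A * B * ‖f y‖ₑ ^ 2 ∂ν := by
        refine lintegral_mono_ae (hcol.mono fun y hy => ?_)
        calc A * (‖f y‖ₑ ^ 2 * ∫⁻ x, ‖K x y‖ₑ ∂μ) ≤ A * (‖f y‖ₑ ^ 2 * B) := by gcongr
          _ = A * B * ‖f y‖ₑ ^ 2 := by ring
    _ = A * B * ∫⁻ y, ‖f y‖ₑ ^ 2 ∂ν := lintegral_const_mul'' _ (hf.enorm.pow_const 2)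

end SchurTest

section ApproximateIdentity

lemma tendsto_eLpNorm_zero_of_dominated {α G : Type*} [MeasurableSpace α] [NormedAddCommGroup G]
    {μ : Measure α} {p : ℝ≥0∞} (hp : p ≠ ⊤) {h : ℕ → α → G} {b : α → ℝ}
    (hm : ∀ n, AEStronglyMeasurable (h n) μ) (hb : MemLp b p μ) (hle : ∀ n, ∀ᵐ x ∂μ, ‖h n x‖ ≤ b x)
    (hlim : ∀ᵐ x ∂μ, Tendsto (fun n => h n x) atTop (𝓝 0)) :
    Tendsto (fun n => eLpNorm (h n) p μ) atTop (𝓝 0) := by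
  rcases eq_or_ne p 0 with rfl | hp0
  · simp
  have hp_pos : 0 < p.toReal := ENNReal.toReal_pos hp0 hp
  have hlintegral : Tendsto (fun n => ∫⁻ x, ‖h n x‖ₑ ^ p.toReal ∂μ) atTop (𝓝 (∫⁻ _, 0 ∂μ)) := by
    refine tendsto_lintegral_of_dominated_convergence' (fun x => ‖b x‖ₑ ^ p.toReal)
      (fun n => (hm n).enorm.pow_const _) (fun n => ?_) ?_ ?_
    · filter_upwards [hle n] with x hx
      exact ENNReal.rpow_le_rpow (enorm_le_iff_norm_le.2 (hx.trans (le_abs_self _))) hp_pos.le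
    · exact (lintegral_rpow_enorm_lt_top_of_eLpNorm_lt_top hp0 hp hb.2).ne
    · filter_upwards [hlim] with x hx
      simpa [hp_pos] using hx.enorm.ennrpow_const p.toReal
  simpa [eLpNorm_eq_lintegral_rpow_enorm_toReal hp0 hp, hp_pos]
    using hlintegral.ennrpow_const (1 / p.toReal)

variable {α : Type*} [TopologicalSpace α] [MeasurableSpace α] {μ : Measure α} {C : ℝ≥0}
  {K : ℕ → α → α → ℝ}

/-- The kernels `K n` form an approximate identity for `μ`: their rows and columns are bounded by
`C` in `L¹`, and the integral operators with kernels `K n` converge pointwise almost everywhere to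
the identity on continuous functions. -/
structure IsApproximateIdentity (μ : Measure α) (C : ℝ≥0) (K : ℕ → α → α → ℝ) : Prop where
  measurable : ∀ n, Measurable (Function.uncurry (K n))
  row_le : ∀ n, ∀ᵐ x ∂μ, ∫⁻ y, ‖K n x y‖ₑ ∂μ ≤ C
  col_le : ∀ n, ∀ᵐ y ∂μ, ∫⁻ x, ‖K n x y‖ₑ ∂μ ≤ C
  row_bounded : ∀ n x, ∃ M, ∀ᵐ y ∂μ, |K n x y| ≤ M
  tendsto : ∀ g : α → ℝ, Continuous g →
    ∀ᵐ x ∂μ, Tendsto (fun n => ∫ y, g y * K n x y ∂μ) atTop (𝓝 (g x))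

namespace IsApproximateIdentity

lemma aestronglyMeasurable_integral_mul [SFinite μ] (hK : IsApproximateIdentity μ C K) (n : ℕ)
    {g : α → ℝ} (hg : AEStronglyMeasurable g μ) :
    AEStronglyMeasurable (fun x => ∫ y, g y * K n x y ∂μ) μ := by
  have hprod : AEStronglyMeasurable (Function.uncurry fun x y => g y * K n x y) (μ.prod μ) :=
    (hg.comp_quasiMeasurePreserving Measure.quasiMeasurePreserving_snd).mul
      (hK.measurable n).aestronglyMeasurable
  exact hprod.integral_prod_right'

lemma integrable_mul (hK : IsApproximateIdentity μ C K) (n : ℕ) (x : α) {g : α → ℝ}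
    (hg : Integrable g μ) : Integrable (fun y => g y * K n x y) μ := by
  obtain ⟨M, hM⟩ := hK.row_bounded n x
  exact hg.mul_bdd (c := M)
    ((hK.measurable n).comp measurable_prodMk_left).aestronglyMeasurable hM

lemma eLpNorm_integral_mul_le [SFinite μ] (hK : IsApproximateIdentity μ C K) (n : ℕ) {g : α → ℝ}
    (hg : AEStronglyMeasurable g μ) :
    eLpNorm (fun x => ∫ y, g y * K n x y ∂μ) 2 μ ≤ C * eLpNorm g 2 μ := by
  rw [← ENNReal.pow_le_pow_left_iff two_ne_zero, mul_pow, sq (C : ℝ≥0∞)]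
  exact eLpNorm_integral_mul_sq_le (hK.measurable n) (hK.row_le n) (hK.col_le n) hg

lemma nnnorm_integral_mul_le (hK : IsApproximateIdentity μ C K) (n : ℕ) {g : α → ℝ} {M : ℝ≥0}
    (hM : ∀ y, ‖g y‖₊ ≤ M) : ∀ᵐ x ∂μ, ‖∫ y, g y * K n x y ∂μ‖₊ ≤ M * C := by
  filter_upwards [hK.row_le n] with x hx
  rw [← enorm_le_coe, ENNReal.coe_mul]
  calc ‖∫ y, g y * K n x y ∂μ‖ₑ ≤ ∫⁻ y, ‖g y * K n x y‖ₑ ∂μ := enorm_integral_le_lintegral_enorm _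
    _ ≤ ∫⁻ y, M * ‖K n x y‖ₑ ∂μ := by
        refine lintegral_mono fun y => ?_
        rw [enorm_mul]
        gcongr
        exact enorm_le_coe.2 (hM y)
    _ = M * ∫⁻ y, ‖K n x y‖ₑ ∂μ := lintegral_const_mul' _ _ ENNReal.coe_ne_top
    _ ≤ M * C := by gcongr

lemma tendsto_eLpNorm_sub_of_continuous [IsFiniteMeasure μ] (hK : IsApproximateIdentity μ C K)
    {g : α → ℝ} (hg : Continuous g) (hgm : AEStronglyMeasurable g μ) {M : ℝ≥0}
    (hM : ∀ y, ‖g y‖₊ ≤ M) :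
    Tendsto (fun n => eLpNorm (fun x => (∫ y, g y * K n x y ∂μ) - g x) 2 μ) atTop (𝓝 0) := by
  refine tendsto_eLpNorm_zero_of_dominated ENNReal.ofNat_ne_top
    (fun n => (hK.aestronglyMeasurable_integral_mul n hgm).sub hgm)
    (memLp_const (M * C + M : ℝ)) (fun n => ?_) ?_
  · filter_upwards [hK.nnnorm_integral_mul_le n hM] with x hx
    exact_mod_cast (nnnorm_sub_le _ _).trans (add_le_add hx (hM x))
  · filter_upwards [hK.tendsto g hg] with x hx
    simpa using hx.sub_const (g x)

lemma eLpNorm_integral_mul_sub_le [IsFiniteMeasure μ] (hK : IsApproximateIdentity μ C K) (n : ℕ)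
    {f g : α → ℝ} (hf : MemLp f 2 μ) (hg : MemLp g 2 μ) :
    eLpNorm (fun x => (∫ y, f y * K n x y ∂μ) - f x) 2 μ ≤
      (C + 1) * eLpNorm (f - g) 2 μ + eLpNorm (fun x => (∫ y, g y * K n x y ∂μ) - g x) 2 μ := by
  have hfg := hf.1.sub hg.1
  have hTg := (hK.aestronglyMeasurable_integral_mul n hg.1).sub hg.1
  have hTfg := hK.aestronglyMeasurable_integral_mul n hfg
  have hsplit : (fun x => (∫ y, f y * K n x y ∂μ) - f x) =
      (fun x => ∫ y, (f - g) y * K n x y ∂μ) - (f - g) +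
        fun x => (∫ y, g y * K n x y ∂μ) - g x := by
    ext x
    simp only [Pi.sub_apply, Pi.add_apply, sub_mul]
    rw [integral_sub (hK.integrable_mul n x (hf.integrable one_le_two))
      (hK.integrable_mul n x (hg.integrable one_le_two))]
    ring
  rw [hsplit, add_mul, one_mul]
  refine (eLpNorm_add_le (hTfg.sub hfg) hTg one_le_two).trans (add_le_add_left ?_ _)
  exact (eLpNorm_sub_le hTfg hfg one_le_two).trans
    (add_le_add_left (hK.eLpNorm_integral_mul_le n hfg) _)

theorem tendsto_eLpNorm_sub [BorelSpace α] [NormalSpace α] [R1Space α]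
    [WeaklyLocallyCompactSpace α] [IsFiniteMeasure μ] [μ.Regular]
    (hK : IsApproximateIdentity μ C K) {f : α → ℝ} (hf : MemLp f 2 μ) :
    Tendsto (fun n => eLpNorm (fun x => (∫ y, f y * K n x y ∂μ) - f x) 2 μ) atTop (𝓝 0) := by
  rw [ENNReal.tendsto_nhds_zero]
  intro ε hε
  obtain ⟨δ, hδ, hδε⟩ : ∃ δ : ℝ≥0∞, δ ≠ 0 ∧ (C + 1) * δ ≤ ε / 2 :=
    ⟨ε / 2 / (C + 1), (ENNReal.div_pos (ENNReal.half_pos hε.ne').ne' (by finiteness)).ne',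
      ENNReal.mul_div_le⟩
  obtain ⟨g, hgs, hfg, hgc, hg⟩ :=
    hf.exists_hasCompactSupport_eLpNorm_sub_le ENNReal.ofNat_ne_top hδ
  obtain ⟨M, hM⟩ := hgs.exists_bound_of_continuous hgc
  have hgconv := hK.tendsto_eLpNorm_sub_of_continuous hgc hg.1
    (M := M.toNNReal) fun y => NNReal.le_toNNReal_of_coe_le (hM y)
  filter_upwards [ENNReal.tendsto_nhds_zero.1 hgconv _ (ENNReal.half_pos hε.ne')] with n hn
  calc eLpNorm (fun x => (∫ y, f y * K n x y ∂μ) - f x) 2 μ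
      ≤ (C + 1) * eLpNorm (f - g) 2 μ + eLpNorm (fun x => (∫ y, g y * K n x y ∂μ) - g x) 2 μ :=
        hK.eLpNorm_integral_mul_sub_le n hf hg
    _ ≤ (C + 1) * δ + ε / 2 := by gcongr
    _ ≤ ε / 2 + ε / 2 := by gcongr
    _ = ε := ENNReal.add_halves ε

end IsApproximateIdentity

end ApproximateIdentity

section Mollification

variable {X : Type*} [NormedAddCommGroup X] [NormedSpace ℝ X]

lemma exists_norm_affine_sub_le {F : Type*} [NormedAddCommGroup F] [ProperSpace X] {k : X → F}
    (hk : Continuous k) (l : ℝ) (b x₀ : X) (R : ℝ) :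
    ∃ M, ∀ x ∈ Metric.ball x₀ 1, ∀ y, ‖y‖ ≤ R → ‖k (l • x + b - y)‖ ≤ M := by
  have hcompact : IsCompact ((fun z : X × X => l • z.1 + b - z.2) ''
      Metric.closedBall x₀ 1 ×ˢ Metric.closedBall 0 R) :=
    ((isCompact_closedBall _ _).prod (isCompact_closedBall _ _)).image (by fun_prop)
  obtain ⟨M, hM⟩ := hcompact.exists_bound_of_continuousOn hk.continuousOn
  exact ⟨M, fun x hx y hy => hM _ (mem_image_of_mem _
    (mk_mem_prod (Metric.ball_subset_closedBall hx) (mem_closedBall_zero_iff.2 hy)))⟩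

variable [MeasurableSpace X] {μ : Measure X} {k f : X → ℝ} {l R : ℝ} {b : X}

/-- The function `x ↦ ∫ f(y) k(l x + b - y) dμ(y)`: the convolution of `f μ` with the kernel `k`,
evaluated at the image of `x` under the affine map `x ↦ l x + b`. -/
def mollify (μ : Measure X) (k : X → ℝ) (l : ℝ) (b : X) (f : X → ℝ) (x : X) : ℝ :=
  ∫ y, f y * k (l • x + b - y) ∂μ

variable [ProperSpace X]

lemma exists_integrable_bound_smul_fderiv (hk : ContDiff ℝ 1 k) (hR : ∀ᵐ y ∂μ, ‖y‖ ≤ R)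
    (hf : Integrable f μ) (x₀ : X) : ∃ B : X → ℝ, Integrable B μ ∧
      ∀ᵐ y ∂μ, ∀ x ∈ Metric.ball x₀ 1, ‖(f y * l) • fderiv ℝ k (l • x + b - y)‖ ≤ B y := by
  obtain ⟨M, hM⟩ := exists_norm_affine_sub_le (hk.continuous_fderiv one_ne_zero) l b x₀ R
  refine ⟨fun y => ‖f y * l‖ * M, (hf.mul_const l).norm.mul_const M, ?_⟩
  filter_upwards [hR] with y hy x hx
  rw [norm_smul]
  gcongr
  exact hM x hx y hy

variable [BorelSpace X]

lemma integrable_mul_kernel (hk : Continuous k) (hR : ∀ᵐ y ∂μ, ‖y‖ ≤ R) (hf : Integrable f μ)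
    (x : X) : Integrable (fun y => f y * k (l • x + b - y)) μ := by
  obtain ⟨M, hM⟩ := exists_norm_affine_sub_le hk l b x R
  exact hf.mul_bdd (c := M) (by fun_prop)
    (hR.mono fun y hy => hM x (Metric.mem_ball_self one_pos) y hy)

lemma aestronglyMeasurable_smul_fderiv (hk : ContDiff ℝ 1 k) (hf : Integrable f μ) (x : X) :
    AEStronglyMeasurable (fun y => (f y * l) • fderiv ℝ k (l • x + b - y)) μ := by
  have : Continuous (fderiv ℝ k) := hk.continuous_fderiv one_ne_zero
  exact (hf.1.mul_const l).smul
    (by fun_prop : Continuous fun y => fderiv ℝ k (l • x + b - y)).aestronglyMeasurable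

lemma integrable_smul_fderiv (hk : ContDiff ℝ 1 k) (hR : ∀ᵐ y ∂μ, ‖y‖ ≤ R) (hf : Integrable f μ)
    (x : X) : Integrable (fun y => (f y * l) • fderiv ℝ k (l • x + b - y)) μ := by
  obtain ⟨B, hB, hle⟩ := exists_integrable_bound_smul_fderiv (l := l) (b := b) hk hR hf x
  exact hB.mono' (aestronglyMeasurable_smul_fderiv hk hf x)
    (hle.mono fun y hy => hy x (Metric.mem_ball_self one_pos))

lemma hasFDerivAt_mollify (hk : ContDiff ℝ 1 k) (hR : ∀ᵐ y ∂μ, ‖y‖ ≤ R) (hf : Integrable f μ)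
    (x₀ : X) : HasFDerivAt (mollify μ k l b f)
      (∫ y, (f y * l) • fderiv ℝ k (l • x₀ + b - y) ∂μ) x₀ := by
  obtain ⟨B, hB, hle⟩ := exists_integrable_bound_smul_fderiv (l := l) (b := b) hk hR hf x₀
  refine hasFDerivAt_integral_of_dominated_of_fderiv_le (bound := B)
    (Metric.ball_mem_nhds x₀ one_pos)
    (Eventually.of_forall fun x => (integrable_mul_kernel hk.continuous hR hf x).1)
    (integrable_mul_kernel hk.continuous hR hf x₀) (aestronglyMeasurable_smul_fderiv hk hf x₀)
    hle hB (Eventually.of_forall fun y x _ => ?_)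
  have haffine : HasFDerivAt (fun x : X => l • x + b - y) (l • ContinuousLinearMap.id ℝ X) x :=
    (((hasFDerivAt_id x).const_smul l).add_const b).sub_const y
  have hcomp := (hk.differentiable one_ne_zero (l • x + b - y)).hasFDerivAt.comp x haffine
  convert! hcomp.const_mul (f y) using 1
  ext v
  simp [mul_assoc]

lemma contDiff_mollify (hk : ContDiff ℝ 1 k) (hR : ∀ᵐ y ∂μ, ‖y‖ ≤ R) (hf : Integrable f μ) :
    ContDiff ℝ 1 (mollify μ k l b f) := by
  have : Continuous (fderiv ℝ k) := hk.continuous_fderiv one_ne_zero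
  have hderiv := hasFDerivAt_mollify (l := l) (b := b) hk hR hf
  rw [contDiff_one_iff_fderiv]
  refine ⟨fun x => (hderiv x).differentiableAt, continuous_iff_continuousAt.2 fun x₀ => ?_⟩
  obtain ⟨B, hB, hle⟩ := exists_integrable_bound_smul_fderiv (l := l) (b := b) hk hR hf x₀
  rw [funext fun x => (hderiv x).fderiv]
  refine continuousAt_of_dominated
    (Eventually.of_forall fun x => aestronglyMeasurable_smul_fderiv hk hf x) ?_ hB
    (Eventually.of_forall fun y => by fun_prop)
  filter_upwards [Metric.ball_mem_nhds x₀ one_pos] with x hx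
  exact hle.mono fun y hy => hy x hx

end Mollification

namespace Setting

variable {d : ℕ} {S : Setting d} {k : E d → ℝ} {l R : ℝ} {b : E d} {u : E d → ℝ}
  {G : Fin d → E d → ℝ}

lemma partialD_mollify {μ : Measure (E d)} (hk : ContDiff ℝ 1 k) (hR : ∀ᵐ y ∂μ, ‖y‖ ≤ R)
    (hu : Integrable u μ) (i : Fin d) (x : E d) :
    partialD i (mollify μ k l b u) x = l * mollify μ (partialD i k) l b u x := by
  rw [partialD, (hasFDerivAt_mollify hk hR hu x).fderiv,
    ContinuousLinearMap.integral_apply (integrable_smul_fderiv hk hR hu x), mollify,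
    ← integral_const_mul]
  refine integral_congr_ae (Eventually.of_forall fun y => ?_)
  simp only [partialD, smul_apply, smul_eq_mul]
  ring

lemma partialD_comp_const_sub {k : E d → ℝ} (hk : Differentiable ℝ k) (i : Fin d) (p y : E d) :
    partialD i (fun y => k (p - y)) y = - partialD i k (p - y) := by
  have hinner : HasFDerivAt (fun y : E d => p - y) (-ContinuousLinearMap.id ℝ (E d)) y :=
    (hasFDerivAt_id y).const_sub p
  have hcomp := ((hk (p - y)).hasFDerivAt.comp y hinner).fderiv
  rw [partialD, partialD, show (fun y => k (p - y)) = k ∘ fun y => p - y from rfl, hcomp]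
  simp

lemma IsWeakGrad.partialD_mollify (h : S.IsWeakGrad u G) (hk : ContDiff ℝ 1 k)
    (hR : ∀ᵐ y ∂S.mu, ‖y‖ ≤ R) (hu : Integrable u S.mu) {x : E d}
    (hx : S.IsTest fun y => k (l • x + b - y)) (i : Fin d) :
    partialD i (mollify S.mu k l b u) x = l * mollify S.mu k l b (G i) x := by
  have hparts := h _ hx i
  simp only [partialD_comp_const_sub (hk.differentiable one_ne_zero), mul_neg, integral_neg,
    neg_inj] at hparts
  rw [Setting.partialD_mollify hk hR hu, mollify, hparts, mollify]

lemma IsWeakGrad.eLpNorm_partialD_mollify_sub_le [IsFiniteMeasure S.mu] (h : S.IsWeakGrad u G)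
    (hk : ContDiff ℝ 1 k) (hR : ∀ᵐ y ∂S.mu, ‖y‖ ≤ R) (hu : Integrable u S.mu)
    (htest : ∀ᵐ x ∂S.mu, S.IsTest fun y => k (l • x + b - y)) {i : Fin d}
    (hG : MemLp (G i) 2 S.mu) :
    eLpNorm (fun x => partialD i (mollify S.mu k l b u) x - G i x) 2 S.mu ≤
      ‖l‖ₑ * eLpNorm (fun x => mollify S.mu k l b (G i) x - G i x) 2 S.mu +
        ‖l - 1‖ₑ * eLpNorm (G i) 2 S.mu := by
  have hsplit : (fun x => partialD i (mollify S.mu k l b u) x - G i x) =ᵐ[S.mu]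
      l • (fun x => mollify S.mu k l b (G i) x - G i x) + (l - 1) • G i := by
    filter_upwards [htest] with x hx
    rw [h.partialD_mollify hk hR hu hx i]
    simp only [Pi.add_apply, Pi.smul_apply, smul_eq_mul]
    ring
  have hm : AEStronglyMeasurable (fun x => mollify S.mu k l b (G i) x - G i x) S.mu :=
    (contDiff_mollify hk hR (hG.integrable one_le_two)).continuous.aestronglyMeasurable.sub hG.1
  rw [eLpNorm_congr_ae hsplit, ← eLpNorm_const_smul, ← eLpNorm_const_smul]
  exact eLpNorm_add_le (hm.const_smul _) (hG.1.const_smul _) one_le_two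

/-- The functions `φ n`, together with their classical gradients, converge to `(u, G)` in `L²`. -/
def TendstoW12 (S : Setting d) (φ : ℕ → E d → ℝ) (u : E d → ℝ) (G : Fin d → E d → ℝ) : Prop :=
  Tendsto (fun n => eLpNorm (fun x => φ n x - u x) 2 S.mu) atTop (𝓝 0) ∧
    ∀ i, Tendsto (fun n => eLpNorm (fun x => partialD i (φ n) x - G i x) 2 S.mu) atTop (𝓝 0)

theorem IsWeakGrad.tendsto_mollify [IsFiniteMeasure S.mu] (h : S.IsWeakGrad u G)
    {k : ℕ → E d → ℝ} {l : ℕ → ℝ} {b : ℕ → E d} {C : ℝ≥0} (hk : ∀ n, ContDiff ℝ 1 (k n))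
    (hR : ∀ᵐ y ∂S.mu, ‖y‖ ≤ R) (hl : Tendsto l atTop (𝓝 1))
    (htest : ∀ n, ∀ᵐ x ∂S.mu, S.IsTest fun y => k n (l n • x + b n - y))
    (hK : IsApproximateIdentity S.mu C fun n x y => k n (l n • x + b n - y))
    (hu : MemLp u 2 S.mu) (hG : ∀ i, MemLp (G i) 2 S.mu) :
    S.TendstoW12 (fun n => mollify S.mu (k n) (l n) (b n) u) u G := by
  refine ⟨hK.tendsto_eLpNorm_sub hu, fun i => ?_⟩
  have hlim : Tendsto (fun n => ‖l n‖ₑ * eLpNorm (fun x =>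
      mollify S.mu (k n) (l n) (b n) (G i) x - G i x) 2 S.mu + ‖l n - 1‖ₑ * eLpNorm (G i) 2 S.mu)
      atTop (𝓝 (‖(1 : ℝ)‖ₑ * 0 + ‖(1 : ℝ) - 1‖ₑ * eLpNorm (G i) 2 S.mu)) :=
    (ENNReal.Tendsto.mul hl.enorm (by simp) (hK.tendsto_eLpNorm_sub (hG i)) (by simp)).add
      (ENNReal.Tendsto.mul_const (hl.sub_const 1).enorm (Or.inr (hG i).2.ne))
  refine tendsto_of_tendsto_of_tendsto_of_le_of_le tendsto_const_nhds (by simpa using hlim)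
    (fun _ => zero_le) fun n => ?_
  exact h.eLpNorm_partialD_mollify_sub_le (hk n) hR (hu.integrable one_le_two) (htest n) (hG i)

end Setting

section Contraction

variable {X : Type*} [NormedAddCommGroup X] [NormedSpace ℝ X]

lemma closedBall_homothety_subset {Ω : Set X} (hconv : Convex ℝ Ω) {x₀ : X} {r : ℝ}
    (hball : Metric.ball x₀ r ⊆ Ω) {x : X} (hx : x ∈ Ω) {s ρ : ℝ} (hs : 0 < s) (hs1 : s ≤ 1)
    (hρ : ρ < s * r) : Metric.closedBall ((1 - s) • x + s • x₀) ρ ⊆ Ω := by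
  intro y hy
  rw [mem_closedBall_iff_norm] at hy
  set z : X := x₀ + s⁻¹ • (y - ((1 - s) • x + s • x₀)) with hz
  have hzΩ : z ∈ Ω := by
    refine hball ?_
    rw [mem_ball_iff_norm, hz, add_sub_cancel_left, norm_smul, norm_inv, Real.norm_of_nonneg hs.le,
      inv_mul_lt_iff₀ hs]
    exact hy.trans_lt hρ
  have hyz : (1 - s) • x + s • z = y := by
    rw [hz, smul_add, smul_inv_smul₀ hs.ne']
    abel
  exact hyz ▸ hconv hx hzΩ (sub_nonneg.2 hs1) hs.le (sub_add_cancel 1 s)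

variable [FiniteDimensional ℝ X] [MeasurableSpace X] [BorelSpace X] {μ : Measure X}
  [μ.IsAddHaarMeasure]

lemma lintegral_comp_smul_add {F : X → ℝ≥0∞} (hF : Measurable F) {l : ℝ} (hl : l ≠ 0) (b : X) :
    ∫⁻ x, F (l • x + b) ∂μ =
      ENNReal.ofReal |(l ^ Module.finrank ℝ X)⁻¹| * ∫⁻ x, F x ∂μ := by
  rw [← lintegral_map (f := fun x => F (x + b)) (hF.comp (measurable_add_const b))
    (measurable_const_smul l), Measure.map_addHaar_smul μ hl, lintegral_smul_measure, smul_eq_mul,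
    lintegral_add_right_eq_self]

variable [HasContDiffBump X]

lemma lintegral_enorm_normed (φ : ContDiffBump (0 : X)) : ∫⁻ y, ‖φ.normed μ y‖ₑ ∂μ = 1 := by
  simp only [Real.enorm_eq_ofReal (φ.nonneg_normed _)]
  rw [← ofReal_integral_eq_lintegral_ofReal φ.integrable_normed
    (Eventually.of_forall φ.nonneg_normed), φ.integral_normed, ENNReal.ofReal_one]

lemma lintegral_enorm_normed_smul_add_le (φ : ContDiffBump (0 : X)) {l : ℝ} (hl : 1 / 2 ≤ l)
    (b : X) : ∫⁻ x, ‖φ.normed μ (l • x + b)‖ₑ ∂μ ≤ 2 ^ Module.finrank ℝ X := by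
  have hl0 : 0 < l := by linarith
  rw [lintegral_comp_smul_add (F := fun z => ‖φ.normed μ z‖ₑ)
    φ.continuous_normed.measurable.enorm hl0.ne', lintegral_enorm_normed, mul_one,
    abs_of_nonneg (by positivity), ← inv_pow, ENNReal.ofReal_pow (by positivity)]
  gcongr
  rw [← ENNReal.ofReal_ofNat]
  exact ENNReal.ofReal_le_ofReal ((inv_le_comm₀ hl0 two_pos).2 (by linarith))

lemma tendsto_setIntegral_mul_normed_homothety {φ : ℕ → ContDiffBump (0 : X)} {s : ℕ → ℝ}
    (hs : Tendsto s atTop (𝓝 0)) (hφ : Tendsto (fun n => (φ n).rOut) atTop (𝓝 0)) (x₀ : X)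
    {Ω : Set X} (hΩ : IsOpen Ω) {g : X → ℝ} (hg : Continuous g) {x : X} (hx : x ∈ Ω) :
    Tendsto (fun n => ∫ y in Ω, g y * (φ n).normed μ ((1 - s n) • x + s n • x₀ - y) ∂μ) atTop
      (𝓝 (g x)) := by
  have hcont : ContinuousAt (Ω.indicator g) x :=
    hg.continuousAt.congr (eqOn_indicator.symm.eventuallyEq_of_mem (hΩ.mem_nhds hx))
  have hpoint : Tendsto (fun n => (1 - s n) • x + s n • x₀) atTop (𝓝 x) := by
    simpa using ((hs.const_sub 1).smul_const x).add (hs.smul_const x₀)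
  have hconv := ContDiffBump.convolution_tendsto_right (μ := μ) hφ
    (Eventually.of_forall fun _ => hg.aestronglyMeasurable.indicator hΩ.measurableSet)
    (hcont.tendsto.comp tendsto_snd) hpoint
  rw [indicator_of_mem hx] at hconv
  refine hconv.congr fun n => ?_
  rw [convolution_eq_swap, ← integral_indicator hΩ.measurableSet]
  refine integral_congr_ae (Eventually.of_forall fun y => ?_)
  by_cases hy : y ∈ Ω <;> simp [hy, mul_comm]

lemma isApproximateIdentity_normed_homothety {φ : ℕ → ContDiffBump (0 : X)} {s : ℕ → ℝ}
    (hs2 : ∀ n, s n ≤ 1 / 2) (hs : Tendsto s atTop (𝓝 0))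
    (hφ : Tendsto (fun n => (φ n).rOut) atTop (𝓝 0)) (x₀ : X) {Ω : Set X} (hΩ : IsOpen Ω) :
    IsApproximateIdentity (μ.restrict Ω) (2 ^ Module.finrank ℝ X)
      fun n x y => (φ n).normed μ ((1 - s n) • x + s n • x₀ - y) where
  measurable n := by
    have hcont := (φ n).continuous_normed (μ := μ)
    exact (by fun_prop : Continuous fun p : X × X =>
      (φ n).normed μ ((1 - s n) • p.1 + s n • x₀ - p.2)).measurable
  row_le n := Eventually.of_forall fun x => by
    refine (setLIntegral_le_lintegral _ _).trans ?_
    rw [lintegral_sub_left_eq_self (fun y => ‖(φ n).normed μ y‖ₑ), lintegral_enorm_normed]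
    exact_mod_cast one_le_pow₀ one_le_two
  col_le n := Eventually.of_forall fun y => by
    refine (setLIntegral_le_lintegral _ _).trans ?_
    simp only [add_sub_assoc]
    exact_mod_cast lintegral_enorm_normed_smul_add_le (φ n) (by linarith [hs2 n]) _
  row_bounded n x := by
    obtain ⟨M, hM⟩ := (φ n).hasCompactSupport_normed.exists_bound_of_continuous
      ((φ n).continuous_normed (μ := μ))
    exact ⟨M, Eventually.of_forall fun y => hM _⟩
  tendsto g hg := (ae_restrict_iff' hΩ.measurableSet).2
    (Eventually.of_forall fun x hx =>
      tendsto_setIntegral_mul_normed_homothety hs hφ x₀ hΩ hg hx)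

end Contraction

namespace Setting

variable {d : ℕ} {Ω : Set (E d)} {u : E d → ℝ} {G : Fin d → E d → ℝ}

lemma isTest_neumann_normed_sub (φ : ContDiffBump (0 : E d)) {p : E d}
    (hp : Metric.closedBall p φ.rOut ⊆ Ω) :
    (neumann Ω).IsTest fun y => φ.normed volume (p - y) := by
  have hsupp : Function.support (fun y => φ.normed volume (p - y)) ⊆
      Metric.closedBall p φ.rOut := fun y hy => by
    have hmem : p - y ∈ Function.support (φ.normed volume) := hy
    rw [φ.support_normed_eq, mem_ball_zero_iff] at hmem
    exact mem_closedBall_iff_norm'.2 hmem.le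
  exact ⟨φ.contDiff_normed.comp (by fun_prop),
    HasCompactSupport.of_support_subset_isCompact (isCompact_closedBall _ _) hsupp,
    (closure_minimal hsupp Metric.isClosed_closedBall).trans hp⟩

/-- Contracting `Ω` toward the centre `x₀` of a ball of radius `r` in `Ω` by the factor `1 - s`
makes room for mollification at scale `s * r / 2` without leaving `Ω`. -/
theorem exists_contDiff_tendstoW12_of_isWeakGrad_neumann (hne : Ω.Nonempty) (ho : IsOpen Ω)
    (hb : Bornology.IsBounded Ω) (hconv : Convex ℝ Ω) (hu : MemLp u 2 (neumann Ω).mu)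
    (hG : ∀ i, MemLp (G i) 2 (neumann Ω).mu) (h : (neumann Ω).IsWeakGrad u G) :
    ∃ φ : ℕ → E d → ℝ, (∀ n, ContDiff ℝ 1 (φ n)) ∧ (neumann Ω).TendstoW12 φ u G := by
  obtain ⟨x₀, hx₀⟩ := hne
  obtain ⟨r, hr, hball⟩ := Metric.isOpen_iff.1 ho x₀ hx₀
  obtain ⟨R, hR⟩ := hb.exists_norm_le
  have hfin : IsFiniteMeasure (neumann Ω).mu := ⟨by
    rw [mu, Measure.restrict_apply_univ]; exact hb.measure_lt_top⟩
  have hae {p : E d → Prop} (hp : ∀ x ∈ Ω, p x) : ∀ᵐ x ∂(neumann Ω).mu, p x :=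
    (ae_restrict_iff' ho.measurableSet).2 (Eventually.of_forall hp)
  set s : ℕ → ℝ := fun n => ((n : ℝ) + 2)⁻¹
  have hs0 (n) : 0 < s n := by positivity
  have hs2 (n) : s n ≤ 1 / 2 := by
    rw [one_div]; exact inv_anti₀ two_pos (le_add_of_nonneg_left n.cast_nonneg)
  have hslim : Tendsto s atTop (𝓝 0) :=
    (tendsto_atTop_add_const_right _ 2 tendsto_natCast_atTop_atTop).inv_tendsto_atTop
  let φ (n : ℕ) : ContDiffBump (0 : E d) :=
    ⟨s n * r / 4, s n * r / 2, by have := hs0 n; positivity, by linarith [mul_pos (hs0 n) hr]⟩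
  have hφ (n) : (φ n).rOut < s n * r := half_lt_self (mul_pos (hs0 n) hr)
  have hφlim : Tendsto (fun n => (φ n).rOut) atTop (𝓝 0) := by
    simpa using (hslim.mul_const r).div_const 2
  have hk (n) : ContDiff ℝ 1 ((φ n).normed volume) := (φ n).contDiff_normed
  refine ⟨fun n => mollify (neumann Ω).mu ((φ n).normed volume) (1 - s n) (s n • x₀) u,
    fun n => contDiff_mollify (hk n) (hae hR) (hu.integrable one_le_two), ?_⟩
  exact h.tendsto_mollify hk (hae hR) (by simpa using hslim.const_sub 1)
    (fun n => hae fun x hx => isTest_neumann_normed_sub _ (closedBall_homothety_subset hconv hball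
      hx (hs0 n) (by linarith [hs2 n]) (hφ n)))
    (isApproximateIdentity_normed_homothety hs2 hslim hφlim x₀ ho) hu hG

end Setting

section Box

variable {d : ℕ}

/-- The open box `∏ (0, L i)`: unlike the half-open box that represents the torus, it is an open
convex set, and it carries the same measure. -/
def openBox (L : Fin d → ℝ) : Set (E d) := WithLp.ofLp ⁻¹' (univ.pi fun i => Ioo 0 (L i))

/-- The closed box `∏ [0, L i]`, a compact set with the same measure as the torus. -/
def closedBox (L : Fin d → ℝ) : Set (E d) := WithLp.ofLp ⁻¹' (univ.pi fun i => Icc 0 (L i))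

variable {L : Fin d → ℝ}

lemma isOpen_openBox : IsOpen (openBox L) :=
  (isOpen_set_pi finite_univ fun _ _ => isOpen_Ioo).preimage (PiLp.continuous_ofLp 2 _)

lemma convex_openBox : Convex ℝ (openBox L) :=
  (convex_pi fun i _ => convex_Ioo 0 (L i)).linear_preimage
    (WithLp.linearEquiv 2 ℝ (Fin d → ℝ)).toLinearMap

lemma nonempty_openBox (hL : ∀ i, 0 < L i) : (openBox L).Nonempty :=
  ⟨WithLp.toLp 2 fun i => L i / 2, fun i _ => ⟨half_pos (hL i), half_lt_self (hL i)⟩⟩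

lemma isCompact_closedBox : IsCompact (closedBox L) :=
  (EuclideanSpace.equiv (Fin d) ℝ).toHomeomorph.isCompact_preimage.2
    (isCompact_univ_pi fun _ => isCompact_Icc)

lemma openBox_subset_closedBox : openBox L ⊆ closedBox L :=
  preimage_mono (pi_mono fun _ _ => Ioo_subset_Icc_self)

namespace Setting

lemma mu_periodic_eq_restrict_preimage (L : Fin d → ℝ) {s : Set (Fin d → ℝ)}
    (hs : (univ.pi fun i => Ico 0 (L i)) =ᵐ[volume] s) :
    (periodic L).mu = volume.restrict (WithLp.ofLp ⁻¹' s) := by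
  have hdom : (periodic L).dom = WithLp.ofLp ⁻¹' (univ.pi fun i => Ico 0 (L i)) := by
    ext x; simp [dom]
  rw [mu, hdom]
  exact Measure.restrict_congr_set
    ((PiLp.volume_preserving_ofLp (Fin d)).quasiMeasurePreserving.preimage_ae_eq hs)

lemma mu_periodic_eq_openBox (L : Fin d → ℝ) :
    (periodic L).mu = volume.restrict (openBox L) :=
  mu_periodic_eq_restrict_preimage L <|
    (Measure.univ_pi_Ico_ae_eq_Icc (f := fun _ => (0 : ℝ))).trans
      (Measure.univ_pi_Ioo_ae_eq_Icc (f := fun _ => (0 : ℝ))).symm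

lemma mu_periodic_eq_closedBox (L : Fin d → ℝ) :
    (periodic L).mu = volume.restrict (closedBox L) :=
  mu_periodic_eq_restrict_preimage L <| by
    rw [pi_univ_Icc]
    exact Measure.univ_pi_Ico_ae_eq_Icc (f := fun _ => (0 : ℝ))

instance isFiniteMeasure_mu_periodic (L : Fin d → ℝ) : IsFiniteMeasure (periodic L).mu :=
  ⟨by rw [mu_periodic_eq_closedBox, Measure.restrict_apply_univ]
      exact isCompact_closedBox.measure_lt_top⟩

lemma ae_mu_periodic_of_forall_mem_openBox {p : E d → Prop} (hp : ∀ x ∈ openBox L, p x) :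
    ∀ᵐ x ∂(periodic L).mu, p x := by
  rw [mu_periodic_eq_openBox]
  exact (ae_restrict_iff' isOpen_openBox.measurableSet).2 (Eventually.of_forall hp)

lemma exists_ae_norm_le_mu_periodic (L : Fin d → ℝ) : ∃ R, ∀ᵐ x ∂(periodic L).mu, ‖x‖ ≤ R := by
  obtain ⟨R, hR⟩ := (isCompact_closedBox (L := L)).isBounded.exists_norm_le
  exact ⟨R, ae_mu_periodic_of_forall_mem_openBox fun x hx => hR x (openBox_subset_closedBox hx)⟩

end Setting

end Box

section Periodicity

lemma periodic_of_mem_span_int {X Y : Type*} [AddCommGroup X] {h : X → Y} {s : Set X}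
    (hs : ∀ c ∈ s, Function.Periodic h c) {c : X} (hc : c ∈ Submodule.span ℤ s) :
    Function.Periodic h c := by
  induction hc using Submodule.span_induction with
  | mem c hc => exact hs c hc
  | zero => exact fun x => by rw [add_zero]
  | add c c' _ _ hc hc' => exact hc.add_period hc'
  | smul n c _ hc => exact hc.zsmul n

open scoped Pointwise in
lemma setIntegral_fundamentalDomain_add {X F ι : Type*} [NormedAddCommGroup X] [NormedSpace ℝ X]
    [Finite ι] [MeasurableSpace X] [BorelSpace X] [NormedAddCommGroup F] [NormedSpace ℝ F]
    (b : Module.Basis ι ℝ X) {μ : Measure X} [μ.IsAddHaarMeasure] {h : X → F}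
    (hper : ∀ i, Function.Periodic h (b i)) (a : X) :
    ∫ y in ZSpan.fundamentalDomain b, h (y + a) ∂μ = ∫ y in ZSpan.fundamentalDomain b, h y ∂μ := by
  have hfd := ZSpan.isAddFundamentalDomain b μ
  have hinv (g : Submodule.span ℤ (range b)) (x : X) : h (g +ᵥ x) = h x :=
    (congrArg h (add_comm _ _)).trans (periodic_of_mem_span_int (forall_mem_range.2 hper) g.2 x)
  have : FiniteDimensional ℝ X := b.finiteDimensional_of_finite
  have : VAddInvariantMeasure (Submodule.span ℤ (range b)) X μ :=
    inferInstanceAs <| VAddInvariantMeasure (Submodule.span ℤ (range b)).toAddSubgroup X μ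
  have himage : a +ᵥ ZSpan.fundamentalDomain b = (· + a) '' ZSpan.fundamentalDomain b := by
    simp only [add_comm _ a]
    rfl
  rw [hfd.setIntegral_eq (hfd.vadd_of_comm a) hinv, himage,
    (measurePreserving_add_right μ a).setIntegral_image_emb (measurableEmbedding_addRight a)]

variable {d : ℕ} {L : Fin d → ℝ}

lemma exists_basis_single_fundamentalDomain_eq (hL : ∀ i, 0 < L i) :
    ∃ b : Module.Basis (Fin d) ℝ (E d), (∀ i, b i = EuclideanSpace.single i (L i)) ∧
      ZSpan.fundamentalDomain b = (Setting.periodic L).dom := by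
  refine ⟨(EuclideanSpace.basisFun (Fin d) ℝ).toBasis.isUnitSMul (w := L)
    fun i => (hL i).ne'.isUnit, fun i => ?_, ?_⟩
  · rw [Module.Basis.isUnitSMul_apply]
    ext j; simp
  · ext x
    simp only [ZSpan.mem_fundamentalDomain, Setting.dom, mem_ofPred_eq]
    refine forall_congr' fun i => ?_
    have hcoord : ((EuclideanSpace.basisFun (Fin d) ℝ).toBasis.isUnitSMul (w := L)
        fun i => (hL i).ne'.isUnit).repr x i = (L i)⁻¹ * x i := by
      rw [Module.Basis.repr_isUnitSMul]
      simp [Units.smul_def]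
    rw [hcoord, mem_Ico, inv_mul_lt_iff₀ (hL i), mul_one,
      mul_nonneg_iff_of_pos_left (inv_pos.2 (hL i))]

namespace Setting

lemma integral_mu_periodic_add (hL : ∀ i, 0 < L i) {h : E d → ℝ}
    (hper : ∀ i, Function.Periodic h (EuclideanSpace.single i (L i))) (a : E d) :
    ∫ y, h (y + a) ∂(periodic L).mu = ∫ y, h y ∂(periodic L).mu := by
  obtain ⟨b, hb, hdom⟩ := exists_basis_single_fundamentalDomain_eq hL
  rw [mu, ← hdom]
  exact setIntegral_fundamentalDomain_add b (fun i => hb i ▸ hper i) a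

/-- By periodicity the integral of the translates of `h` is constant; differentiate it. -/
lemma integral_partialD_mu_periodic (hL : ∀ i, 0 < L i) {h : E d → ℝ} (hh : ContDiff ℝ 1 h)
    (hper : ∀ i, Function.Periodic h (EuclideanSpace.single i (L i))) (i : Fin d) :
    ∫ y, partialD i h y ∂(periodic L).mu = 0 := by
  obtain ⟨R, hR⟩ := exists_ae_norm_le_mu_periodic L
  have hk : ContDiff ℝ 1 fun z => h (0 - z) := hh.comp (by fun_prop)
  have hconst : mollify (periodic L).mu (fun z => h (0 - z)) 1 0 (fun _ => 1) =
      fun _ => ∫ y, h y ∂(periodic L).mu := by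
    ext x
    rw [← integral_mu_periodic_add hL hper (-x)]
    simp [mollify, sub_eq_add_neg]
  have hderiv := partialD_mollify (l := 1) (b := 0) hk hR (integrable_const (1 : ℝ)) i 0
  have hzero (c : ℝ) : partialD i (fun _ : E d => c) 0 = 0 := by simp [partialD]
  rw [hconst, hzero, mollify, one_mul] at hderiv
  simp only [partialD_comp_const_sub (hh.differentiable one_ne_zero), one_mul, smul_zero, zero_add,
    sub_sub_cancel, integral_neg] at hderiv
  exact neg_eq_zero.1 hderiv.symm

end Setting

end Periodicity

section CosKernel

variable {d : ℕ} {L : Fin d → ℝ}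

/-- The periodic function `∏ cos²(π x_i / L_i)`, whose maximum `1` on a period is attained only at
the origin; its normalized powers form an approximate identity on the torus. -/
def cosKernel (L : Fin d → ℝ) (x : E d) : ℝ := ∏ i, Real.cos (Real.pi * x i / L i) ^ 2

lemma contDiff_cosKernel : ContDiff ℝ ∞ (cosKernel L) := by
  unfold cosKernel
  refine contDiff_prod fun i _ => ContDiff.pow (Real.contDiff_cos.comp ?_) 2
  fun_prop

lemma cosKernel_nonneg (x : E d) : 0 ≤ cosKernel L x :=
  Finset.prod_nonneg fun _ _ => sq_nonneg _

lemma cosKernel_zero : cosKernel L 0 = 1 := by simp [cosKernel]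

lemma cosKernel_neg (x : E d) : cosKernel L (-x) = cosKernel L x := by simp [cosKernel, neg_div]

lemma periodic_cosKernel (hL : ∀ i, 0 < L i) (i : Fin d) :
    Function.Periodic (cosKernel L) (EuclideanSpace.single i (L i)) := by
  refine fun x => Finset.prod_congr rfl fun j _ => ?_
  rcases eq_or_ne j i with rfl | hj
  · have hshift : Real.pi * (x j + L j) / L j = Real.pi * x j / L j + Real.pi := by
      field_simp [(hL j).ne']
    simp [hshift, Real.cos_add_pi]
  · simp [hj]

lemma cos_pi_mul_div_sq_lt_one {l t : ℝ} (ht : |t| < l) (ht0 : t ≠ 0) :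
    Real.cos (Real.pi * t / l) ^ 2 < 1 := by
  have hl : 0 < l := (abs_nonneg t).trans_lt ht
  have habs : |Real.pi * t / l| < Real.pi := by
    rw [abs_div, abs_mul, abs_of_pos Real.pi_pos, abs_of_pos hl, div_lt_iff₀ hl]
    exact mul_lt_mul_of_pos_left ht Real.pi_pos
  have hsin : Real.sin (Real.pi * t / l) ≠ 0 := fun h =>
    div_ne_zero (mul_ne_zero Real.pi_ne_zero ht0) hl.ne'
      ((Real.sin_eq_zero_iff_of_lt_of_lt (abs_lt.1 habs).1 (abs_lt.1 habs).2).1 h)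
  rw [Real.cos_sq', sub_lt_self_iff]
  positivity

lemma cosKernel_lt_one {x : E d} (hx : ∀ i, |x i| < L i) (h0 : x ≠ 0) : cosKernel L x < 1 := by
  obtain ⟨i, hi⟩ : ∃ i, x i ≠ 0 := by
    by_contra! h
    exact h0 (by ext i; simp [h i])
  rw [cosKernel, ← Finset.mul_prod_erase _ _ (Finset.mem_univ i)]
  exact mul_lt_one_of_nonneg_of_lt_one_left (sq_nonneg _) (cos_pi_mul_div_sq_lt_one (hx i) hi)
    (Finset.prod_le_one (fun _ _ => sq_nonneg _) fun j _ => Real.cos_sq_le_one _)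

/-- The power `cosKernel L ^ n`, normalized to have integral `1` over the torus. -/
def normedCosKernel (L : Fin d → ℝ) (n : ℕ) (x : E d) : ℝ :=
  (∫ y, cosKernel L y ^ n ∂(Setting.periodic L).mu)⁻¹ * cosKernel L x ^ n

lemma contDiff_normedCosKernel (n : ℕ) : ContDiff ℝ ∞ (normedCosKernel L n) :=
  contDiff_const.mul (contDiff_cosKernel.pow n)

lemma normedCosKernel_nonneg (n : ℕ) (x : E d) : 0 ≤ normedCosKernel L n x :=
  mul_nonneg (inv_nonneg.2 (integral_nonneg fun _ => pow_nonneg (cosKernel_nonneg _) n))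
    (pow_nonneg (cosKernel_nonneg x) n)

lemma normedCosKernel_sub_comm (n : ℕ) (x y : E d) :
    normedCosKernel L n (x - y) = normedCosKernel L n (y - x) := by
  rw [normedCosKernel, ← neg_sub, cosKernel_neg, normedCosKernel]

lemma periodic_normedCosKernel (hL : ∀ i, 0 < L i) (n : ℕ) (i : Fin d) :
    Function.Periodic (normedCosKernel L n) (EuclideanSpace.single i (L i)) := fun x => by
  rw [normedCosKernel, periodic_cosKernel hL i x, normedCosKernel]

lemma exists_normedCosKernel_le (n : ℕ) : ∃ M, ∀ x, |normedCosKernel L n x| ≤ M := by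
  refine ⟨|(∫ y, cosKernel L y ^ n ∂(Setting.periodic L).mu)⁻¹|, fun x => ?_⟩
  rw [normedCosKernel, abs_mul]
  refine mul_le_of_le_one_right (abs_nonneg _) ?_
  rw [abs_of_nonneg (pow_nonneg (cosKernel_nonneg x) n)]
  exact pow_le_one₀ (cosKernel_nonneg x)
    (Finset.prod_le_one (fun _ _ => sq_nonneg _) fun i _ => Real.cos_sq_le_one _)

lemma integral_cosKernel_sub_pow (hL : ∀ i, 0 < L i) (n : ℕ) (a : E d) :
    ∫ y, cosKernel L (y - a) ^ n ∂(Setting.periodic L).mu =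
      ∫ y, cosKernel L y ^ n ∂(Setting.periodic L).mu := by
  simpa only [← sub_eq_add_neg, Function.comp_apply] using Setting.integral_mu_periodic_add hL
    (fun i => (periodic_cosKernel hL i).comp (· ^ n)) (-a)

lemma lintegral_enorm_normedCosKernel_sub_le (hL : ∀ i, 0 < L i) (n : ℕ) (a : E d) :
    ∫⁻ y, ‖normedCosKernel L n (y - a)‖ₑ ∂(Setting.periodic L).mu ≤ 1 := by
  obtain ⟨M, hM⟩ := exists_normedCosKernel_le (L := L) n
  have hcont : Continuous (normedCosKernel L n) := (contDiff_normedCosKernel n).continuous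
  have hint : Integrable (fun y => normedCosKernel L n (y - a)) (Setting.periodic L).mu :=
    Integrable.of_bound (by fun_prop) M (Eventually.of_forall fun y => hM (y - a))
  simp only [Real.enorm_eq_ofReal (normedCosKernel_nonneg n _)]
  rw [← ofReal_integral_eq_lintegral_ofReal hint
    (Eventually.of_forall fun y => normedCosKernel_nonneg n _), ENNReal.ofReal_le_one]
  simp only [normedCosKernel, integral_const_mul, integral_cosKernel_sub_pow hL]
  exact inv_mul_le_one

lemma tendsto_integral_mul_normedCosKernel_sub (hL : ∀ i, 0 < L i) {g : E d → ℝ}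
    (hg : Continuous g) {x : E d} (hx : x ∈ openBox L) :
    Tendsto (fun n => ∫ y, g y * normedCosKernel L n (x - y) ∂(Setting.periodic L).mu) atTop
      (𝓝 (g x)) := by
  have hmax : ∀ y ∈ closedBox L, y ≠ x → cosKernel L (y - x) < cosKernel L (x - x) := by
    intro y hy hyx
    rw [sub_self, cosKernel_zero]
    refine cosKernel_lt_one (fun i => abs_lt.2 ?_) (sub_ne_zero.2 hyx)
    obtain ⟨hx0, hxL⟩ := hx i (mem_univ i)
    obtain ⟨hy0, hyL⟩ := hy i (mem_univ i)
    rw [PiLp.sub_apply]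
    constructor <;> linarith
  have hcont : Continuous (cosKernel L) := contDiff_cosKernel.continuous
  have hmem : x ∈ closure (interior (closedBox L)) :=
    subset_closure (isOpen_openBox.subset_interior_iff.2 openBox_subset_closedBox hx)
  have hlim := tendsto_setIntegral_pow_smul_of_unique_maximum_of_isCompact_of_continuousOn
    (μ := volume) (g := g) (c := fun y => cosKernel L (y - x)) isCompact_closedBox
    (by fun_prop) hmax (fun _ _ => cosKernel_nonneg _) (by simp [cosKernel_zero]) hmem
    hg.continuousOn
  rw [← Setting.mu_periodic_eq_closedBox] at hlim
  refine hlim.congr fun n => ?_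
  rw [integral_cosKernel_sub_pow hL, smul_eq_mul, ← integral_const_mul]
  refine integral_congr_ae (Eventually.of_forall fun y => ?_)
  beta_reduce
  rw [normedCosKernel_sub_comm, normedCosKernel, smul_eq_mul]
  ring

lemma isApproximateIdentity_normedCosKernel (hL : ∀ i, 0 < L i) :
    IsApproximateIdentity (Setting.periodic L).mu 1 fun n x y => normedCosKernel L n (x - y) where
  measurable n := by
    have hcont : Continuous (normedCosKernel L n) := (contDiff_normedCosKernel n).continuous
    exact (by fun_prop : Continuous fun p : E d × E d => normedCosKernel L n (p.1 - p.2)).measurable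
  row_le n := Eventually.of_forall fun x => by
    simp only [normedCosKernel_sub_comm n x]
    exact lintegral_enorm_normedCosKernel_sub_le hL n x
  col_le n := Eventually.of_forall fun y => lintegral_enorm_normedCosKernel_sub_le hL n y
  row_bounded n x := by
    obtain ⟨M, hM⟩ := exists_normedCosKernel_le (L := L) n
    exact ⟨M, Eventually.of_forall fun y => hM _⟩
  tendsto _ hg := Setting.ae_mu_periodic_of_forall_mem_openBox fun _ hx =>
    tendsto_integral_mul_normedCosKernel_sub hL hg hx

end CosKernel

namespace Setting

variable {d : ℕ} {L : Fin d → ℝ} {u : E d → ℝ} {G : Fin d → E d → ℝ}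

lemma isTest_periodic_comp_sub {k : E d → ℝ} (hk : ContDiff ℝ ∞ k)
    (hper : ∀ i, Function.Periodic k (EuclideanSpace.single i (L i))) (p : E d) :
    (periodic L).IsTest fun y => k (p - y) :=
  ⟨hk.comp (by fun_prop), fun i y => by
    simp only [← sub_sub]; exact (hper i).sub_eq _⟩

theorem exists_contDiff_tendstoW12_of_isWeakGrad_periodic (hL : ∀ i, 0 < L i)
    (hu : MemLp u 2 (periodic L).mu) (hG : ∀ i, MemLp (G i) 2 (periodic L).mu)
    (h : (periodic L).IsWeakGrad u G) :
    ∃ φ : ℕ → E d → ℝ, (∀ n, ContDiff ℝ 1 (φ n) ∧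
        ∀ i, Function.Periodic (φ n) (EuclideanSpace.single i (L i))) ∧
      (periodic L).TendstoW12 φ u G := by
  obtain ⟨R, hR⟩ := exists_ae_norm_le_mu_periodic L
  have hk (n) : ContDiff ℝ 1 (normedCosKernel L n) := (contDiff_normedCosKernel n).of_le (by simp)
  refine ⟨fun n => mollify (periodic L).mu (normedCosKernel L n) 1 0 u, fun n =>
    ⟨contDiff_mollify (hk n) hR (hu.integrable one_le_two), fun i x => ?_⟩, ?_⟩
  · simp only [mollify, one_smul, add_zero, add_sub_right_comm x,
      periodic_normedCosKernel hL n i _]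
  · exact h.tendsto_mollify (l := fun _ => 1) (b := fun _ => 0) hk hR tendsto_const_nhds
      (fun n => Eventually.of_forall fun x => isTest_periodic_comp_sub (contDiff_normedCosKernel n)
        (periodic_normedCosKernel hL n) _)
      (by simpa using isApproximateIdentity_normedCosKernel hL) hu hG

end Setting

/-! ### Calculus in `V` -/

namespace Setting

section PartialDerivatives

variable {d : ℕ} {φ θ : E d → ℝ} {x : E d}

lemma continuous_partialD_of_contDiff (hφ : ContDiff ℝ 1 φ) (i : Fin d) :
    Continuous (partialD i φ) :=
  (hφ.continuous_fderiv one_ne_zero).clm_apply continuous_const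

lemma partialD_mul (hφ : DifferentiableAt ℝ φ x) (hθ : DifferentiableAt ℝ θ x) (i : Fin d) :
    partialD i (fun x => φ x * θ x) x = φ x * partialD i θ x + partialD i φ x * θ x := by
  simp only [partialD]
  rw [fderiv_fun_mul hφ hθ]
  simp [mul_comm]

lemma partialD_comp {ψ : ℝ → ℝ} (hψ : DifferentiableAt ℝ ψ (φ x)) (hφ : DifferentiableAt ℝ φ x)
    (i : Fin d) : partialD i (fun x => ψ (φ x)) x = deriv ψ (φ x) * partialD i φ x := by
  have hchain := (hψ.hasDerivAt.comp_hasFDerivAt x hφ.hasFDerivAt).fderiv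
  simp only [partialD]
  rw [show (fun x => ψ (φ x)) = ψ ∘ φ from rfl, hchain]
  simp

lemma norm_fderiv_le_sum_norm_partialD (φ : E d → ℝ) (x : E d) :
    ‖fderiv ℝ φ x‖ ≤ ∑ i, ‖partialD i φ x‖ := by
  refine ContinuousLinearMap.opNorm_le_bound _ (Finset.sum_nonneg fun _ _ => norm_nonneg _)
    fun v => ?_
  have hcoord : v = ∑ i, v i • EuclideanSpace.single i (1 : ℝ) := by
    ext j
    simp [Finset.sum_apply, Pi.single_apply]
  have hexpand : fderiv ℝ φ x v = ∑ i, v i * partialD i φ x := by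
    conv_lhs => rw [hcoord]
    simp only [map_sum, map_smul, smul_eq_mul, partialD]
  rw [hexpand, Finset.sum_mul]
  refine norm_sum_le_of_le _ fun i _ => ?_
  rw [norm_mul, mul_comm]
  exact mul_le_mul_of_nonneg_left (PiLp.norm_apply_le v i) (norm_nonneg _)

lemma eLpNorm_fderiv_le_sum {μ : Measure (E d)} {p : ℝ≥0∞} (hp : 1 ≤ p) (hφ : ContDiff ℝ 1 φ) :
    eLpNorm (fderiv ℝ φ) p μ ≤ ∑ i, eLpNorm (partialD i φ) p μ := by
  calc eLpNorm (fderiv ℝ φ) p μ ≤ eLpNorm (∑ i, fun x => ‖partialD i φ x‖) p μ := by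
        refine eLpNorm_mono fun x => ?_
        rw [Finset.sum_apply, Real.norm_of_nonneg (Finset.sum_nonneg fun _ _ => norm_nonneg _)]
        exact norm_fderiv_le_sum_norm_partialD φ x
    _ ≤ ∑ i, eLpNorm (fun x => ‖partialD i φ x‖) p μ := eLpNorm_sum_le
        (fun i _ => (continuous_partialD_of_contDiff hφ i).norm.aestronglyMeasurable) hp
    _ = ∑ i, eLpNorm (partialD i φ) p μ := by simp only [eLpNorm_norm]

end PartialDerivatives

end Setting

section LpConvergence

variable {α : Type*} [MeasurableSpace α] {μ : Measure α} {p : ℝ≥0∞}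

lemma tendsto_eLpNorm_of_tendsto_eLpNorm_sub {F : Type*} [NormedAddCommGroup F] {f : ℕ → α → F}
    {g : α → F} (hp : 1 ≤ p) (hf : ∀ n, MemLp (f n) p μ) (hg : MemLp g p μ)
    (h : Tendsto (fun n => eLpNorm (fun x => f n x - g x) p μ) atTop (𝓝 0)) :
    Tendsto (fun n => eLpNorm (f n) p μ) atTop (𝓝 (eLpNorm g p μ)) := by
  have : Fact (1 ≤ p) := ⟨hp⟩
  have hLp : Tendsto (fun n => (hf n).toLp (f n)) atTop (𝓝 (hg.toLp g)) :=
    (Lp.tendsto_Lp_iff_tendsto_eLpNorm'' _ hf g hg).2 h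
  simpa only [Lp.enorm_toLp] using hLp.enorm

lemma tendsto_eLpNorm_comp_sub {f : ℕ → α → ℝ} {g : α → ℝ} {ψ : ℝ → ℝ} {K : ℝ≥0}
    (hψ : LipschitzWith K ψ)
    (h : Tendsto (fun n => eLpNorm (fun x => f n x - g x) p μ) atTop (𝓝 0)) :
    Tendsto (fun n => eLpNorm (fun x => ψ (f n x) - ψ (g x)) p μ) atTop (𝓝 0) := by
  have hbound : Tendsto (fun n => (K : ℝ≥0∞) * eLpNorm (fun x => f n x - g x) p μ) atTop (𝓝 0) := by
    simpa using ENNReal.Tendsto.const_mul h (Or.inr ENNReal.coe_ne_top)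
  refine tendsto_of_tendsto_of_tendsto_of_le_of_le tendsto_const_nhds hbound (fun _ => zero_le)
    fun n => eLpNorm_le_nnreal_smul_eLpNorm_of_ae_le_mul (Eventually.of_forall fun x => ?_) p
  simpa only [nndist_eq_nnnorm] using hψ.nndist_le (f n x) (g x)

lemma tendsto_eLpNorm_mul_sub {a : ℕ → α → ℝ} {a' : α → ℝ} {g : ℕ → α → ℝ} {g' : α → ℝ} {K : ℝ≥0}
    (hp : 1 ≤ p) (hp' : p ≠ ⊤) (ha : ∀ n, AEStronglyMeasurable (a n) μ)
    (ha' : AEStronglyMeasurable a' μ) (hg : ∀ n, AEStronglyMeasurable (g n) μ) (hg' : MemLp g' p μ)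
    (haK : ∀ n x, ‖a n x‖₊ ≤ K) (haK' : ∀ x, ‖a' x‖₊ ≤ K)
    (hlim : ∀ᵐ x ∂μ, Tendsto (fun n => a n x) atTop (𝓝 (a' x)))
    (h : Tendsto (fun n => eLpNorm (fun x => g n x - g' x) p μ) atTop (𝓝 0)) :
    Tendsto (fun n => eLpNorm (fun x => a n x * g n x - a' x * g' x) p μ) atTop (𝓝 0) := by
  have hfixed : Tendsto (fun n => eLpNorm (fun x => (a n x - a' x) * g' x) p μ) atTop (𝓝 0) := by
    refine tendsto_eLpNorm_zero_of_dominated (b := fun x => (K + K) * ‖g' x‖) hp'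
      (fun n => ((ha n).sub ha').mul hg'.1) (hg'.norm.const_mul _)
      (fun n => Eventually.of_forall fun x => ?_) ?_
    · rw [norm_mul]
      exact mul_le_mul_of_nonneg_right ((norm_sub_le _ _).trans
        (add_le_add (haK n x) (haK' x))) (norm_nonneg _)
    · filter_upwards [hlim] with x hx
      simpa using (hx.sub_const (a' x)).mul_const (g' x)
  have hmoving : Tendsto (fun n => (K : ℝ≥0∞) * eLpNorm (fun x => g n x - g' x) p μ) atTop
      (𝓝 0) := by
    simpa using ENNReal.Tendsto.const_mul h (Or.inr ENNReal.coe_ne_top)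
  have hsum := hmoving.add hfixed
  rw [add_zero] at hsum
  refine tendsto_of_tendsto_of_tendsto_of_le_of_le tendsto_const_nhds hsum (fun _ => zero_le)
    fun n => ?_
  have hsplit : (fun x => a n x * g n x - a' x * g' x) =
      (fun x => a n x * (g n x - g' x)) + fun x => (a n x - a' x) * g' x := by
    ext x
    simp only [Pi.add_apply]
    ring
  rw [hsplit]
  refine (eLpNorm_add_le ((ha n).mul ((hg n).sub hg'.1)) (((ha n).sub ha').mul hg'.1) hp).trans
    (add_le_add ?_ le_rfl)
  refine eLpNorm_le_nnreal_smul_eLpNorm_of_ae_le_mul (Eventually.of_forall fun x => ?_) p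
  simp only [Pi.mul_apply, Pi.sub_apply, nnnorm_mul]
  exact mul_le_mul_left (haK n x) _

end LpConvergence

namespace Setting

variable {d : ℕ} {S : Setting d}

lemma Admissible.exists_convex (hS : S.Admissible) : ∃ Ω : Set (E d), Ω.Nonempty ∧ IsOpen Ω ∧
    Bornology.IsBounded Ω ∧ Convex ℝ Ω ∧ S.mu = volume.restrict Ω := by
  cases S with
  | dirichlet Ω | neumann Ω => exact ⟨Ω, hS.1, hS.2.1, hS.2.2.1, hS.2.2.2, rfl⟩
  | periodic L => exact ⟨openBox L, nonempty_openBox hS, isOpen_openBox,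
      isCompact_closedBox.isBounded.subset openBox_subset_closedBox, convex_openBox,
      mu_periodic_eq_openBox L⟩

lemma Admissible.isFiniteMeasure (hS : S.Admissible) : IsFiniteMeasure S.mu := by
  obtain ⟨Ω, -, -, hb, -, hmu⟩ := hS.exists_convex
  exact ⟨by rw [hmu, Measure.restrict_apply_univ]; exact hb.measure_lt_top⟩

lemma Admissible.memLp_of_continuous (hS : S.Admissible) {F : Type*} [NormedAddCommGroup F]
    {φ : E d → F} (hφ : Continuous φ) (p : ℝ≥0∞) : MemLp φ p S.mu := by
  obtain ⟨Ω, -, ho, hb, -, hmu⟩ := hS.exists_convex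
  exact hmu ▸ memLp_restrict_of_isBounded hφ ho.measurableSet hb p

/-- A class of `C¹` functions that is dense in `V` and stable under composition with smooth
functions vanishing at `0`. -/
def IsCore : Setting d → (E d → ℝ) → Prop
  | dirichlet Ω, φ => (dirichlet Ω).IsTest φ
  | neumann _, φ => ContDiff ℝ 1 φ
  | periodic L, φ => ContDiff ℝ 1 φ ∧ ∀ i, Function.Periodic φ (EuclideanSpace.single i (L i))

lemma IsCore.contDiff {φ : E d → ℝ} (h : S.IsCore φ) : ContDiff ℝ 1 φ := by
  cases S with
  | dirichlet Ω => exact h.1.of_le (by simp)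
  | neumann Ω => exact h
  | periodic L => exact h.1

lemma IsCore.comp {φ : E d → ℝ} (h : S.IsCore φ) {ψ : ℝ → ℝ} (hψ : ContDiff ℝ ∞ ψ)
    (h0 : ψ 0 = 0) : S.IsCore fun x => ψ (φ x) := by
  cases S with
  | dirichlet Ω => exact ⟨hψ.comp h.1, h.2.1.comp_left h0,
      (closure_mono (Function.support_comp_subset h0 φ)).trans h.2.2⟩
  | neumann Ω => exact (hψ.of_le (by simp)).comp (show ContDiff ℝ 1 φ from h)
  | periodic L => exact ⟨(hψ.of_le (by simp)).comp h.1, fun i x => congrArg ψ (h.2 i x)⟩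

/-- The element of `L² × (L²)^d` with components represented by `u` and `G`. -/
def pairOf {u : E d → ℝ} {G : Fin d → E d → ℝ} (hu : MemLp u 2 S.mu)
    (hG : ∀ i, MemLp (G i) 2 S.mu) : S.Pair :=
  WithLp.toLp 2 (hu.toLp u, WithLp.toLp 2 fun i => (hG i).toLp (G i))

lemma pairOf_mem_W12_iff {u : E d → ℝ} {G : Fin d → E d → ℝ} (hu : MemLp u 2 S.mu)
    (hG : ∀ i, MemLp (G i) 2 S.mu) : pairOf hu hG ∈ S.W12 ↔ S.IsWeakGrad u G := by
  refine forall_congr' fun φ => forall_congr' fun _ => forall_congr' fun i => ?_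
  have hfst : ∫ x, (pairOf hu hG).fst x * partialD i φ x ∂S.mu =
      ∫ x, u x * partialD i φ x ∂S.mu :=
    integral_congr_ae (hu.coeFn_toLp.mono fun x hx => congrArg (· * partialD i φ x) hx)
  have hsnd : ∫ x, (pairOf hu hG).snd i x * φ x ∂S.mu = ∫ x, G i x * φ x ∂S.mu :=
    integral_congr_ae ((hG i).coeFn_toLp.mono fun x hx => congrArg (· * φ x) hx)
  rw [hfst, hsnd]

lemma integral_mul_eq_inner (u : S.H) {ψ : E d → ℝ} (h : MemLp ψ 2 S.mu) :
    ∫ x, u x * ψ x ∂S.mu = inner ℝ (h.toLp ψ) u := by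
  rw [L2.inner_def]
  refine integral_congr_ae ?_
  filter_upwards [h.coeFn_toLp] with x hx
  rw [hx, RCLike.inner_apply, conj_trivial]

lemma isClosed_W12 : IsClosed (S.W12 : Set S.Pair) := by
  have hinter : (S.W12 : Set S.Pair) = ⋂ (φ : E d → ℝ) (_ : S.IsTest φ) (i : Fin d),
      {p : S.Pair | ∫ x, p.fst x * partialD i φ x ∂S.mu = - ∫ x, p.snd i x * φ x ∂S.mu} := by
    ext p
    simp only [mem_iInter]
    rfl
  rw [hinter]
  refine isClosed_iInter fun φ => isClosed_iInter fun hφ => isClosed_iInter fun i => ?_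
  simp only [integral_mul_eq_inner _ (hφ.memLp_partialD i), integral_mul_eq_inner _ hφ.memLp]
  exact isClosed_eq (continuous_const.inner (WithLp.continuous_fst ..))
    (continuous_const.inner
      ((PiLp.continuous_apply 2 _ i).comp (WithLp.continuous_snd ..))).neg

lemma isClosed_Vsub : IsClosed (S.Vsub : Set S.Pair) := by
  cases S with
  | dirichlet Ω => exact Submodule.isClosed_topologicalClosure _
  | neumann Ω => exact isClosed_W12
  | periodic L => exact isClosed_W12

lemma isWeakGrad_neumann_of_contDiff {Ω : Set (E d)} {φ : E d → ℝ} (hφ : ContDiff ℝ 1 φ) :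
    (neumann Ω).IsWeakGrad φ fun i => partialD i φ := by
  rintro θ ⟨hθ, hθc, hθΩ⟩ i
  have hzero : ∀ x ∉ Ω, θ x = 0 := fun x hx => image_eq_zero_of_notMem_tsupport fun h => hx (hθΩ h)
  have hzero_deriv : ∀ x ∉ Ω, partialD i θ x = 0 := fun x hx => by
    rw [partialD, Function.notMem_support.1 fun h => hx (hθΩ (support_fderiv_subset ℝ h))]
    rfl
  have hθ1 : ContDiff ℝ 1 θ := hθ.of_le (by simp)
  have hcs : HasCompactSupport (partialD i θ) := hasCompactSupport_partialD hθc i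
  change ∫ x in Ω, _ = - ∫ x in Ω, _
  rw [setIntegral_eq_integral_of_forall_compl_eq_zero fun x hx => by
      rw [hzero_deriv x hx, mul_zero],
    setIntegral_eq_integral_of_forall_compl_eq_zero fun x hx => by rw [hzero x hx, mul_zero]]
  exact integral_mul_fderiv_eq_neg_fderiv_mul_of_integrable
    (((continuous_partialD_of_contDiff hφ i).mul hθ.continuous).integrable_of_hasCompactSupport
      hθc.mul_left)
    ((hφ.continuous.mul (continuous_partialD_of_contDiff hθ1 i)).integrable_of_hasCompactSupport
      hcs.mul_left)
    ((hφ.continuous.mul hθ.continuous).integrable_of_hasCompactSupport hθc.mul_left)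
    (fun x _ => hφ.differentiable one_ne_zero x) (fun x _ => hθ1.differentiable one_ne_zero x)

lemma isWeakGrad_periodic_of_contDiff {L : Fin d → ℝ} (hL : ∀ i, 0 < L i) {φ : E d → ℝ}
    (hφ : ContDiff ℝ 1 φ) (hper : ∀ i, Function.Periodic φ (EuclideanSpace.single i (L i))) :
    (periodic L).IsWeakGrad φ fun i => partialD i φ := by
  rintro θ ⟨hθ, hθper⟩ i
  have hθ1 : ContDiff ℝ 1 θ := hθ.of_le (by simp)
  have hzero := integral_partialD_mu_periodic hL (hφ.mul hθ1)
    (fun i => (hper i).mul (hθper i)) i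
  have hL' : (periodic L).Admissible := hL
  have hint : ∀ {h : E d → ℝ}, Continuous h → Integrable h (periodic L).mu := fun hh =>
    memLp_one_iff_integrable.1 (hL'.memLp_of_continuous hh 1)
  have hleft : Integrable (fun x => φ x * partialD i θ x) (periodic L).mu :=
    hint (hφ.continuous.mul (continuous_partialD_of_contDiff hθ1 i))
  have hright : Integrable (fun x => partialD i φ x * θ x) (periodic L).mu :=
    hint ((continuous_partialD_of_contDiff hφ i).mul hθ.continuous)
  simp only [partialD_mul (hφ.differentiable one_ne_zero _) (hθ1.differentiable one_ne_zero _)]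
    at hzero
  rw [integral_add hleft hright] at hzero
  exact eq_neg_of_add_eq_zero_left hzero

lemma IsCore.pairOf_mem (hS : S.Admissible) {φ : E d → ℝ} (h : S.IsCore φ)
    (hu : MemLp φ 2 S.mu) (hG : ∀ i, MemLp (partialD i φ) 2 S.mu) : pairOf hu hG ∈ S.Vsub := by
  cases S with
  | dirichlet Ω =>
    exact subset_closure (Submodule.subset_span ⟨φ, h, hu.coeFn_toLp, fun i => (hG i).coeFn_toLp⟩)
  | neumann Ω => exact (pairOf_mem_W12_iff hu hG).2 (isWeakGrad_neumann_of_contDiff h)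
  | periodic L => exact (pairOf_mem_W12_iff hu hG).2 (isWeakGrad_periodic_of_contDiff hS h.1 h.2)

lemma IsTest.differentiable {φ : E d → ℝ} (h : S.IsTest φ) : Differentiable ℝ φ := by
  cases S <;> exact h.1.differentiable (by simp)

lemma isTest_zero : S.IsTest 0 := by
  cases S with
  | dirichlet Ω | neumann Ω => exact ⟨contDiff_const, HasCompactSupport.zero, by simp [tsupport]⟩
  | periodic L => exact ⟨contDiff_const, fun _ _ => rfl⟩

lemma IsTest.add {φ ψ : E d → ℝ} (hφ : S.IsTest φ) (hψ : S.IsTest ψ) : S.IsTest (φ + ψ) := by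
  cases S with
  | dirichlet Ω | neumann Ω => exact ⟨hφ.1.add hψ.1, hφ.2.1.add hψ.2.1,
      (tsupport_add φ ψ).trans (union_subset hφ.2.2 hψ.2.2)⟩
  | periodic L => exact ⟨hφ.1.add hψ.1, fun i x => congrArg₂ (· + ·) (hφ.2 i x) (hψ.2 i x)⟩

lemma IsTest.const_smul {φ : E d → ℝ} (hφ : S.IsTest φ) (c : ℝ) : S.IsTest (c • φ) := by
  cases S with
  | dirichlet Ω | neumann Ω => exact ⟨contDiff_const.smul hφ.1, hφ.2.1.smul_left,
      (tsupport_smul_subset_right (fun _ => c) φ).trans hφ.2.2⟩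
  | periodic L => exact ⟨contDiff_const.smul hφ.1, fun i x => congrArg (c • ·) (hφ.2 i x)⟩

lemma exists_isTest_of_mem_span {p : S.Pair}
    (hp : p ∈ Submodule.span ℝ {p : S.Pair | ∃ φ, S.IsTest φ ∧ p.fst =ᵐ[S.mu] φ ∧
      ∀ i, p.snd i =ᵐ[S.mu] partialD i φ}) :
    ∃ φ, S.IsTest φ ∧ p.fst =ᵐ[S.mu] φ ∧ ∀ i, p.snd i =ᵐ[S.mu] partialD i φ := by
  induction hp using Submodule.span_induction with
  | mem _ hp => exact hp
  | zero =>
    refine ⟨0, isTest_zero, Lp.coeFn_zero .., fun i => (Lp.coeFn_zero ..).trans ?_⟩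
    exact Eventually.of_forall fun x => by simp [partialD]
  | add p q _ _ hp hq =>
    obtain ⟨φ, hφ, hfst, hsnd⟩ := hp
    obtain ⟨ψ, hψ, hfst', hsnd'⟩ := hq
    refine ⟨φ + ψ, hφ.add hψ, (Lp.coeFn_add ..).trans (hfst.add hfst'), fun i =>
      ((Lp.coeFn_add ..).trans ((hsnd i).add (hsnd' i))).trans (Eventually.of_forall fun x => ?_)⟩
    simp only [Pi.add_apply, partialD]
    rw [fderiv_add (hφ.differentiable x) (hψ.differentiable x)]
    rfl
  | smul c p _ hp =>
    obtain ⟨φ, hφ, hfst, hsnd⟩ := hp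
    refine ⟨c • φ, hφ.const_smul c, (Lp.coeFn_smul ..).trans (hfst.const_smul c), fun i =>
      ((Lp.coeFn_smul ..).trans ((hsnd i).const_smul c)).trans (Eventually.of_forall fun x => ?_)⟩
    simp only [Pi.smul_apply, partialD]
    rw [fderiv_const_smul (hφ.differentiable x)]
    rfl

lemma V.memLp_fn (v : S.V) : MemLp (V.fn v) 2 S.mu := Lp.memLp _

lemma memLp_grad (v : S.V) (i : Fin d) : MemLp (S.grad v i : E d → ℝ) 2 S.mu := Lp.memLp _

lemma exists_isCore_tendstoW12 (hS : S.Admissible) (v : S.V) : ∃ φ : ℕ → E d → ℝ,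
    (∀ n, S.IsCore (φ n)) ∧ S.TendstoW12 φ (V.fn v) fun i => S.grad v i := by
  cases S with
  | dirichlet Ω =>
    obtain ⟨p, hp, hlim⟩ := mem_closure_iff_seq_limit.1 v.2
    choose φ hφ hfst hsnd using fun n => exists_isTest_of_mem_span (hp n)
    have hlim_fst := ((WithLp.continuous_fst ..).tendsto v.1).comp hlim
    have hlim_snd := fun i =>
      (((PiLp.continuous_apply 2 _ i).comp (WithLp.continuous_snd ..)).tendsto v.1).comp hlim
    exact ⟨φ, hφ,
      ((Lp.tendsto_Lp_iff_tendsto_eLpNorm' _ _).1 hlim_fst).congr fun n =>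
        eLpNorm_congr_ae ((hfst n).sub EventuallyEq.rfl),
      fun i => ((Lp.tendsto_Lp_iff_tendsto_eLpNorm' _ _).1 (hlim_snd i)).congr fun n =>
        eLpNorm_congr_ae ((hsnd n i).sub EventuallyEq.rfl)⟩
  | neumann Ω =>
    exact exists_contDiff_tendstoW12_of_isWeakGrad_neumann hS.1 hS.2.1 hS.2.2.1
      hS.2.2.2 (V.memLp_fn v) (memLp_grad v) v.2
  | periodic L =>
    exact exists_contDiff_tendstoW12_of_isWeakGrad_periodic hS (V.memLp_fn v)
      (memLp_grad v) v.2

lemma exists_isCore_tendstoW12_ae (hS : S.Admissible) (v : S.V) : ∃ φ : ℕ → E d → ℝ,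
    (∀ n, S.IsCore (φ n)) ∧ S.TendstoW12 φ (V.fn v) (fun i => S.grad v i) ∧
      ∀ᵐ x ∂S.mu, Tendsto (fun n => φ n x) atTop (𝓝 (V.fn v x)) := by
  obtain ⟨φ, hφ, hfn, hgrad⟩ := exists_isCore_tendstoW12 hS v
  obtain ⟨ns, hns, hae⟩ := (tendstoInMeasure_of_tendsto_eLpNorm two_ne_zero
    (fun n => (hφ n).contDiff.continuous.aestronglyMeasurable) (V.memLp_fn v).1
    hfn).exists_seq_tendsto_ae
  exact ⟨fun n => φ (ns n), fun n => hφ _,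
    ⟨hfn.comp hns.tendsto_atTop, fun i => (hgrad i).comp hns.tendsto_atTop⟩, hae⟩

lemma norm_sq_eq (v : S.V) : ‖v‖ ^ 2 = ‖S.inclH v‖ ^ 2 + ∑ i, ‖S.grad v i‖ ^ 2 := by
  have hprod : ‖v‖ ^ 2 = ‖(v : S.Pair).fst‖ ^ 2 + ‖(v : S.Pair).snd‖ ^ 2 :=
    WithLp.prod_norm_sq_eq_of_L2 _
  rw [hprod, PiLp.norm_sq_eq_of_L2]
  rfl

lemma norm_inclH_le (v : S.V) : ‖S.inclH v‖ ≤ ‖v‖ := by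
  refine le_of_sq_le_sq ?_ (norm_nonneg _)
  rw [norm_sq_eq]
  exact le_add_of_nonneg_right (Finset.sum_nonneg fun _ _ => sq_nonneg _)

lemma norm_grad_apply_le (v : S.V) (i : Fin d) : ‖S.grad v i‖ ≤ ‖v‖ := by
  refine le_of_sq_le_sq ?_ (norm_nonneg _)
  rw [norm_sq_eq]
  exact (Finset.single_le_sum (f := fun i => ‖S.grad v i‖ ^ 2) (fun _ _ => sq_nonneg _)
    (Finset.mem_univ i)).trans (le_add_of_nonneg_left (sq_nonneg _))

lemma pairOf_mem_of_tendstoW12 (hS : S.Admissible) {φ : ℕ → E d → ℝ} {u : E d → ℝ}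
    {G : Fin d → E d → ℝ} (hφ : ∀ n, S.IsCore (φ n)) (hu : MemLp u 2 S.mu)
    (hG : ∀ i, MemLp (G i) 2 S.mu) (h : S.TendstoW12 φ u G) : pairOf hu hG ∈ S.Vsub := by
  have hφ2 : ∀ n, MemLp (φ n) 2 S.mu := fun n =>
    hS.memLp_of_continuous (hφ n).contDiff.continuous 2
  have hdφ2 : ∀ n i, MemLp (partialD i (φ n)) 2 S.mu := fun n i =>
    hS.memLp_of_continuous (continuous_partialD_of_contDiff (hφ n).contDiff i) 2
  refine isClosed_Vsub.mem_of_tendsto (b := atTop) (f := fun n => pairOf (hφ2 n) (hdφ2 n)) ?_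
    (Eventually.of_forall fun n => (hφ n).pairOf_mem hS _ _)
  refine ((WithLp.prod_continuous_toLp ..).tendsto _).comp (Tendsto.prodMk_nhds
    ((Lp.tendsto_Lp_iff_tendsto_eLpNorm'' _ _ _ _).2 h.1) ?_)
  exact ((PiLp.continuous_toLp ..).tendsto _).comp (tendsto_pi_nhds.2 fun i =>
    (Lp.tendsto_Lp_iff_tendsto_eLpNorm'' _ _ _ _).2 (h.2 i))

lemma exists_V_of_pairOf_mem {u : E d → ℝ} {G : Fin d → E d → ℝ} (hu : MemLp u 2 S.mu)
    (hG : ∀ i, MemLp (G i) 2 S.mu) (h : pairOf hu hG ∈ S.Vsub) :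
    ∃ z : S.V, V.fn z =ᵐ[S.mu] u ∧ ∀ i, S.grad z i =ᵐ[S.mu] G i :=
  ⟨⟨_, h⟩, hu.coeFn_toLp, fun i => (hG i).coeFn_toLp⟩

lemma TendstoW12.comp {φ : ℕ → E d → ℝ} {u : E d → ℝ} {G : Fin d → E d → ℝ}
    (h : S.TendstoW12 φ u G) (hφ : ∀ n, ContDiff ℝ 1 (φ n))
    (hlim : ∀ᵐ x ∂S.mu, Tendsto (fun n => φ n x) atTop (𝓝 (u x))) (hu : MemLp u 2 S.mu)
    (hG : ∀ i, MemLp (G i) 2 S.mu) {ψ : ℝ → ℝ} (hψ : ContDiff ℝ 1 ψ) {K : ℝ≥0}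
    (hK : ∀ s, ‖deriv ψ s‖₊ ≤ K) :
    S.TendstoW12 (fun n x => ψ (φ n x)) (fun x => ψ (u x))
      fun i x => deriv ψ (u x) * G i x := by
  have hdψ : Differentiable ℝ ψ := hψ.differentiable one_ne_zero
  have hcont : Continuous (deriv ψ) := hψ.continuous_deriv_one
  refine ⟨tendsto_eLpNorm_comp_sub (lipschitzWith_of_nnnorm_deriv_le hdψ hK) h.1, fun i => ?_⟩
  have hchain : ∀ n x, partialD i (fun x => ψ (φ n x)) x =
      deriv ψ (φ n x) * partialD i (φ n) x := fun n x =>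
    partialD_comp (hdψ _) ((hφ n).differentiable one_ne_zero x) i
  simp only [hchain]
  exact tendsto_eLpNorm_mul_sub one_le_two ENNReal.ofNat_ne_top
    (fun n => (hcont.comp (hφ n).continuous).aestronglyMeasurable)
    (hcont.comp_aestronglyMeasurable hu.1)
    (fun n => (continuous_partialD_of_contDiff (hφ n) i).aestronglyMeasurable) (hG i)
    (fun n x => hK _) (fun x => hK _)
    (hlim.mono fun x hx => (hcont.tendsto _).comp hx) (h.2 i)

lemma exists_V_comp (hS : S.Admissible) (v : S.V) {ψ : ℝ → ℝ} (hψ : ContDiff ℝ ∞ ψ)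
    (h0 : ψ 0 = 0) {K : ℝ≥0} (hK : ∀ s, ‖deriv ψ s‖₊ ≤ K) :
    ∃ z : S.V, V.fn z =ᵐ[S.mu] (fun x => ψ (V.fn v x)) ∧
      ∀ i, S.grad z i =ᵐ[S.mu] fun x => deriv ψ (V.fn v x) * S.grad v i x := by
  obtain ⟨φ, hφ, htendsto, hae⟩ := exists_isCore_tendstoW12_ae hS v
  have hψ1 : ContDiff ℝ 1 ψ := hψ.of_le (by simp)
  have hcomp : MemLp (fun x => ψ (V.fn v x)) 2 S.mu :=
    (lipschitzWith_of_nnnorm_deriv_le (hψ1.differentiable one_ne_zero) hK).comp_memLp h0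
      (V.memLp_fn v)
  have hgrad : ∀ i, MemLp (fun x => deriv ψ (V.fn v x) * S.grad v i x) 2 S.mu := fun i =>
    (memLp_grad v i).of_le_mul ((hψ1.continuous_deriv_one.comp_aestronglyMeasurable
      (V.memLp_fn v).1).mul (memLp_grad v i).1) (c := K) (Eventually.of_forall fun x => by
        rw [norm_mul]
        exact mul_le_mul_of_nonneg_right (hK _) (norm_nonneg _))
  exact exists_V_of_pairOf_mem hcomp hgrad (pairOf_mem_of_tendstoW12 hS
    (fun n => (hφ n).comp hψ h0) hcomp hgrad (htendsto.comp (fun n => (hφ n).contDiff) hae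
      (V.memLp_fn v) (memLp_grad v) hψ1 hK))

lemma exists_contDiff_hasCompactSupport_eqOn {ψ : ℝ → ℝ} (hψ : ContDiff ℝ ∞ ψ) (R : ℝ) :
    ∃ ψ' : ℝ → ℝ, ContDiff ℝ ∞ ψ' ∧ HasCompactSupport ψ' ∧
      ∀ s, |s| ≤ R → ψ' s = ψ s ∧ deriv ψ' s = deriv ψ s := by
  let χ : ContDiffBump (0 : ℝ) := ⟨|R| + 1, |R| + 2, by positivity, by linarith⟩
  refine ⟨fun s => χ s * ψ s, χ.contDiff.mul hψ, χ.hasCompactSupport.mul_right, fun s hs => ?_⟩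
  have hs' : s ∈ Metric.ball (0 : ℝ) (|R| + 1) := by
    rw [mem_ball_zero_iff, Real.norm_eq_abs]
    linarith [le_abs_self R]
  have hlocal : (fun s => χ s * ψ s) =ᶠ[𝓝 s] ψ := by
    filter_upwards [Metric.isOpen_ball.mem_nhds hs'] with t ht
    rw [χ.one_of_mem_closedBall (Metric.ball_subset_closedBall ht), one_mul]
  exact ⟨hlocal.eq_of_nhds, hlocal.deriv_eq⟩

lemma exists_V_comp_of_bounded (hS : S.Admissible) (v : S.V) {R : ℝ}
    (hv : ∀ᵐ x ∂S.mu, |V.fn v x| ≤ R) {ψ : ℝ → ℝ} (hψ : ContDiff ℝ ∞ ψ) (h0 : ψ 0 = 0) :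
    ∃ z : S.V, V.fn z =ᵐ[S.mu] (fun x => ψ (V.fn v x)) ∧
      ∀ i, S.grad z i =ᵐ[S.mu] fun x => deriv ψ (V.fn v x) * S.grad v i x := by
  obtain ⟨ψ', hψ', hsupp, heq⟩ := exists_contDiff_hasCompactSupport_eqOn hψ |R|
  obtain ⟨K, hK⟩ := hsupp.deriv.exists_bound_of_continuous (hψ'.continuous_deriv (by simp))
  obtain ⟨z, hfn, hgrad⟩ := exists_V_comp hS v hψ' (by rw [(heq 0 (by simp)).1, h0])
    (K := K.toNNReal) fun s => NNReal.le_toNNReal_of_coe_le (hK s)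
  have hv' : ∀ᵐ x ∂S.mu, |V.fn v x| ≤ |R| := hv.mono fun x hx => hx.trans (le_abs_self R)
  refine ⟨z, ?_, fun i => ?_⟩
  · filter_upwards [hfn, hv'] with x hx hx'
    rw [hx, (heq _ hx').1]
  · filter_upwards [hgrad i, hv'] with x hx hx'
    rw [hx, (heq _ hx').2]

lemma V.fn_add (u v : S.V) : V.fn (u + v) =ᵐ[S.mu] fun x => V.fn u x + V.fn v x :=
  Lp.coeFn_add ..

lemma V.fn_sub (u v : S.V) : V.fn (u - v) =ᵐ[S.mu] fun x => V.fn u x - V.fn v x :=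
  Lp.coeFn_sub ..

lemma V.fn_smul (c : ℝ) (v : S.V) : V.fn (c • v) =ᵐ[S.mu] fun x => c * V.fn v x :=
  Lp.coeFn_smul ..

lemma grad_add (u v : S.V) (i : Fin d) :
    S.grad (u + v) i =ᵐ[S.mu] fun x => S.grad u i x + S.grad v i x :=
  Lp.coeFn_add ..

lemma grad_sub (u v : S.V) (i : Fin d) :
    S.grad (u - v) i =ᵐ[S.mu] fun x => S.grad u i x - S.grad v i x :=
  Lp.coeFn_sub ..

lemma grad_smul (c : ℝ) (v : S.V) (i : Fin d) :
    S.grad (c • v) i =ᵐ[S.mu] fun x => c * S.grad v i x :=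
  Lp.coeFn_smul ..

-- Polarization reduces the product rule to the chain rule for `s ↦ s²`.
lemma exists_V_mul_of_bounded (hS : S.Admissible) (u v : S.V) {R R' : ℝ}
    (hu : ∀ᵐ x ∂S.mu, |V.fn u x| ≤ R) (hv : ∀ᵐ x ∂S.mu, |V.fn v x| ≤ R') :
    ∃ z : S.V, V.fn z =ᵐ[S.mu] (fun x => V.fn u x * V.fn v x) ∧
      ∀ i, S.grad z i =ᵐ[S.mu] fun x => V.fn u x * S.grad v i x + V.fn v x * S.grad u i x := by
  have hsq : ContDiff ℝ ∞ fun s : ℝ => s ^ 2 := contDiff_id.pow 2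
  have hderiv : ∀ s : ℝ, deriv (fun s : ℝ => s ^ 2) s = 2 * s := fun s => by simp
  obtain ⟨a, ha, ha'⟩ := exists_V_comp_of_bounded hS (u + v) (R := R + R') (by
    filter_upwards [V.fn_add u v, hu, hv] with x hadd hux hvx
    rw [hadd]; exact (abs_add_le _ _).trans (add_le_add hux hvx)) hsq (by simp)
  obtain ⟨b, hb, hb'⟩ := exists_V_comp_of_bounded hS (u - v) (R := R + R') (by
    filter_upwards [V.fn_sub u v, hu, hv] with x hsub hux hvx
    rw [hsub]; exact (abs_sub _ _).trans (add_le_add hux hvx)) hsq (by simp)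
  refine ⟨(1 / 4 : ℝ) • (a - b), ?_, fun i => ?_⟩
  · filter_upwards [V.fn_smul (1 / 4) (a - b), V.fn_sub a b, ha, hb, V.fn_add u v, V.fn_sub u v]
      with x hsmul hab hax hbx hadd hsub
    rw [hsmul, hab, hax, hbx, hadd, hsub]; ring
  · filter_upwards [grad_smul (1 / 4) (a - b) i, grad_sub a b i, ha' i, hb' i, V.fn_add u v,
      V.fn_sub u v, grad_add u v i, grad_sub u v i]
      with x hsmul hab hax hbx hadd hsub hadd' hsub'
    rw [hsmul, hab, hax, hbx, hadd, hsub, hadd', hsub', hderiv, hderiv]; ring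

lemma V.eLpNorm_fn_le (v : S.V) : eLpNorm (V.fn v) 2 S.mu ≤ ‖v‖ₑ := by
  rw [show eLpNorm (V.fn v) 2 S.mu = ‖S.inclH v‖ₑ from (Lp.enorm_def _).symm]
  exact enorm_le_iff_norm_le.2 (norm_inclH_le v)

lemma eLpNorm_grad_le (v : S.V) (i : Fin d) : eLpNorm (S.grad v i) 2 S.mu ≤ ‖v‖ₑ := by
  rw [← Lp.enorm_def]
  exact enorm_le_iff_norm_le.2 (norm_grad_apply_le v i)

lemma exists_eLpNorm_six_le (hd1 : 1 ≤ d) (hd3 : d ≤ 3) (hS : S.Admissible) :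
    ∃ C : ℝ≥0, ∀ v : S.V, eLpNorm (V.fn v) 6 S.mu ≤ C * ‖v‖ₑ := by
  obtain ⟨Ω, -, ho, hb, hconv, hmu⟩ := hS.exists_convex
  obtain ⟨C, hsob⟩ := exists_eLpNorm_six_le_of_convex hd1 hd3 ho hb hconv
  rw [← hmu] at hsob
  refine ⟨C * (1 + d), fun v => ?_⟩
  obtain ⟨φ, hφ, ⟨hfn, hgrad⟩, hae⟩ := exists_isCore_tendstoW12_ae hS v
  have hC1 : ∀ n, ContDiff ℝ 1 (φ n) := fun n => (hφ n).contDiff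
  have hlim : Tendsto (fun n => (C : ℝ≥0∞) * (eLpNorm (φ n) 2 S.mu +
      ∑ i, eLpNorm (partialD i (φ n)) 2 S.mu)) atTop
      (𝓝 (C * (eLpNorm (V.fn v) 2 S.mu + ∑ i, eLpNorm (S.grad v i) 2 S.mu))) := by
    refine ENNReal.Tendsto.const_mul (Tendsto.add ?_ (tendsto_finsetSum _ fun i _ => ?_))
      (Or.inr ENNReal.coe_ne_top)
    · exact tendsto_eLpNorm_of_tendsto_eLpNorm_sub one_le_two
        (fun n => hS.memLp_of_continuous (hC1 n).continuous 2) (V.memLp_fn v) hfn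
    · exact tendsto_eLpNorm_of_tendsto_eLpNorm_sub one_le_two
        (fun n => hS.memLp_of_continuous (continuous_partialD_of_contDiff (hC1 n) i) 2)
        (memLp_grad v i) (hgrad i)
  calc eLpNorm (V.fn v) 6 S.mu ≤ liminf (fun n => eLpNorm (φ n) 6 S.mu) atTop :=
        Lp.eLpNorm_lim_le_liminf_eLpNorm
          (fun n => (hC1 n).continuous.aestronglyMeasurable) _ hae
    _ ≤ liminf (fun n => (C : ℝ≥0∞) * (eLpNorm (φ n) 2 S.mu +
        ∑ i, eLpNorm (partialD i (φ n)) 2 S.mu)) atTop :=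
      liminf_le_liminf (Eventually.of_forall fun n => (hsob (φ n) (hC1 n)).trans (by
        gcongr
        exact eLpNorm_fderiv_le_sum one_le_two (hC1 n)))
    _ = C * (eLpNorm (V.fn v) 2 S.mu + ∑ i, eLpNorm (S.grad v i) 2 S.mu) := hlim.liminf_eq
    _ ≤ C * (‖v‖ₑ + ∑ _i : Fin d, ‖v‖ₑ) := by
      gcongr with i
      · exact V.eLpNorm_fn_le v
      · exact eLpNorm_grad_le v i
    _ = (C * (1 + d) : ℝ≥0) * ‖v‖ₑ := by
      rw [Finset.sum_const, Finset.card_univ, Fintype.card_fin, nsmul_eq_mul]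
      push_cast
      ring

end Setting

/-! ### The Agmon inequality -/

section LpNorm

variable {α F : Type*} {m : MeasurableSpace α} {μ : Measure α} [NormedAddCommGroup F]
  {p q r : ℝ≥0∞}

lemma lpNorm_congr_ae {f g : α → F} (h : f =ᵐ[μ] g) : lpNorm f p μ = lpNorm g p μ := by
  by_cases hf : AEStronglyMeasurable f μ
  · rw [← toReal_eLpNorm hf, ← toReal_eLpNorm (hf.congr h), eLpNorm_congr_ae h]
  · rw [lpNorm_of_not_aestronglyMeasurable hf,
      lpNorm_of_not_aestronglyMeasurable (mt (fun hg => hg.congr h.symm) hf)]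

lemma lpNorm_coeFn (u : Lp F p μ) : lpNorm u p μ = ‖u‖ := by
  rw [← toReal_eLpNorm (Lp.aestronglyMeasurable u), Lp.norm_def]

lemma norm_toLp_eq_lpNorm {f : α → F} (hf : MemLp f p μ) : ‖hf.toLp f‖ = lpNorm f p μ := by
  rw [Lp.norm_toLp, toReal_eLpNorm hf.1]

lemma lpNorm_mono_ae {G : Type*} [NormedAddCommGroup G] {f : α → F} {g : α → G}
    (hg : MemLp g p μ) (h : ∀ᵐ x ∂μ, ‖f x‖ ≤ ‖g x‖) : lpNorm f p μ ≤ lpNorm g p μ := by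
  by_cases hf : AEStronglyMeasurable f μ
  · rw [← toReal_eLpNorm hf, ← toReal_eLpNorm hg.1]
    exact ENNReal.toReal_mono hg.eLpNorm_ne_top (eLpNorm_mono_ae h)
  · rw [lpNorm_of_not_aestronglyMeasurable hf]
    exact lpNorm_nonneg

lemma lpNorm_const_mul (c : ℝ) (f : α → ℝ) :
    lpNorm (fun x => c * f x) p μ = |c| * lpNorm f p μ :=
  lpNorm_const_smul c f μ

lemma lpNorm_mul_le {f g : α → ℝ} [p.HolderTriple q r] (hf : MemLp f p μ) (hg : MemLp g q μ) :
    lpNorm (fun x => f x * g x) r μ ≤ lpNorm f p μ * lpNorm g q μ := by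
  have hle : eLpNorm (fun x => f x * g x) r μ ≤ eLpNorm f p μ * eLpNorm g q μ :=
    eLpNorm_smul_le_mul_eLpNorm (p := p) (q := q) (r := r) (f := g) (φ := f) hg.1 hf.1
  rw [← toReal_eLpNorm (f := fun x => f x * g x) (hf.1.mul hg.1), ← toReal_eLpNorm hf.1,
    ← toReal_eLpNorm hg.1, ← ENNReal.toReal_mul]
  exact ENNReal.toReal_mono (ENNReal.mul_ne_top hf.eLpNorm_ne_top hg.eLpNorm_ne_top) hle

lemma integral_mul_eq_inner_toLp {f g : α → ℝ} (hf : MemLp f 2 μ) (hg : MemLp g 2 μ) :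
    ∫ x, f x * g x ∂μ = inner ℝ (hf.toLp f) (hg.toLp g) := by
  rw [L2.inner_def]
  refine integral_congr_ae ?_
  filter_upwards [hf.coeFn_toLp, hg.coeFn_toLp] with x hfx hgx
  simp only [hfx, hgx, RCLike.inner_apply, conj_trivial, mul_comm]

lemma abs_integral_mul_le {f g : α → ℝ} (hf : MemLp f 2 μ) (hg : MemLp g 2 μ) :
    |∫ x, f x * g x ∂μ| ≤ lpNorm f 2 μ * lpNorm g 2 μ := by
  rw [integral_mul_eq_inner_toLp hf hg, ← norm_toLp_eq_lpNorm hf, ← norm_toLp_eq_lpNorm hg]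
  exact abs_real_inner_le_norm _ _

lemma sq_lpNorm_two {f : α → ℝ} (hf : MemLp f 2 μ) : lpNorm f 2 μ ^ 2 = ∫ x, f x ^ 2 ∂μ := by
  simp only [sq (f _)]
  rw [integral_mul_eq_inner_toLp hf hf, real_inner_self_eq_norm_sq, norm_toLp_eq_lpNorm]

lemma holderTriple_six_six_three : ENNReal.HolderTriple 6 6 3 :=
  .of_toReal ⟨by norm_num, by norm_num, by norm_num⟩

lemma holderTriple_three_six_two : ENNReal.HolderTriple 3 6 2 :=
  .of_toReal ⟨by norm_num, by norm_num, by norm_num⟩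

lemma memLp_mul_mul_of_six {f g h : α → ℝ} (hf : MemLp f 6 μ) (hg : MemLp g 6 μ)
    (hh : MemLp h 6 μ) : MemLp (fun x => f x * g x * h x) 2 μ :=
  have := holderTriple_six_six_three
  have := holderTriple_three_six_two
  have hfg : MemLp (fun x => f x * g x) 3 μ := hg.mul' hf
  hh.mul' hfg

lemma lpNorm_mul_mul_le_six {f g h : α → ℝ} (hf : MemLp f 6 μ) (hg : MemLp g 6 μ)
    (hh : MemLp h 6 μ) :
    lpNorm (fun x => f x * g x * h x) 2 μ ≤ lpNorm f 6 μ * lpNorm g 6 μ * lpNorm h 6 μ := by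
  have := holderTriple_six_six_three
  have := holderTriple_three_six_two
  have hfg : MemLp (fun x => f x * g x) 3 μ := hg.mul' hf
  calc lpNorm (fun x => f x * g x * h x) 2 μ
      ≤ lpNorm (fun x => f x * g x) 3 μ * lpNorm h 6 μ := lpNorm_mul_le hfg hh
    _ ≤ _ := mul_le_mul_of_nonneg_right (lpNorm_mul_le hf hg) lpNorm_nonneg

end LpNorm

section Stampacchia

variable {b : ℝ → ℝ} {Q D k₀ : ℝ}

-- One step from level `j` to `j + 1` gains the factor `4 * Q * b k₀ / D ≤ 1` beyond `1 / 2`,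
-- because the hypothesis is quadratic in `b`.
lemma le_geometric_of_stampacchia (hb : ∀ k, 0 ≤ b k) (hD : 0 < D) (hQ : 0 ≤ Q)
    (hQD : 4 * Q * b k₀ ≤ D)
    (hstep : ∀ k l, k₀ ≤ k → k < l → (l - k) * b l ≤ Q * b k ^ 2) (j : ℕ) :
    b (k₀ + D * (1 - (1 / 2) ^ j)) ≤ b k₀ * (1 / 2) ^ j := by
  induction j with
  | zero => simp
  | succ j ih =>
    set t : ℝ := (1 / 2) ^ j
    have ht : 0 < t := by positivity
    have ht1 : t ≤ 1 := pow_le_one₀ (by norm_num) (by norm_num)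
    rw [show (1 / 2 : ℝ) ^ (j + 1) = t / 2 by rw [pow_succ]; ring]
    have hk₀ : k₀ ≤ k₀ + D * (1 - t) :=
      le_add_of_nonneg_right (mul_nonneg hD.le (sub_nonneg.2 ht1))
    have hlt : k₀ + D * (1 - t) < k₀ + D * (1 - t / 2) := by gcongr; linarith
    refine le_of_mul_le_mul_left ?_ (show 0 < D * t / 2 by positivity)
    calc D * t / 2 * b (k₀ + D * (1 - t / 2))
        = (k₀ + D * (1 - t / 2) - (k₀ + D * (1 - t))) * b (k₀ + D * (1 - t / 2)) := by ring
      _ ≤ Q * b (k₀ + D * (1 - t)) ^ 2 := hstep _ _ hk₀ hlt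
      _ ≤ Q * (b k₀ * t) ^ 2 := by gcongr; exact hb _
      _ = 4 * Q * b k₀ * (b k₀ * t ^ 2 / 4) := by ring
      _ ≤ D * (b k₀ * t ^ 2 / 4) :=
        mul_le_mul_of_nonneg_right hQD (by have := hb k₀; positivity)
      _ = D * t / 2 * (b k₀ * (t / 2)) := by ring

lemma eq_zero_of_stampacchia (hb : ∀ k, 0 ≤ b k) (hanti : Antitone b) (hD : 0 < D) (hQ : 0 ≤ Q)
    (hQD : 4 * Q * b k₀ ≤ D)
    (hstep : ∀ k l, k₀ ≤ k → k < l → (l - k) * b l ≤ Q * b k ^ 2) : b (k₀ + D) = 0 := by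
  refine le_antisymm ?_ (hb _)
  have hlim : Tendsto (fun j : ℕ => b k₀ * (1 / 2) ^ j) atTop (𝓝 0) := by
    simpa using (tendsto_pow_atTop_nhds_zero_of_lt_one (r := (1 / 2 : ℝ)) (by norm_num)
      (by norm_num)).const_mul (b k₀)
  refine ge_of_tendsto' hlim fun j => (hanti ?_).trans
    (le_geometric_of_stampacchia hb hD hQ hQD hstep j)
  gcongr
  exact mul_le_of_le_one_right hD.le (sub_le_self _ (by positivity))

end Stampacchia

section SmoothTruncation

/-- The primitive of `Real.smoothTransition` vanishing on `(-∞, 0]`: a smooth substitute for the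
positive part, used to truncate elements of `V` at a level. -/
def smoothRamp (s : ℝ) : ℝ := ∫ t in (0:ℝ)..s, Real.smoothTransition t

lemma hasDerivAt_smoothRamp (s : ℝ) : HasDerivAt smoothRamp (Real.smoothTransition s) s :=
  intervalIntegral.integral_hasDerivAt_right
    (Real.smoothTransition.continuous.intervalIntegrable _ _)
    (Real.smoothTransition.continuous.stronglyMeasurableAtFilter _ _)
    Real.smoothTransition.continuous.continuousAt

lemma deriv_smoothRamp : deriv smoothRamp = Real.smoothTransition :=
  funext fun s => (hasDerivAt_smoothRamp s).deriv

lemma contDiff_smoothRamp : ContDiff ℝ ∞ smoothRamp :=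
  contDiff_infty_iff_deriv.2 ⟨fun s => (hasDerivAt_smoothRamp s).differentiableAt,
    deriv_smoothRamp ▸ Real.smoothTransition.contDiff⟩

lemma monotone_smoothRamp : Monotone smoothRamp :=
  monotone_of_deriv_nonneg (fun s => (hasDerivAt_smoothRamp s).differentiableAt)
    fun s => deriv_smoothRamp ▸ Real.smoothTransition.nonneg s

lemma smoothRamp_of_nonpos {s : ℝ} (hs : s ≤ 0) : smoothRamp s = 0 := by
  rw [smoothRamp, intervalIntegral.integral_symm, neg_eq_zero]
  refine (intervalIntegral.integral_congr fun t ht => ?_).trans intervalIntegral.integral_zero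
  rw [uIcc_of_le hs] at ht
  exact Real.smoothTransition.zero_of_nonpos ht.2

lemma smoothRamp_nonneg (s : ℝ) : 0 ≤ smoothRamp s := by
  rcases le_total s 0 with h | h
  · exact (smoothRamp_of_nonpos h).ge
  · exact (smoothRamp_of_nonpos le_rfl).symm.trans_le (monotone_smoothRamp h)

lemma smoothRamp_le {s : ℝ} (hs : 0 ≤ s) : smoothRamp s ≤ s := by
  have hle := intervalIntegral.integral_mono_on (μ := volume) (g := fun _ => 1) hs
    (Real.smoothTransition.continuous.intervalIntegrable _ _) (by simp)
    (fun t _ => Real.smoothTransition.le_one t)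
  simpa [smoothRamp] using hle

lemma smoothRamp_one_pos : 0 < smoothRamp 1 :=
  intervalIntegral.intervalIntegral_pos_of_pos_on
    (Real.smoothTransition.continuous.intervalIntegrable _ _)
    (fun _ ht => Real.smoothTransition.pos_of_pos ht.1) one_pos

/-- A smooth function comparable to `(s - k)⁺`, up to the constant `smoothRamp 1` and away from
`k < s < l`. -/
def smoothTruncation (k l s : ℝ) : ℝ := (l - k) * smoothRamp ((s - k) / (l - k))

variable {k l s : ℝ}

lemma hasDerivAt_smoothTruncation (hkl : k < l) :
    HasDerivAt (smoothTruncation k l) (Real.smoothTransition ((s - k) / (l - k))) s := by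
  have hinner : HasDerivAt (fun s : ℝ => (s - k) / (l - k)) (1 / (l - k)) s :=
    ((hasDerivAt_id s).sub_const k).div_const _
  have hchain := ((hasDerivAt_smoothRamp ((s - k) / (l - k))).comp s hinner).const_mul (l - k)
  convert! hchain using 1
  field_simp [(sub_pos.2 hkl).ne']

lemma contDiff_smoothTruncation : ContDiff ℝ ∞ (smoothTruncation k l) :=
  contDiff_const.mul (contDiff_smoothRamp.comp (by fun_prop))

lemma deriv_smoothTruncation_mem_Icc (hkl : k < l) :
    deriv (smoothTruncation k l) s ∈ Icc (0:ℝ) 1 := by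
  rw [(hasDerivAt_smoothTruncation hkl).deriv]
  exact ⟨Real.smoothTransition.nonneg _, Real.smoothTransition.le_one _⟩

lemma smoothTruncation_of_le (hkl : k < l) (hs : s ≤ k) : smoothTruncation k l s = 0 := by
  rw [smoothTruncation, smoothRamp_of_nonpos
    (div_nonpos_of_nonpos_of_nonneg (sub_nonpos.2 hs) (sub_pos.2 hkl).le), mul_zero]

lemma smoothTruncation_nonneg (hkl : k < l) : 0 ≤ smoothTruncation k l s :=
  mul_nonneg (sub_pos.2 hkl).le (smoothRamp_nonneg _)

lemma smoothTruncation_le_sub (hkl : k < l) (hs : k ≤ s) : smoothTruncation k l s ≤ s - k := by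
  have hlk := sub_pos.2 hkl
  calc (l - k) * smoothRamp ((s - k) / (l - k)) ≤ (l - k) * ((s - k) / (l - k)) :=
        mul_le_mul_of_nonneg_left (smoothRamp_le (div_nonneg (sub_nonneg.2 hs) hlk.le)) hlk.le
    _ = s - k := mul_div_cancel₀ _ hlk.ne'

lemma le_smoothTruncation (hkl : k < l) (hs : l ≤ s) :
    smoothRamp 1 * (l - k) ≤ smoothTruncation k l s := by
  rw [smoothTruncation, mul_comm]
  refine mul_le_mul_of_nonneg_left (monotone_smoothRamp ?_) (sub_pos.2 hkl).le
  exact (one_le_div (sub_pos.2 hkl)).2 (sub_le_sub_right hs k)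

end SmoothTruncation

section Superlevel

variable {α : Type*} {m : MeasurableSpace α} {p : ℝ≥0∞} {μ : Measure α} {v : α → ℝ} {k c : ℝ}

/-- The `L^p` norm of the indicator function of `{v > k}`; in terms of it the Stampacchia
iteration needs no fractional powers of measures. -/
def superlevelNorm (p : ℝ≥0∞) (μ : Measure α) (v : α → ℝ) (k : ℝ) : ℝ :=
  lpNorm ({x | k < v x}.indicator fun _ => (1 : ℝ)) p μ

lemma memLp_indicator_superlevel [IsFiniteMeasure μ] (hv : AEStronglyMeasurable v μ) :
    MemLp ({x | k < v x}.indicator fun _ => (1 : ℝ)) p μ := by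
  have hm : NullMeasurableSet {x | k < v x} μ :=
    nullMeasurableSet_lt aemeasurable_const hv.aemeasurable
  refine .of_bound (aestronglyMeasurable_const.indicator₀ hm) 1 (.of_forall fun x => ?_)
  exact (norm_indicator_le_norm_self _ x).trans norm_one.le

lemma antitone_superlevelNorm [IsFiniteMeasure μ] (hv : AEStronglyMeasurable v μ) :
    Antitone (superlevelNorm p μ v) := fun _ _ hkl =>
  lpNorm_mono_ae (memLp_indicator_superlevel hv) <| .of_forall fun _ =>
    norm_indicator_le_of_subset (fun _ hx => hkl.trans_lt hx) _ _

lemma ae_le_of_superlevelNorm_eq_zero [IsFiniteMeasure μ] (hp : p ≠ 0)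
    (hv : AEStronglyMeasurable v μ) (h : superlevelNorm p μ v k = 0) : ∀ᵐ x ∂μ, v x ≤ k := by
  filter_upwards [(lpNorm_eq_zero (memLp_indicator_superlevel hv) hp).1 h] with x hx
  by_contra! hlt
  rw [indicator_of_mem (by exact hlt)] at hx
  exact one_ne_zero hx

lemma mul_superlevelNorm_le {F : Type*} [NormedAddCommGroup F] {f : α → F} (hf : MemLp f p μ)
    (hc : 0 ≤ c) (hcf : ∀ᵐ x ∂μ, k < v x → c ≤ ‖f x‖) :
    c * superlevelNorm p μ v k ≤ lpNorm f p μ := by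
  rw [superlevelNorm, ← abs_of_nonneg hc, ← lpNorm_const_mul]
  refine lpNorm_mono_ae hf (hcf.mono fun x hx => ?_)
  by_cases h : k < v x
  · simpa [indicator_of_mem (show x ∈ {x | k < v x} from h), abs_of_nonneg hc] using hx h
  · simp [indicator_of_notMem (show x ∉ {x | k < v x} from h)]

end Superlevel

namespace Setting
variable {d : ℕ} {S : Setting d}

lemma inner_H_eq (u v : S.H) : inner ℝ u v = ∫ x, u x * v x ∂S.mu := by
  rw [L2.inner_def]
  exact integral_congr_ae (.of_forall fun x => by simp [mul_comm])

lemma ofH_apply (u : S.H) (z : S.V) : S.ofH u z = ∫ x, u x * V.fn z x ∂S.mu :=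
  inner_H_eq u (S.inclH z)

lemma A0_apply (w z : S.V) : S.A0 w z = ∑ i, ∫ x, S.grad w i x * S.grad z i x ∂S.mu := by
  change inner ℝ (S.grad w) (S.grad z) = _
  simp only [PiLp.inner_apply, inner_H_eq]

lemma norm_sq_eq_integral (v : S.V) :
    ‖v‖ ^ 2 = ∫ x, V.fn v x ^ 2 ∂S.mu + ∑ i, ∫ x, S.grad v i x ^ 2 ∂S.mu := by
  simp only [norm_sq_eq, ← lpNorm_coeFn, sq_lpNorm_two (Lp.memLp _)]
  rfl

namespace DomA

lemma sum_integral_grad_add (v : S.DomA) (z : S.V) :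
    ∑ i, ∫ x, S.grad v.toV i x * S.grad z i x ∂S.mu + ∫ x, v.fn x * V.fn z x ∂S.mu =
      ∫ x, v.Aval x * V.fn z x ∂S.mu := by
  have heq : S.A0 v.toV z + S.ofH (S.inclH v.toV) z = S.ofH v.Aval z :=
    congrArg (fun l : S.V' => l z) v.eq
  rwa [A0_apply, ofH_apply, ofH_apply] at heq

/-- The negative of an element of `D(A)`; it reduces lower bounds to upper bounds. -/
def neg (v : S.DomA) : S.DomA where
  toV := -v.toV
  Aval := -v.Aval
  eq := by
    have hA : S.A (-v.toV) = -S.A v.toV := by simp [A, A0, ofH]; abel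
    have hH : S.ofH (-v.Aval) = -S.ofH v.Aval := by simp [ofH]
    rw [hA, hH, v.eq]

lemma fn_neg (v : S.DomA) : v.neg.fn =ᵐ[S.mu] fun x => -v.fn x := by
  change (S.inclH (-v.toV) : E d → ℝ) =ᵐ[S.mu] _
  rw [map_neg]
  exact Lp.coeFn_neg ..

lemma normV_neg (v : S.DomA) : v.neg.normV = v.normV := norm_neg _

lemma normDA_neg (v : S.DomA) : v.neg.normDA = v.normDA := norm_neg _

lemma normH_le_normV (v : S.DomA) : v.normH ≤ v.normV := norm_inclH_le _

lemma normH_nonneg (v : S.DomA) : 0 ≤ v.normH := norm_nonneg _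

lemma normV_nonneg (v : S.DomA) : 0 ≤ v.normV := norm_nonneg _

lemma normDA_nonneg (v : S.DomA) : 0 ≤ v.normDA := norm_nonneg _

lemma normV_sq_le (v : S.DomA) : v.normV ^ 2 ≤ v.normH * v.normDA := by
  calc v.normV ^ 2 = ∫ x, v.Aval x * v.fn x ∂S.mu := by
        rw [normV, norm_sq_eq_integral, add_comm]
        simp only [sq]
        exact v.sum_integral_grad_add v.toV
    _ ≤ lpNorm v.Aval 2 S.mu * lpNorm v.fn 2 S.mu :=
        (le_abs_self _).trans (abs_integral_mul_le (Lp.memLp v.Aval) (V.memLp_fn v.toV))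
    _ = v.normH * v.normDA := by
        rw [mul_comm, lpNorm_coeFn]
        exact congrArg (· * v.normDA) (lpNorm_coeFn (S.inclH v.toV))

lemma normV_le_normDA (v : S.DomA) : v.normV ≤ v.normDA := by
  rcases v.normV_nonneg.eq_or_lt with h | h
  · exact h ▸ v.normDA_nonneg
  · refine le_of_mul_le_mul_left ?_ h
    rw [← sq]
    exact v.normV_sq_le.trans (mul_le_mul_of_nonneg_right v.normH_le_normV v.normDA_nonneg)

lemma fn_ae_eq_zero {v : S.DomA} (h : v.normV = 0) : v.fn =ᵐ[S.mu] 0 := by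
  change (S.inclH v.toV : E d → ℝ) =ᵐ[S.mu] _
  rw [norm_eq_zero.1 h, map_zero]
  exact Lp.coeFn_zero ..

end DomA

/-- `C` is a constant of the embedding `V → L⁶`. -/
def SobolevBound (S : Setting d) (C : ℝ) : Prop :=
  0 ≤ C ∧ ∀ v : S.V, MemLp (V.fn v) 6 S.mu ∧ lpNorm (V.fn v) 6 S.mu ≤ C * ‖v‖

lemma exists_sobolevBound (hd1 : 1 ≤ d) (hd3 : d ≤ 3) (hS : S.Admissible) :
    ∃ C, S.SobolevBound C := by
  obtain ⟨C, hC⟩ := exists_eLpNorm_six_le hd1 hd3 hS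
  refine ⟨C, C.2, fun v => ?_⟩
  have hfin : (C : ℝ≥0∞) * ‖v‖ₑ ≠ ⊤ := ENNReal.mul_ne_top ENNReal.coe_ne_top enorm_ne_top
  refine ⟨⟨(V.memLp_fn v).1, (hC v).trans_lt hfin.lt_top⟩, ?_⟩
  rw [← toReal_eLpNorm (V.memLp_fn v).1]
  simpa using ENNReal.toReal_mono hfin (hC v)

namespace SobolevBound
variable {C : ℝ} (hC : S.SobolevBound C)
include hC

lemma memLp_mul_mul (a b c : S.V) :
    MemLp (fun x => V.fn a x * V.fn b x * V.fn c x) 2 S.mu :=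
  memLp_mul_mul_of_six (hC.2 a).1 (hC.2 b).1 (hC.2 c).1

lemma lpNorm_mul_mul_le (a b c : S.V) :
    lpNorm (fun x => V.fn a x * V.fn b x * V.fn c x) 2 S.mu ≤ C ^ 3 * (‖a‖ * ‖b‖ * ‖c‖) := by
  have hC0 := hC.1
  calc _ ≤ lpNorm (V.fn a) 6 S.mu * lpNorm (V.fn b) 6 S.mu * lpNorm (V.fn c) 6 S.mu :=
        lpNorm_mul_mul_le_six (hC.2 a).1 (hC.2 b).1 (hC.2 c).1
    _ ≤ C * ‖a‖ * (C * ‖b‖) * (C * ‖c‖) :=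
        mul_le_mul (mul_le_mul (hC.2 a).2 (hC.2 b).2 lpNorm_nonneg (by positivity))
          (hC.2 c).2 lpNorm_nonneg (by positivity)
    _ = _ := by ring

lemma abs_integral_mul_mul_mul_le {w : E d → ℝ} (hw : MemLp w 2 S.mu) (a b c : S.V) :
    |∫ x, w x * (V.fn a x * V.fn b x * V.fn c x) ∂S.mu| ≤
      lpNorm w 2 S.mu * (C ^ 3 * (‖a‖ * ‖b‖ * ‖c‖)) :=
  (abs_integral_mul_le hw (hC.memLp_mul_mul a b c)).trans
    (mul_le_mul_of_nonneg_left (hC.lpNorm_mul_mul_le a b c) lpNorm_nonneg)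

lemma lpNorm_two_le_of_superlevel [IsFiniteMeasure S.mu] {v : E d → ℝ}
    (hv : AEStronglyMeasurable v S.mu) {k : ℝ} {w : S.V}
    (hw : ∀ᵐ x ∂S.mu, v x ≤ k → V.fn w x = 0) :
    lpNorm (V.fn w) 2 S.mu ≤ C * ‖w‖ * superlevelNorm 6 S.mu v k ^ 2 := by
  set χ : E d → ℝ := {x | k < v x}.indicator fun _ => 1
  have hχ : MemLp χ 6 S.mu := memLp_indicator_superlevel hv
  have hwχ : V.fn w =ᵐ[S.mu] fun x => V.fn w x * χ x * χ x := by
    filter_upwards [hw] with x hx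
    by_cases h : k < v x
    · simp only [χ, indicator_of_mem (show x ∈ {x | k < v x} from h), mul_one]
    · rw [hx (not_lt.1 h), zero_mul, zero_mul]
  calc lpNorm (V.fn w) 2 S.mu = lpNorm (fun x => V.fn w x * χ x * χ x) 2 S.mu := lpNorm_congr_ae hwχ
    _ ≤ lpNorm (V.fn w) 6 S.mu * lpNorm χ 6 S.mu * lpNorm χ 6 S.mu :=
        lpNorm_mul_mul_le_six (hC.2 w).1 hχ hχ
    _ ≤ C * ‖w‖ * superlevelNorm 6 S.mu v k * superlevelNorm 6 S.mu v k :=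
        mul_le_mul_of_nonneg_right
          (mul_le_mul_of_nonneg_right (hC.2 w).2 lpNorm_nonneg) lpNorm_nonneg
    _ = _ := by ring

end SobolevBound

namespace DomA
variable {C k l : ℝ}

lemma exists_smoothTruncation (hS : S.Admissible) (v : S.DomA) (hk : 0 ≤ k) (hkl : k < l) :
    ∃ w : S.V, V.fn w =ᵐ[S.mu] (fun x => smoothTruncation k l (v.fn x)) ∧
      ‖w‖ ^ 2 ≤ ∫ x, v.Aval x * V.fn w x ∂S.mu := by
  obtain ⟨w, hw, hgrad⟩ := exists_V_comp hS v.toV contDiff_smoothTruncation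
    (smoothTruncation_of_le hkl hk) (K := 1) fun s => by
      have hs := deriv_smoothTruncation_mem_Icc (s := s) hkl
      rw [← NNReal.coe_le_coe, coe_nnnorm, Real.norm_of_nonneg hs.1]
      exact hs.2
  refine ⟨w, hw, ?_⟩
  rw [norm_sq_eq_integral, ← v.sum_integral_grad_add w, add_comm]
  refine add_le_add (Finset.sum_le_sum fun i _ => ?_) ?_
  · refine integral_mono_ae (memLp_grad w i).integrable_sq
      ((memLp_grad v.toV i).integrable_mul (memLp_grad w i)) ?_
    filter_upwards [hgrad i] with x hx
    have hψ := deriv_smoothTruncation_mem_Icc (s := V.fn v.toV x) hkl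
    simp only [hx]
    nlinarith [mul_nonneg (mul_nonneg hψ.1 (sub_nonneg.2 hψ.2)) (sq_nonneg (S.grad v.toV i x))]
  · refine integral_mono_ae (V.memLp_fn w).integrable_sq
      ((V.memLp_fn v.toV).integrable_mul (V.memLp_fn w)) ?_
    filter_upwards [hw] with x hx
    simp only [hx]
    change smoothTruncation k l (v.fn x) ^ 2 ≤ v.fn x * smoothTruncation k l (v.fn x)
    rcases le_total (v.fn x) k with h | h
    · simp [smoothTruncation_of_le hkl h]
    · rw [sq]
      exact mul_le_mul_of_nonneg_right ((smoothTruncation_le_sub hkl h).trans (sub_le_self _ hk))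
        (smoothTruncation_nonneg hkl)

lemma norm_le_of_superlevel (hC : S.SobolevBound C) [IsFiniteMeasure S.mu] (v : S.DomA) {w : S.V}
    (hwk : ∀ᵐ x ∂S.mu, v.fn x ≤ k → V.fn w x = 0)
    (henergy : ‖w‖ ^ 2 ≤ ∫ x, v.Aval x * V.fn w x ∂S.mu) :
    ‖w‖ ≤ v.normDA * C * superlevelNorm 6 S.mu v.fn k ^ 2 := by
  rcases (norm_nonneg w).eq_or_lt with h | h
  · rw [← h]
    exact mul_nonneg (mul_nonneg v.normDA_nonneg hC.1) (sq_nonneg _)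
  refine le_of_mul_le_mul_left ?_ h
  calc ‖w‖ * ‖w‖ = ‖w‖ ^ 2 := (sq _).symm
    _ ≤ lpNorm v.Aval 2 S.mu * lpNorm (V.fn w) 2 S.mu := henergy.trans
        ((le_abs_self _).trans (abs_integral_mul_le (Lp.memLp v.Aval) (V.memLp_fn w)))
    _ ≤ v.normDA * (C * ‖w‖ * superlevelNorm 6 S.mu v.fn k ^ 2) := by
        rw [lpNorm_coeFn]
        exact mul_le_mul_of_nonneg_left
          (hC.lpNorm_two_le_of_superlevel (V.memLp_fn v.toV).1 hwk) v.normDA_nonneg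
    _ = _ := by ring

lemma sub_mul_superlevelNorm_le (hS : S.Admissible) (hC : S.SobolevBound C) (v : S.DomA)
    (hk : 0 ≤ k) (hkl : k < l) :
    smoothRamp 1 * ((l - k) * superlevelNorm 6 S.mu v.fn l) ≤
      C ^ 2 * v.normDA * superlevelNorm 6 S.mu v.fn k ^ 2 := by
  have := hS.isFiniteMeasure
  obtain ⟨w, hw, henergy⟩ := v.exists_smoothTruncation hS hk hkl
  have hwk : ∀ᵐ x ∂S.mu, v.fn x ≤ k → V.fn w x = 0 :=
    hw.mono fun x hx h => hx.trans (smoothTruncation_of_le hkl h)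
  have hwl : ∀ᵐ x ∂S.mu, l < v.fn x → smoothRamp 1 * (l - k) ≤ ‖V.fn w x‖ :=
    hw.mono fun x hx h => ((le_smoothTruncation hkl h.le).trans hx.ge).trans (Real.le_norm_self _)
  calc smoothRamp 1 * ((l - k) * superlevelNorm 6 S.mu v.fn l)
      ≤ lpNorm (V.fn w) 6 S.mu := by
        rw [← mul_assoc]
        exact mul_superlevelNorm_le (hC.2 w).1
          (mul_nonneg smoothRamp_one_pos.le (sub_nonneg.2 hkl.le)) hwl
    _ ≤ C * ‖w‖ := (hC.2 w).2
    _ ≤ C * (v.normDA * C * superlevelNorm 6 S.mu v.fn k ^ 2) :=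
        mul_le_mul_of_nonneg_left (v.norm_le_of_superlevel hC hwk henergy) hC.1
    _ = _ := by ring

-- The iteration starts at the level `k₀ = √(‖v‖_V ‖v‖_{D(A)})`, where Chebyshev's inequality
-- already gives `k₀ * superlevelNorm 6 S.mu v.fn k₀ ≤ C ‖v‖_V`.
lemma exists_fn_le (hS : S.Admissible) (hC : S.SobolevBound C) :
    ∃ K : ℝ, 0 ≤ K ∧ ∀ v : S.DomA, ∀ᵐ x ∂S.mu, v.fn x ≤ K * √(v.normV * v.normDA) := by
  have := hS.isFiniteMeasure
  have hC0 := hC.1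
  obtain ⟨c, hc, hstep⟩ : ∃ c > 0, ∀ (v : S.DomA) (k l : ℝ), 0 ≤ k → k < l →
      c * ((l - k) * superlevelNorm 6 S.mu v.fn l) ≤
        C ^ 2 * v.normDA * superlevelNorm 6 S.mu v.fn k ^ 2 :=
    ⟨smoothRamp 1, smoothRamp_one_pos, fun v _ _ => v.sub_mul_superlevelNorm_le hS hC⟩
  refine ⟨2 + 4 * C ^ 3 / c, by positivity, fun v => ?_⟩
  rcases v.normV_nonneg.eq_or_lt with hV | hV
  · filter_upwards [fn_ae_eq_zero hV.symm] with x hx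
    simp [hx, ← hV]
  have hN : 0 < v.normDA := hV.trans_le v.normV_le_normDA
  set k₀ := √(v.normV * v.normDA)
  have hk₀ : 0 < k₀ := Real.sqrt_pos.2 (mul_pos hV hN)
  have hk₀sq : k₀ * k₀ = v.normV * v.normDA := Real.mul_self_sqrt (mul_pos hV hN).le
  have hstart : k₀ * superlevelNorm 6 S.mu v.fn k₀ ≤ C * v.normV :=
    (mul_superlevelNorm_le (hC.2 v.toV).1 hk₀.le
      (.of_forall fun x hx => hx.le.trans (Real.le_norm_self _))).trans (hC.2 v.toV).2
  have hsmall : 4 * (C ^ 2 * v.normDA / c) * superlevelNorm 6 S.mu v.fn k₀ ≤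
      (1 + 4 * C ^ 3 / c) * k₀ := by
    refine le_of_mul_le_mul_left ?_ hk₀
    calc k₀ * (4 * (C ^ 2 * v.normDA / c) * superlevelNorm 6 S.mu v.fn k₀)
        = 4 * (C ^ 2 * v.normDA / c) * (k₀ * superlevelNorm 6 S.mu v.fn k₀) := by ring
      _ ≤ 4 * (C ^ 2 * v.normDA / c) * (C * v.normV) := by gcongr
      _ = 4 * C ^ 3 / c * (k₀ * k₀) := by rw [hk₀sq]; ring
      _ ≤ (1 + 4 * C ^ 3 / c) * (k₀ * k₀) := by gcongr; linarith
      _ = k₀ * ((1 + 4 * C ^ 3 / c) * k₀) := by ring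
  have hzero := eq_zero_of_stampacchia (b := superlevelNorm 6 S.mu v.fn)
    (fun k => lpNorm_nonneg) (antitone_superlevelNorm (V.memLp_fn v.toV).1) (by positivity)
    (by positivity) hsmall fun k l hk hkl => by
      rw [div_mul_eq_mul_div, le_div_iff₀' hc]
      exact hstep v k l (hk₀.le.trans hk) hkl
  refine (ae_le_of_superlevelNorm_eq_zero (by simp) (V.memLp_fn v.toV).1 hzero).mono
    fun x hx => hx.trans_eq ?_
  ring

lemma exists_abs_fn_le (hS : S.Admissible) (hC : S.SobolevBound C) :
    ∃ K : ℝ, 0 ≤ K ∧ ∀ v : S.DomA, ∀ᵐ x ∂S.mu, |v.fn x| ≤ K * √(v.normV * v.normDA) := by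
  obtain ⟨K, hK, hle⟩ := exists_fn_le hS hC
  refine ⟨K, hK, fun v => ?_⟩
  filter_upwards [hle v, hle v.neg, v.fn_neg] with x hupper hlower hneg
  rw [hneg, normV_neg, normDA_neg] at hlower
  exact abs_le.2 ⟨neg_le.1 hlower, hupper⟩

end DomA

end Setting

/-! ### Weighted energy estimates -/

namespace Setting
variable {d : ℕ} {S : Setting d}

section GradientNorms

lemma norm_sq_eq_sum_integral (G : PiLp 2 fun _ : Fin d => S.H) :
    ‖G‖ ^ 2 = ∑ i, ∫ x, G i x ^ 2 ∂S.mu := by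
  simp only [PiLp.norm_sq_eq_of_L2, ← lpNorm_coeFn, sq_lpNorm_two (Lp.memLp _)]

lemma norm_le_add_of_ae_le {G P Q : PiLp 2 fun _ : Fin d => S.H} {a b : ℝ} (ha : 0 ≤ a)
    (hb : 0 ≤ b) (h : ∀ i, ∀ᵐ x ∂S.mu, |G i x| ≤ a * |P i x| + b * |Q i x|) :
    ‖G‖ ≤ a * ‖P‖ + b * ‖Q‖ := by
  let lengths (G : PiLp 2 fun _ : Fin d => S.H) : EuclideanSpace ℝ (Fin d) :=
    WithLp.toLp 2 fun i => ‖G i‖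
  have norm_lengths (G) : ‖lengths G‖ = ‖G‖ := by
    simp [lengths, EuclideanSpace.norm_eq, PiLp.norm_eq_of_L2]
  have hcomp (i) : ‖G i‖ ≤ a * ‖P i‖ + b * ‖Q i‖ := by
    calc ‖G i‖ ≤ ‖a • |P i| + b • |Q i|‖ := Lp.norm_le_norm_of_ae_le <| by
          filter_upwards [h i, Lp.coeFn_add (a • |P i|) (b • |Q i|), Lp.coeFn_smul a |P i|,
            Lp.coeFn_smul b |Q i|, Lp.coeFn_abs (P i), Lp.coeFn_abs (Q i)]
            with x hx hadd hsmulP hsmulQ habsP habsQ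
          rw [hadd, Pi.add_apply, hsmulP, hsmulQ, Pi.smul_apply, Pi.smul_apply, habsP, habsQ]
          exact hx.trans (le_abs_self _)
      _ ≤ ‖a • |P i|‖ + ‖b • |Q i|‖ := norm_add_le _ _
      _ = _ := by simp only [norm_smul, norm_abs_eq_norm, Real.norm_of_nonneg ha,
          Real.norm_of_nonneg hb]
  calc ‖G‖ = ‖lengths G‖ := (norm_lengths G).symm
    _ ≤ ‖a • lengths P + b • lengths Q‖ := by
        rw [EuclideanSpace.norm_eq, EuclideanSpace.norm_eq]
        refine Real.sqrt_le_sqrt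
          (Finset.sum_le_sum fun i _ => pow_le_pow_left₀ (norm_nonneg _) ?_ 2)
        simpa [lengths] using (hcomp i).trans (le_abs_self _)
    _ ≤ ‖a • lengths P‖ + ‖b • lengths Q‖ := norm_add_le _ _
    _ = _ := by
        rw [norm_smul, norm_smul, norm_lengths, norm_lengths, Real.norm_of_nonneg ha,
          Real.norm_of_nonneg hb]

lemma norm_grad_le (z : S.V) : ‖S.grad z‖ ≤ ‖z‖ := by
  refine le_of_sq_le_sq ?_ (norm_nonneg _)
  rw [norm_sq_eq, PiLp.norm_sq_eq_of_L2]
  exact le_add_of_nonneg_left (sq_nonneg _)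

lemma norm_A0_le (u : S.V) : ‖S.A0 u‖ ≤ ‖S.grad u‖ :=
  ContinuousLinearMap.opNorm_le_bound _ (norm_nonneg _) fun z =>
    (norm_inner_le_norm (S.grad u) (S.grad z)).trans
      (mul_le_mul_of_nonneg_left (norm_grad_le z) (norm_nonneg _))

end GradientNorms

section WeightedEnergy

lemma exists_mul_grad (e w : S.V) {R : ℝ} (he : ∀ᵐ x ∂S.mu, |V.fn e x| ≤ R) :
    ∃ G : PiLp 2 fun _ : Fin d => S.H,
      ∀ i, G i =ᵐ[S.mu] fun x => V.fn e x * S.grad w i x := by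
  have he' : MemLp (V.fn e) ∞ S.mu := memLp_top_of_bound (V.memLp_fn e).1 R he
  have hmem (i) : MemLp (fun x => V.fn e x * S.grad w i x) 2 S.mu := (memLp_grad w i).mul' he'
  exact ⟨WithLp.toLp 2 fun i => (hmem i).toLp _, fun i => (hmem i).coeFn_toLp⟩

lemma exists_V_sq_mul_of_bounded (hS : S.Admissible) (e w : S.V) {R M : ℝ}
    (he : ∀ᵐ x ∂S.mu, |V.fn e x| ≤ R) (hw : ∀ᵐ x ∂S.mu, |V.fn w x| ≤ M) :
    ∃ z : S.V, V.fn z =ᵐ[S.mu] (fun x => V.fn e x * V.fn e x * V.fn w x) ∧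
      ∀ i, S.grad z i =ᵐ[S.mu] fun x => V.fn e x ^ 2 * S.grad w i x +
        2 * (V.fn w x * (V.fn e x * S.grad e i x)) := by
  obtain ⟨q, hq, hgradq⟩ := exists_V_mul_of_bounded hS e e he he
  have hqR : ∀ᵐ x ∂S.mu, |V.fn q x| ≤ R * R := by
    filter_upwards [hq, he] with x hqx hex
    rw [hqx, abs_mul]
    exact mul_le_mul hex hex (abs_nonneg _) ((abs_nonneg _).trans hex)
  obtain ⟨z, hz, hgradz⟩ := exists_V_mul_of_bounded hS q w hqR hw
  refine ⟨z, ?_, fun i => ?_⟩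
  · filter_upwards [hz, hq] with x hzx hqx
    rw [hzx, hqx]
  · filter_upwards [hgradz i, hgradq i, hq] with x hzx hgqx hqx
    rw [hzx, hgqx, hqx]
    ring

-- Young's inequality absorbs the cross term `2 (e ∇w) (w ∇e)` of `∇w ⬝ ∇(e² w)`.
lemma half_norm_sq_sub_le {e w z : S.V} {G : PiLp 2 fun _ : Fin d => S.H} {M : ℝ}
    (hw : ∀ᵐ x ∂S.mu, |V.fn w x| ≤ M)
    (hG : ∀ i, G i =ᵐ[S.mu] fun x => V.fn e x * S.grad w i x)
    (hz : ∀ i, S.grad z i =ᵐ[S.mu] fun x => V.fn e x ^ 2 * S.grad w i x +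
      2 * (V.fn w x * (V.fn e x * S.grad e i x))) :
    1 / 2 * ‖G‖ ^ 2 - 2 * M ^ 2 * ‖S.grad e‖ ^ 2 ≤
      ∑ i, ∫ x, S.grad w i x * S.grad z i x ∂S.mu := by
  simp only [norm_sq_eq_sum_integral, Finset.mul_sum, ← Finset.sum_sub_distrib]
  refine Finset.sum_le_sum fun i _ => ?_
  have hGi : Integrable (fun x => 1 / 2 * G i x ^ 2) S.mu :=
    (Lp.memLp (G i)).integrable_sq.const_mul _
  have hei : Integrable (fun x => 2 * M ^ 2 * S.grad e i x ^ 2) S.mu :=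
    (memLp_grad e i).integrable_sq.const_mul _
  rw [← integral_const_mul, ← integral_const_mul, ← integral_sub hGi hei]
  refine integral_mono_ae (hGi.sub hei) ((memLp_grad w i).integrable_mul (memLp_grad z i)) ?_
  filter_upwards [hz i, hG i, hw] with x hzx hGx hwx
  have hwM : (V.fn w x * S.grad e i x) ^ 2 ≤ M ^ 2 * S.grad e i x ^ 2 := by
    rw [mul_pow]
    exact mul_le_mul_of_nonneg_right (sq_le_sq' (abs_le.1 hwx).1 (abs_le.1 hwx).2) (sq_nonneg _)
  simp only [hzx, hGx]
  nlinarith [sq_nonneg (V.fn e x * S.grad w i x + 2 * (V.fn w x * S.grad e i x))]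

-- Test the equation of `w` with `e² w`.
lemma exists_norm_sq_mul_grad_le (hS : S.Admissible) {C : ℝ} (hC : S.SobolevBound C) :
    ∃ K : ℝ, 0 ≤ K ∧ ∀ (w : S.DomA) (e : S.V) (G : PiLp 2 fun _ : Fin d => S.H) (R : ℝ),
      (∀ᵐ x ∂S.mu, |V.fn e x| ≤ R) →
      (∀ i, G i =ᵐ[S.mu] fun x => V.fn e x * S.grad w.toV i x) →
      ‖G‖ ^ 2 ≤ K * (w.normV * w.normDA) * ‖e‖ ^ 2 := by
  obtain ⟨K, -, hagmon⟩ := DomA.exists_abs_fn_le hS hC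
  have hC0 := hC.1
  refine ⟨2 * C ^ 3 + 4 * K ^ 2, by positivity, fun w e G R he hG => ?_⟩
  have hVD : 0 ≤ w.normV * w.normDA := mul_nonneg w.normV_nonneg w.normDA_nonneg
  obtain ⟨z, hz, hgradz⟩ := exists_V_sq_mul_of_bounded hS e w.toV he (hagmon w)
  have hlower := half_norm_sq_sub_le (hagmon w) hG hgradz
  rw [mul_pow, Real.sq_sqrt hVD] at hlower
  have hupper : ∫ x, w.Aval x * V.fn z x ∂S.mu ≤ C ^ 3 * (w.normV * w.normDA) * ‖e‖ ^ 2 := by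
    calc ∫ x, w.Aval x * V.fn z x ∂S.mu
        = ∫ x, w.Aval x * (V.fn e x * V.fn e x * V.fn w.toV x) ∂S.mu :=
          integral_congr_ae (hz.mono fun x hx => congrArg (w.Aval x * ·) hx)
      _ ≤ lpNorm w.Aval 2 S.mu * (C ^ 3 * (‖e‖ * ‖e‖ * w.normV)) :=
          (le_abs_self _).trans
            (hC.abs_integral_mul_mul_mul_le (Lp.memLp w.Aval) e e w.toV)
      _ = w.normDA * (C ^ 3 * (‖e‖ * ‖e‖ * w.normV)) := by rw [lpNorm_coeFn, DomA.normDA]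
      _ = _ := by ring
  have hnonneg : 0 ≤ ∫ x, w.fn x * V.fn z x ∂S.mu := integral_nonneg_of_ae <| by
    filter_upwards [hz] with x hx
    rw [hx, ← sq, mul_left_comm]
    exact mul_nonneg (sq_nonneg _) (mul_self_nonneg _)
  have hgrade : 2 * (K ^ 2 * (w.normV * w.normDA)) * ‖S.grad e‖ ^ 2 ≤
      2 * (K ^ 2 * (w.normV * w.normDA)) * ‖e‖ ^ 2 := by
    gcongr
    exact norm_grad_le e
  linarith [w.sum_integral_grad_add z]

end WeightedEnergy

section PairA0

lemma DomA.memLp_fn (v : S.DomA) : MemLp v.fn 2 S.mu := V.memLp_fn v.toV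

lemma DomA.lpNorm_fn (v : S.DomA) : lpNorm v.fn 2 S.mu = v.normH := lpNorm_coeFn (S.inclH v.toV)

lemma memLp_Aval_sub (v : S.DomA) : MemLp (fun x => v.Aval x - v.fn x) 2 S.mu :=
  (Lp.memLp v.Aval).sub v.memLp_fn

lemma lpNorm_Aval_sub_le (v : S.DomA) :
    lpNorm (fun x => v.Aval x - v.fn x) 2 S.mu ≤ 2 * v.normDA := by
  calc lpNorm (fun x => v.Aval x - v.fn x) 2 S.mu
      ≤ lpNorm v.Aval 2 S.mu + lpNorm v.fn 2 S.mu :=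
        lpNorm_sub_le (Lp.memLp v.Aval) one_le_two
    _ = v.normDA + v.normH := by rw [lpNorm_coeFn, v.lpNorm_fn, DomA.normDA]
    _ ≤ _ := by linarith [v.normH_le_normV, v.normV_le_normDA]

lemma abs_pairA0_le {w : E d → ℝ} (hw : MemLp w 2 S.mu) (v : S.DomA) :
    |S.pairA0 w v| ≤ lpNorm w 2 S.mu * (2 * v.normDA) :=
  (abs_integral_mul_le hw (memLp_Aval_sub v)).trans
    (mul_le_mul_of_nonneg_left (lpNorm_Aval_sub_le v) lpNorm_nonneg)

lemma pairA0_add {w₁ w₂ : E d → ℝ} (h₁ : MemLp w₁ 2 S.mu) (h₂ : MemLp w₂ 2 S.mu) (v : S.DomA) :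
    S.pairA0 (fun x => w₁ x + w₂ x) v = S.pairA0 w₁ v + S.pairA0 w₂ v := by
  simp only [pairA0, add_mul]
  exact integral_add (h₁.integrable_mul (memLp_Aval_sub v)) (h₂.integrable_mul (memLp_Aval_sub v))

lemma pairA0_const_mul (c : ℝ) (w : E d → ℝ) (v : S.DomA) :
    S.pairA0 (fun x => c * w x) v = c * S.pairA0 w v := by
  simp only [pairA0, mul_assoc, integral_const_mul]

lemma pairA0_eq_sum_integral_grad (v : S.DomA) (z : S.V) :
    S.pairA0 (V.fn z) v = ∑ i, ∫ x, S.grad v.toV i x * S.grad z i x ∂S.mu := by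
  have hA : Integrable (fun x => v.Aval x * V.fn z x) S.mu :=
    (Lp.memLp v.Aval).integrable_mul (V.memLp_fn z)
  have hv : Integrable (fun x => v.fn x * V.fn z x) S.mu :=
    v.memLp_fn.integrable_mul (V.memLp_fn z)
  rw [← sub_eq_of_eq_add (v.sum_integral_grad_add z).symm, pairA0, ← integral_sub hA hv]
  simp only [mul_comm (V.fn z _), sub_mul]

lemma pairA0_congr_ae {w₁ w₂ : E d → ℝ} (h : w₁ =ᵐ[S.mu] w₂) (v : S.DomA) :
    S.pairA0 w₁ v = S.pairA0 w₂ v :=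
  integral_congr_ae (h.mono fun _ hx => congrArg (· * _) hx)

-- By parts, the pairing is `∫ ψ'(v) |∇v|²`.
lemma pairA0_comp_nonneg (hS : S.Admissible) (v : S.DomA) {R : ℝ}
    (hv : ∀ᵐ x ∂S.mu, |v.fn x| ≤ R) {ψ : ℝ → ℝ} (hψ : ContDiff ℝ ∞ ψ) (h0 : ψ 0 = 0)
    (hmono : Monotone ψ) : 0 ≤ S.pairA0 (fun x => ψ (v.fn x)) v := by
  obtain ⟨z, hz, hgrad⟩ := exists_V_comp_of_bounded hS v.toV hv hψ h0
  have hpair : S.pairA0 (fun x => ψ (v.fn x)) v = S.pairA0 (V.fn z) v :=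
    pairA0_congr_ae hz.symm v
  rw [hpair, pairA0_eq_sum_integral_grad]
  refine Finset.sum_nonneg fun i _ => integral_nonneg_of_ae ?_
  filter_upwards [hgrad i] with x hx
  rw [hx, mul_left_comm]
  exact mul_nonneg hmono.deriv_nonneg (mul_self_nonneg _)

end PairA0

section Represents

lemma represents_of_memLp {w : E d → ℝ} (hw : MemLp w 2 S.mu) :
    S.Represents w (S.ofH (hw.toLp w)) := fun z => by
  refine ⟨hw.integrable_mul (V.memLp_fn z), ?_⟩
  rw [ofH_apply]
  exact integral_congr_ae (hw.coeFn_toLp.mono fun x hx => congrArg (· * _) hx.symm)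

lemma norm_le_of_represents {w : E d → ℝ} {l : S.V'} (hl : S.Represents w l) {M : ℝ} (hM : 0 ≤ M)
    (h : ∀ z : S.V, |∫ x, w x * V.fn z x ∂S.mu| ≤ M * ‖z‖) : ‖l‖ ≤ M :=
  l.opNorm_le_bound hM fun z => (hl z).2 ▸ h z

end Represents

end Setting

/-! ### The double-well nonlinearity -/

section DoubleWellPotential

lemma hasDerivAt_doubleWell (τ s : ℝ) : HasDerivAt (doubleWell τ) (doubleWellNL τ s) s := by
  convert! ((((hasDerivAt_id s).pow 2).sub_const 1).pow 2).const_mul τ using 1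
  simp only [doubleWellNL, id_eq, Pi.pow_apply]
  ring

lemma doubleWell_nonneg {τ : ℝ} (hτ : 0 ≤ τ) (s : ℝ) : 0 ≤ doubleWell τ s :=
  mul_nonneg hτ (sq_nonneg _)

lemma continuous_doubleWell (τ : ℝ) : Continuous (doubleWell τ) :=
  continuous_iff_continuousAt.2 fun s => (hasDerivAt_doubleWell τ s).continuousAt

lemma doubleWellNL_zero (τ : ℝ) : doubleWellNL τ 0 = 0 := by simp [doubleWellNL]

lemma contDiff_doubleWellNL (τ : ℝ) : ContDiff ℝ ∞ (doubleWellNL τ) :=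
  contDiff_const.mul ((contDiff_id.pow 3).sub contDiff_id)

lemma deriv_doubleWellNL (τ s : ℝ) : deriv (doubleWellNL τ) s = 4 * τ * (3 * s ^ 2 - 1) := by
  have h : HasDerivAt (doubleWellNL τ) (4 * τ * (3 * s ^ 2 - 1)) s := by
    convert! (((hasDerivAt_id s).pow 3).sub (hasDerivAt_id s)).const_mul (4 * τ) using 1
    simp
  exact h.deriv

lemma abs_deriv_doubleWellNL_le (τ : ℝ) {R s : ℝ} (hs : |s| ≤ R) :
    |deriv (doubleWellNL τ) s| ≤ 4 * |τ| * (3 * R ^ 2 + 1) := by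
  have hsq : s ^ 2 ≤ R ^ 2 := sq_le_sq' (abs_le.1 hs).1 (abs_le.1 hs).2
  rw [deriv_doubleWellNL, abs_mul, abs_mul, abs_of_pos (four_pos : (0 : ℝ) < 4)]
  gcongr
  exact abs_le.2 ⟨by linarith [sq_nonneg s, sq_nonneg R], by linarith⟩

lemma abs_deriv_doubleWellNL_sub_le (τ : ℝ) {R s t : ℝ} (hs : |s| ≤ R) (ht : |t| ≤ R) :
    |deriv (doubleWellNL τ) s - deriv (doubleWellNL τ) t| ≤ 24 * |τ| * R * |s - t| := by
  have hadd : |s + t| ≤ 2 * R := (abs_add_le s t).trans (by linarith)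
  calc |deriv (doubleWellNL τ) s - deriv (doubleWellNL τ) t|
      = |12 * τ * (s + t) * (s - t)| := by simp only [deriv_doubleWellNL]; ring_nf
    _ = 12 * |τ| * |s + t| * |s - t| := by simp only [abs_mul, Nat.abs_ofNat]
    _ ≤ 12 * |τ| * (2 * R) * |s - t| := by gcongr
    _ = _ := by ring

end DoubleWellPotential

lemma memLp_comp_of_ae_bounded {α : Type*} [MeasurableSpace α] {μ : Measure α}
    [IsFiniteMeasure μ] {w : α → ℝ} (hw : AEStronglyMeasurable w μ) {R : ℝ}
    (hR : ∀ᵐ x ∂μ, |w x| ≤ R) {ψ : ℝ → ℝ} (hψ : Continuous ψ) (p : ℝ≥0∞) :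
    MemLp (fun x => ψ (w x)) p μ := by
  obtain ⟨M, hM⟩ :=
    (isCompact_Icc (a := -R) (b := R)).exists_bound_of_continuousOn hψ.continuousOn
  exact MemLp.of_bound (hψ.comp_aestronglyMeasurable hw) M
    (hR.mono fun x hx => hM _ (abs_le.1 hx))

lemma sq_le_of_le_mul_one_add_mul {N B V h : ℝ} (hN : 0 ≤ N) (h_le : N ≤ B * (V * (1 + h * V))) :
    N ^ 2 ≤ 2 * B ^ 2 * V ^ 2 * (1 + h ^ 2 * V ^ 2) := by
  have hsq : N ^ 2 ≤ (B * (V * (1 + h * V))) ^ 2 := pow_le_pow_left₀ hN h_le 2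
  linarith [mul_nonneg (sq_nonneg (B * V)) (sq_nonneg (1 - h * V))]

namespace Setting
variable {d : ℕ} {S : Setting d}

section DoubleWellGrowth

lemma lpNorm_fn_le (z : S.V) : lpNorm (V.fn z) 2 S.mu ≤ ‖z‖ :=
  (lpNorm_coeFn (S.inclH z)).trans_le (norm_inclH_le z)

lemma DomA.memLp_comp (hS : S.Admissible) {C : ℝ} (hC : S.SobolevBound C) (v : S.DomA)
    {ψ : ℝ → ℝ} (hψ : Continuous ψ) (p : ℝ≥0∞) : MemLp (fun x => ψ (v.fn x)) p S.mu := by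
  have := hS.isFiniteMeasure
  obtain ⟨K, -, hagmon⟩ := DomA.exists_abs_fn_le hS hC
  exact memLp_comp_of_ae_bounded v.memLp_fn.1 (hagmon v) hψ p

lemma pairA0_cube_nonneg (hS : S.Admissible) {C : ℝ} (hC : S.SobolevBound C) (v : S.DomA) :
    0 ≤ S.pairA0 (fun x => v.fn x ^ 3) v := by
  obtain ⟨K, -, hagmon⟩ := DomA.exists_abs_fn_le hS hC
  exact pairA0_comp_nonneg hS v (hagmon v) (contDiff_id.pow 3) (zero_pow three_ne_zero)
    (Odd.strictMono_pow (by decide)).monotone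

lemma abs_integral_doubleWellNL_le {C : ℝ} (hC : S.SobolevBound C) {τ : ℝ} (hτ : 0 ≤ τ)
    (v : S.DomA) (z : S.V) : |∫ x, doubleWellNL τ (v.fn x) * V.fn z x ∂S.mu| ≤
      4 * τ * (C ^ 3 + 1) * (v.normV * (1 + v.normH * v.normV)) * ‖z‖ := by
  have hC0 := hC.1
  have hH := v.normH_nonneg
  have hV := v.normV_nonneg
  have hcubic : |∫ x, v.fn x * (v.fn x * v.fn x * V.fn z x) ∂S.mu| ≤
      v.normH * (C ^ 3 * (v.normV * v.normV * ‖z‖)) := by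
    rw [← v.lpNorm_fn]
    exact hC.abs_integral_mul_mul_mul_le v.memLp_fn v.toV v.toV z
  have hlinear : |∫ x, v.fn x * V.fn z x ∂S.mu| ≤ v.normV * ‖z‖ :=
    (abs_integral_mul_le v.memLp_fn (V.memLp_fn z)).trans
      (mul_le_mul (lpNorm_fn_le v.toV) (lpNorm_fn_le z) lpNorm_nonneg hV)
  have hsplit : ∫ x, doubleWellNL τ (v.fn x) * V.fn z x ∂S.mu =
      4 * τ * (∫ x, v.fn x * (v.fn x * v.fn x * V.fn z x) ∂S.mu -
        ∫ x, v.fn x * V.fn z x ∂S.mu) := by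
    have hint : Integrable (fun x => v.fn x * (v.fn x * v.fn x * V.fn z x)) S.mu :=
      v.memLp_fn.integrable_mul (hC.memLp_mul_mul v.toV v.toV z)
    have hint' : Integrable (fun x => v.fn x * V.fn z x) S.mu :=
      v.memLp_fn.integrable_mul (V.memLp_fn z)
    rw [← integral_sub hint hint', ← integral_const_mul]
    congr with x
    rw [doubleWellNL]
    ring
  calc |∫ x, doubleWellNL τ (v.fn x) * V.fn z x ∂S.mu|
      ≤ 4 * τ * (v.normH * (C ^ 3 * (v.normV * v.normV * ‖z‖)) + v.normV * ‖z‖) := by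
        rw [hsplit, abs_mul, abs_of_nonneg (by positivity : 0 ≤ 4 * τ)]
        exact mul_le_mul_of_nonneg_left ((abs_sub _ _).trans (add_le_add hcubic hlinear))
          (by positivity)
    _ ≤ 4 * τ * ((C ^ 3 + 1) * (v.normV * (1 + v.normH * v.normV)) * ‖z‖) := by
        refine mul_le_mul_of_nonneg_left ?_ (by positivity)
        have : 0 ≤ C ^ 3 * (v.normV * ‖z‖) + v.normH * v.normV * v.normV * ‖z‖ := by positivity
        linarith
    _ = _ := by ring

lemma neg_pairA0_doubleWellNL_le (hS : S.Admissible) {C : ℝ} (hC : S.SobolevBound C) {τ : ℝ}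
    (hτ : 0 ≤ τ) (v : S.DomA) :
    -(S.pairA0 (fun x => doubleWellNL τ (v.fn x)) v) ≤ 8 * τ * v.normDA * v.normV := by
  have hD := v.normDA_nonneg
  have hcube : MemLp (fun x => v.fn x ^ 3) 2 S.mu := v.memLp_comp hS hC (continuous_pow 3) 2
  have hneg : MemLp (fun x => -1 * v.fn x) 2 S.mu := v.memLp_fn.const_mul (-1)
  have hsplit : S.pairA0 (fun x => doubleWellNL τ (v.fn x)) v =
      4 * τ * (S.pairA0 (fun x => v.fn x ^ 3) v - S.pairA0 v.fn v) := by
    have hexpand : (fun x => doubleWellNL τ (v.fn x)) =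
        fun x => 4 * τ * (v.fn x ^ 3 + -1 * v.fn x) := by
      ext x
      rw [doubleWellNL]
      ring
    rw [hexpand, pairA0_const_mul, pairA0_add hcube hneg, pairA0_const_mul]
    ring
  have hlinear : S.pairA0 v.fn v ≤ v.normV * (2 * v.normDA) := by
    refine (le_abs_self _).trans ((abs_pairA0_le v.memLp_fn v).trans ?_)
    rw [v.lpNorm_fn]
    exact mul_le_mul_of_nonneg_right v.normH_le_normV (by positivity)
  calc -(S.pairA0 (fun x => doubleWellNL τ (v.fn x)) v)
      = 4 * τ * (S.pairA0 v.fn v - S.pairA0 (fun x => v.fn x ^ 3) v) := by rw [hsplit]; ring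
    _ ≤ 4 * τ * (v.normV * (2 * v.normDA)) := by
        refine mul_le_mul_of_nonneg_left ?_ (by positivity)
        linarith [pairA0_cube_nonneg hS hC v]
    _ = _ := by ring

lemma growthF_doubleWell (hS : S.Admissible) {C : ℝ} (hC : S.SobolevBound C) {τ : ℝ}
    (hτ : 0 ≤ τ) : S.GrowthF (doubleWell τ) (doubleWellNL τ) := by
  have hC0 := hC.1
  refine ⟨hasDerivAt_doubleWell τ, doubleWell_nonneg hτ, fun z _ =>
    memLp_one_iff_integrable.1 (z.memLp_comp hS hC (continuous_doubleWell τ) 1), ?_⟩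
  set B := 4 * τ * (C ^ 3 + 1)
  have : 0 ≤ B := by positivity
  refine ⟨2 * B ^ 2 + 8 * τ, by positivity, fun v => ?_⟩
  have hV := v.normV_nonneg
  have hH := v.normH_nonneg
  have hD := v.normDA_nonneg
  have hf : MemLp (fun x => doubleWellNL τ (v.fn x)) 2 S.mu :=
    v.memLp_comp hS hC (contDiff_doubleWellNL τ).continuous 2
  have hnorm : ‖S.ofH (hf.toLp _)‖ ≤ B * (v.normV * (1 + v.normH * v.normV)) :=
    norm_le_of_represents (represents_of_memLp hf) (by positivity)
      (abs_integral_doubleWellNL_le hC hτ v)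
  refine ⟨⟨_, represents_of_memLp hf, ?_⟩, hf, ?_⟩
  · refine (sq_le_of_le_mul_one_add_mul (ContinuousLinearMap.opNorm_nonneg _) hnorm).trans ?_
    gcongr
    exact le_add_of_nonneg_right (by positivity)
  · refine (neg_pairA0_doubleWellNL_le hS hC hτ v).trans ?_
    gcongr
    exact le_add_of_nonneg_left (by positivity)

end DoubleWellGrowth

section DoubleWellDifferences

-- `∇(ψ(v) - ψ(w)) = ψ'(v) ∇(v - w) + (ψ'(v) - ψ'(w)) ∇w`
lemma exists_V_comp_sub (hS : S.Admissible) {v w : S.V} {R : ℝ} (hv : ∀ᵐ x ∂S.mu, |V.fn v x| ≤ R)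
    (hw : ∀ᵐ x ∂S.mu, |V.fn w x| ≤ R) {ψ : ℝ → ℝ} (hψ : ContDiff ℝ ∞ ψ) (h0 : ψ 0 = 0) {a b : ℝ}
    (ha : 0 ≤ a) (hb : 0 ≤ b) (hderiv : ∀ ⦃s⦄, |s| ≤ R → |deriv ψ s| ≤ a)
    (hlip : ∀ ⦃s t⦄, |s| ≤ R → |t| ≤ R → |deriv ψ s - deriv ψ t| ≤ b * |s - t|)
    {G : PiLp 2 fun _ : Fin d => S.H}
    (hG : ∀ i, G i =ᵐ[S.mu] fun x => V.fn (v - w) x * S.grad w i x) :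
    ∃ u : S.V, V.fn u =ᵐ[S.mu] (fun x => ψ (V.fn v x) - ψ (V.fn w x)) ∧
      ‖S.grad u‖ ≤ a * ‖S.grad (v - w)‖ + b * ‖G‖ := by
  obtain ⟨p, hp, hgradp⟩ := exists_V_comp_of_bounded hS v hv hψ h0
  obtain ⟨q, hq, hgradq⟩ := exists_V_comp_of_bounded hS w hw hψ h0
  refine ⟨p - q, ?_, norm_le_add_of_ae_le ha hb fun i => ?_⟩
  · filter_upwards [V.fn_sub p q, hp, hq] with x hpqx hpx hqx
    rw [hpqx, hpx, hqx]
  · filter_upwards [grad_sub p q i, hgradp i, hgradq i, grad_sub v w i, V.fn_sub v w, hG i, hv, hw]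
      with x hpqx hpx hqx hgradx hfnx hGx hvx hwx
    calc |S.grad (p - q) i x|
        = |deriv ψ (V.fn v x) * S.grad (v - w) i x +
            (deriv ψ (V.fn v x) - deriv ψ (V.fn w x)) * S.grad w i x| := by
          rw [hpqx, hpx, hqx, hgradx]
          ring_nf
      _ ≤ |deriv ψ (V.fn v x)| * |S.grad (v - w) i x| +
            |deriv ψ (V.fn v x) - deriv ψ (V.fn w x)| * |S.grad w i x| := by
          simp only [← abs_mul]
          exact abs_add_le _ _
      _ ≤ a * |S.grad (v - w) i x| + b * |V.fn v x - V.fn w x| * |S.grad w i x| := by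
          gcongr
          exacts [hderiv hvx, hlip hvx hwx]
      _ = a * |S.grad (v - w) i x| + b * |G i x| := by rw [hGx, hfnx, abs_mul, mul_assoc]

lemma normV_mul_normDA_le_left (v w : S.DomA) : v.normV * v.normDA ≤
    √(v.normV ^ 2 + w.normV ^ 2) * √(v.normDA ^ 2 + w.normDA ^ 2) :=
  mul_le_mul (Real.le_sqrt_of_sq_le (le_add_of_nonneg_right (sq_nonneg _)))
    (Real.le_sqrt_of_sq_le (le_add_of_nonneg_right (sq_nonneg _))) v.normDA_nonneg
    (Real.sqrt_nonneg _)

lemma normV_mul_normDA_le_right (v w : S.DomA) : w.normV * w.normDA ≤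
    √(v.normV ^ 2 + w.normV ^ 2) * √(v.normDA ^ 2 + w.normDA ^ 2) := by
  rw [add_comm (v.normV ^ 2), add_comm (v.normDA ^ 2)]
  exact normV_mul_normDA_le_left w v

lemma exists_mul_grad_sub (hS : S.Admissible) {C : ℝ} (hC : S.SobolevBound C) :
    ∃ M : ℝ, 0 ≤ M ∧ ∀ v w : S.DomA, ∃ G : PiLp 2 fun _ : Fin d => S.H,
      (∀ i, G i =ᵐ[S.mu] fun x => V.fn (v.toV - w.toV) x * S.grad w.toV i x) ∧
      ‖G‖ ≤ M * √(w.normV * w.normDA) * ‖v.toV - w.toV‖ := by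
  obtain ⟨K, -, hagmon⟩ := DomA.exists_abs_fn_le hS hC
  obtain ⟨M, hM, hweighted⟩ := exists_norm_sq_mul_grad_le hS hC
  refine ⟨√M, Real.sqrt_nonneg _, fun v w => ?_⟩
  have hvw : ∀ᵐ x ∂S.mu, |V.fn (v.toV - w.toV) x| ≤
      K * √(v.normV * v.normDA) + K * √(w.normV * w.normDA) := by
    filter_upwards [V.fn_sub v.toV w.toV, hagmon v, hagmon w] with x hx hvx hwx
    rw [hx]
    exact (abs_sub _ _).trans (add_le_add hvx hwx)
  obtain ⟨G, hG⟩ := exists_mul_grad (v.toV - w.toV) w.toV hvw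
  refine ⟨G, hG, le_of_sq_le_sq ((hweighted w _ G _ hvw hG).trans_eq ?_) (by positivity)⟩
  rw [mul_pow, mul_pow, Real.sq_sqrt hM,
    Real.sq_sqrt (mul_nonneg w.normV_nonneg w.normDA_nonneg)]

lemma difF_doubleWell (hS : S.Admissible) {C : ℝ} (hC : S.SobolevBound C) (τ : ℝ) :
    S.DifF (doubleWellNL τ) := by
  obtain ⟨K, hK, hagmon⟩ := DomA.exists_abs_fn_le hS hC
  obtain ⟨M, hM, hweighted⟩ := exists_mul_grad_sub hS hC
  refine ⟨4 * |τ| * (3 * K ^ 2 + 1 + 6 * K * M), by positivity, fun v w _ _ => ?_⟩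
  have hleft := Real.sqrt_le_sqrt (normV_mul_normDA_le_left v w)
  have hright := Real.sqrt_le_sqrt (normV_mul_normDA_le_right v w)
  rw [difBound]
  set p := √(v.normV ^ 2 + w.normV ^ 2)
  set q := √(v.normDA ^ 2 + w.normDA ^ 2)
  have hp : 0 ≤ p := Real.sqrt_nonneg _
  have hq : 0 ≤ q := Real.sqrt_nonneg _
  obtain ⟨G, hG, hGnorm⟩ := hweighted v w
  obtain ⟨u, hu, hgradu⟩ := exists_V_comp_sub hS (R := K * √(p * q))
    ((hagmon v).mono fun x hx => hx.trans (mul_le_mul_of_nonneg_left hleft hK))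
    ((hagmon w).mono fun x hx => hx.trans (mul_le_mul_of_nonneg_left hright hK))
    (contDiff_doubleWellNL τ) (doubleWellNL_zero τ) (by positivity) (by positivity)
    (fun s hs => abs_deriv_doubleWellNL_le τ hs)
    (fun s t hs ht => abs_deriv_doubleWellNL_sub_le τ hs ht) hG
  refine ⟨u, hu, ?_⟩
  calc ‖S.A0 u‖ ≤ ‖S.grad u‖ := norm_A0_le u
    _ ≤ 4 * |τ| * (3 * (K * √(p * q)) ^ 2 + 1) * ‖v.toV - w.toV‖ +
          24 * |τ| * (K * √(p * q)) * (M * √(p * q) * ‖v.toV - w.toV‖) := by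
        refine hgradu.trans ?_
        gcongr
        · exact norm_grad_le _
        · exact hGnorm.trans (by gcongr)
    _ = 4 * |τ| * (3 * K ^ 2 * √(p * q) ^ 2 + 1 + 6 * K * M * √(p * q) ^ 2) *
          ‖v.toV - w.toV‖ := by ring
    _ = 4 * |τ| * (3 * K ^ 2 * (p * q) + 1 + 6 * K * M * (p * q)) * ‖v.toV - w.toV‖ := by
        rw [Real.sq_sqrt (mul_nonneg hp hq)]
    _ ≤ 4 * |τ| * ((3 * K ^ 2 + 1 + 6 * K * M) * ((1 + p) * (1 + q))) * ‖v.toV - w.toV‖ := by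
        gcongr
        have : 0 ≤ (3 * K ^ 2 + 6 * K * M) * (1 + p + q) + (p + q + p * q) := by positivity
        linarith
    _ = _ := by ring

end DoubleWellDifferences

end Setting

/-! ### The control nonlinearity -/

section ControlNonlinearity

variable {d : ℕ} {a₀ a₁ a₂ : E d → ℝ} {x : E d}

lemma mul_abs_sub_mul_nonneg (s t : ℝ) : 0 ≤ (s * |s| - t * |t|) * (s - t) := by
  have hsq : (|s| - |t|) * (s ^ 2 - t ^ 2) = (|s| + |t|) * (|s| - |t|) ^ 2 := by
    rw [← sq_abs s, ← sq_abs t]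
    ring
  calc 0 ≤ ((|s| + |t|) * (s - t) ^ 2 + (|s| + |t|) * (|s| - |t|) ^ 2) / 2 := by positivity
    _ = (s * |s| - t * |t|) * (s - t) := by rw [← hsq]; ring

lemma abs_mul_abs_sub_le (s t : ℝ) : |(s * |s| - t * |t|)| ≤ (|s| + |t|) * |s - t| := by
  calc |(s * |s| - t * |t|)| = |(s * (|s| - |t|) + (s - t) * |t|)| := by
        rw [mul_sub, sub_mul, sub_add_sub_cancel]
    _ ≤ |s| * |(|s| - |t|)| + |s - t| * |t| := by
        refine (abs_add_le _ _).trans_eq ?_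
        rw [abs_mul, abs_mul, abs_abs]
    _ ≤ |s| * |s - t| + |s - t| * |t| := by
        have := mul_le_mul_of_nonneg_left (abs_abs_sub_abs_le s t) (abs_nonneg s)
        linarith
    _ = _ := by ring

lemma gBar_zero (x : E d) : gBar a₁ a₂ x 0 = 0 := by simp [gBar]

lemma gBar_eq (x : E d) (s : ℝ) : gBar a₁ a₂ x s = (a₁ x - a₂ x) * s + a₂ x * (s * |s|) := by
  rw [gBar]
  ring

lemma gClass_eq (x : E d) (s : ℝ) : gClass a₀ a₁ a₂ x s = a₀ x + gBar a₁ a₂ x s := by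
  rw [gClass, gBar]
  ring

lemma gClass_sub (x : E d) (s t : ℝ) :
    gClass a₀ a₁ a₂ x s - gClass a₀ a₁ a₂ x t = gBar a₁ a₂ x s - gBar a₁ a₂ x t := by
  rw [gClass_eq, gClass_eq, add_sub_add_left_eq_sub]

lemma gBar_sub (x : E d) (s t : ℝ) : gBar a₁ a₂ x s - gBar a₁ a₂ x t =
    (a₁ x - a₂ x) * (s - t) + a₂ x * (s * |s| - t * |t|) := by
  rw [gBar_eq, gBar_eq]
  ring

lemma abs_gBar_sub_le {A₁ A₂ : ℝ} (h₁ : |a₁ x| ≤ A₁) (h₂ : |a₂ x| ≤ A₂) (s t : ℝ) :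
    |gBar a₁ a₂ x s - gBar a₁ a₂ x t| ≤ (A₁ + A₂) * ((1 + |s| + |t|) * |s - t|) := by
  have hA₁ : 0 ≤ A₁ := (abs_nonneg _).trans h₁
  have hA₂ : 0 ≤ A₂ := (abs_nonneg _).trans h₂
  calc |gBar a₁ a₂ x s - gBar a₁ a₂ x t|
      ≤ |a₁ x - a₂ x| * |s - t| + |a₂ x| * |(s * |s| - t * |t|)| := by
        rw [gBar_sub, ← abs_mul, ← abs_mul]
        exact abs_add_le _ _
    _ ≤ (A₁ + A₂) * |s - t| + A₂ * ((|s| + |t|) * |s - t|) := by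
        gcongr
        · exact (abs_sub _ _).trans (add_le_add h₁ h₂)
        · exact abs_mul_abs_sub_le s t
    _ ≤ (A₁ + A₂) * |s - t| + (A₁ + A₂) * ((|s| + |t|) * |s - t|) := by
        gcongr
        exact le_add_of_nonneg_left hA₁
    _ = _ := by ring

lemma neg_gBar_sub_mul_le {A₁ A₂ : ℝ} (h₁ : |a₁ x| ≤ A₁) (h₂ : |a₂ x| ≤ A₂) (h₂' : 0 ≤ a₂ x)
    (s t : ℝ) : -((gBar a₁ a₂ x s - gBar a₁ a₂ x t) * (s - t)) ≤ (A₁ + A₂) * (s - t) ^ 2 := by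
  calc -((gBar a₁ a₂ x s - gBar a₁ a₂ x t) * (s - t))
      = -(a₁ x - a₂ x) * (s - t) ^ 2 - a₂ x * ((s * |s| - t * |t|) * (s - t)) := by
        rw [gBar_sub]
        ring
    _ ≤ -(a₁ x - a₂ x) * (s - t) ^ 2 :=
        sub_le_self _ (mul_nonneg h₂' (mul_abs_sub_mul_nonneg s t))
    _ ≤ _ := by
        gcongr
        exact (neg_le_abs _).trans ((abs_sub _ _).trans (add_le_add h₁ h₂))

variable {μ : Measure (E d)}

lemma memLp_gBar [IsFiniteMeasure μ] (ha₁ : MemLp a₁ ∞ μ) (ha₂ : MemLp a₂ ∞ μ) {w : E d → ℝ}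
    (hw : MemLp w 4 μ) : MemLp (fun x => gBar a₁ a₂ x (w x)) 2 μ := by
  have : ENNReal.HolderTriple 4 4 2 := .of_toReal ⟨by norm_num, by norm_num, by norm_num⟩
  have hw2 : MemLp w 2 μ := hw.mono_exponent (by norm_num)
  have hww : MemLp (fun x => w x * |w x|) 2 μ := hw.abs.mul' hw
  have hlinear : MemLp (fun x => (a₁ x - a₂ x) * w x) 2 μ := hw2.mul' (ha₁.sub ha₂)
  have hquadratic : MemLp (fun x => a₂ x * (w x * |w x|)) 2 μ := hww.mul' ha₂
  simp only [gBar_eq]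
  exact hlinear.add hquadratic

lemma abs_integral_gBar_sub_mul_le [IsFiniteMeasure μ] (ha₁ : MemLp a₁ ∞ μ)
    (ha₂ : MemLp a₂ ∞ μ) {p q z : E d → ℝ} (hp : MemLp p 2 μ) (hq : MemLp q 2 μ)
    (hz : MemLp (fun x => (p x - q x) * z x) 2 μ) :
    |∫ x, (gBar a₁ a₂ x (p x) - gBar a₁ a₂ x (q x)) * z x ∂μ| ≤
      (lpNorm a₁ ∞ μ + lpNorm a₂ ∞ μ) *
        ((lpNorm (fun _ => (1 : ℝ)) 2 μ + lpNorm p 2 μ + lpNorm q 2 μ) *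
          lpNorm (fun x => (p x - q x) * z x) 2 μ) := by
  have hone : MemLp (fun _ : E d => (1 : ℝ)) 2 μ := memLp_const 1
  have hweight : MemLp (fun x => 1 + |p x| + |q x|) 2 μ := (hone.add hp.abs).add hq.abs
  have hweight_le : lpNorm (fun x => 1 + |p x| + |q x|) 2 μ ≤
      lpNorm (fun _ => (1 : ℝ)) 2 μ + lpNorm p 2 μ + lpNorm q 2 μ := by
    have h_outer : lpNorm (fun x => 1 + |p x| + |q x|) 2 μ ≤
        lpNorm (fun x => 1 + |p x|) 2 μ + lpNorm (fun x => |q x|) 2 μ :=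
      lpNorm_add_le (hone.add hp.abs) one_le_two
    have h_inner : lpNorm (fun x => 1 + |p x|) 2 μ ≤
        lpNorm (fun _ => (1 : ℝ)) 2 μ + lpNorm (fun x => |p x|) 2 μ :=
      lpNorm_add_le hone one_le_two
    rw [lpNorm_fun_abs hq.1] at h_outer
    rw [lpNorm_fun_abs hp.1] at h_inner
    linarith
  have hint : Integrable (fun x => (1 + |p x| + |q x|) * |(p x - q x) * z x|) μ :=
    hweight.integrable_mul hz.abs
  calc |∫ x, (gBar a₁ a₂ x (p x) - gBar a₁ a₂ x (q x)) * z x ∂μ|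
      ≤ ∫ x, (lpNorm a₁ ∞ μ + lpNorm a₂ ∞ μ) *
          ((1 + |p x| + |q x|) * |(p x - q x) * z x|) ∂μ := by
        rw [← Real.norm_eq_abs]
        refine norm_integral_le_of_norm_le (hint.const_mul _) ?_
        filter_upwards [ae_le_lpNorm_exponent_top ha₁, ae_le_lpNorm_exponent_top ha₂]
          with x h₁ h₂
        rw [Real.norm_eq_abs, abs_mul, abs_mul, ← mul_assoc (1 + |p x| + |q x|), ← mul_assoc]
        exact mul_le_mul_of_nonneg_right (abs_gBar_sub_le h₁ h₂ _ _) (abs_nonneg _)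
    _ ≤ (lpNorm a₁ ∞ μ + lpNorm a₂ ∞ μ) * (lpNorm (fun x => 1 + |p x| + |q x|) 2 μ *
          lpNorm (fun x => (p x - q x) * z x) 2 μ) := by
        rw [integral_const_mul, ← lpNorm_fun_abs hz.1]
        exact mul_le_mul_of_nonneg_left ((le_abs_self _).trans (abs_integral_mul_le hweight hz.abs))
          (add_nonneg lpNorm_nonneg lpNorm_nonneg)
    _ ≤ _ := mul_le_mul_of_nonneg_left (mul_le_mul_of_nonneg_right hweight_le lpNorm_nonneg)
        (add_nonneg lpNorm_nonneg lpNorm_nonneg)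

lemma neg_integral_gBar_add_sub_mul_le (ha₁ : MemLp a₁ ∞ μ) (ha₂ : MemLp a₂ ∞ μ)
    (ha₂nn : ∀ᵐ x ∂μ, 0 ≤ a₂ x) {q z : E d → ℝ} (hz : MemLp z 2 μ)
    (hg : MemLp (fun x => gBar a₁ a₂ x (q x + z x) - gBar a₁ a₂ x (q x)) 2 μ) :
    -(∫ x, (gBar a₁ a₂ x (q x + z x) - gBar a₁ a₂ x (q x)) * z x ∂μ) ≤
      (lpNorm a₁ ∞ μ + lpNorm a₂ ∞ μ) * lpNorm z 2 μ ^ 2 := by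
  rw [sq_lpNorm_two hz, ← integral_const_mul, ← integral_neg]
  refine integral_mono_ae (hg.integrable_mul hz).neg (hz.integrable_sq.const_mul _) ?_
  filter_upwards [ae_le_lpNorm_exponent_top ha₁, ae_le_lpNorm_exponent_top ha₂, ha₂nn]
    with x h₁ h₂ h₂nn
  simpa only [add_sub_cancel_left] using neg_gBar_sub_mul_le h₁ h₂ h₂nn (q x + z x) (q x)

end ControlNonlinearity

lemma sq_le_of_le_one_add_mul {N B V h : ℝ} (hN : 0 ≤ N) (hh : 0 ≤ h) (hhV : h ≤ V)
    (h_le : N ≤ B * ((1 + h) * V)) : N ^ 2 ≤ 4 * B ^ 2 * V ^ 2 * (1 + h ^ 2 * V ^ 2) := by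
  have h_four : h ^ 4 ≤ h ^ 2 * V ^ 2 := by
    rw [show h ^ 4 = h ^ 2 * h ^ 2 by ring]
    gcongr
  have h_one_add : (1 + h) ^ 2 ≤ 4 * (1 + h ^ 2 * V ^ 2) := by
    linarith [sq_nonneg (1 - h), sq_nonneg (1 - h ^ 2), sq_nonneg (h ^ 2)]
  calc N ^ 2 ≤ (B * ((1 + h) * V)) ^ 2 := pow_le_pow_left₀ hN h_le 2
    _ = (B * V) ^ 2 * (1 + h) ^ 2 := by ring
    _ ≤ (B * V) ^ 2 * (4 * (1 + h ^ 2 * V ^ 2)) := by gcongr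
    _ = _ := by ring

namespace Setting
variable {d : ℕ} {S : Setting d} {a₀ a₁ a₂ : E d → ℝ}

section ControlEstimates

lemma SobolevBound.memLp_four (hS : S.Admissible) {C : ℝ} (hC : S.SobolevBound C) (v : S.V) :
    MemLp (V.fn v) 4 S.mu :=
  have := hS.isFiniteMeasure
  (hC.2 v).1.mono_exponent (by norm_num)

lemma SobolevBound.exists_lpNorm_mul_le (hS : S.Admissible) {C : ℝ} (hC : S.SobolevBound C) :
    ∃ C₂ : ℝ, 0 ≤ C₂ ∧ ∀ a b : S.V, MemLp (fun x => V.fn a x * V.fn b x) 2 S.mu ∧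
      lpNorm (fun x => V.fn a x * V.fn b x) 2 S.mu ≤ C₂ * (‖a‖ * ‖b‖) := by
  have := hS.isFiniteMeasure
  have hC0 := hC.1
  have hone : MemLp (fun _ : E d => (1 : ℝ)) 6 S.mu := memLp_const 1
  refine ⟨C ^ 2 * lpNorm (fun _ : E d => (1 : ℝ)) 6 S.mu,
    mul_nonneg (sq_nonneg C) lpNorm_nonneg, fun a b => ?_⟩
  have hmem := memLp_mul_mul_of_six (hC.2 a).1 (hC.2 b).1 hone
  have hle := lpNorm_mul_mul_le_six (hC.2 a).1 (hC.2 b).1 hone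
  simp only [mul_one] at hmem hle
  refine ⟨hmem, ?_⟩
  calc lpNorm (fun x => V.fn a x * V.fn b x) 2 S.mu
      ≤ lpNorm (V.fn a) 6 S.mu * lpNorm (V.fn b) 6 S.mu * lpNorm (fun _ => (1 : ℝ)) 6 S.mu := hle
    _ ≤ C * ‖a‖ * (C * ‖b‖) * lpNorm (fun _ => (1 : ℝ)) 6 S.mu :=
        mul_le_mul_of_nonneg_right
          (mul_le_mul (hC.2 a).2 (hC.2 b).2 lpNorm_nonneg (by positivity)) lpNorm_nonneg
    _ = _ := by ring

lemma Represents.congr_ae {w₁ w₂ : E d → ℝ} {l : S.V'} (hl : S.Represents w₁ l)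
    (h : w₁ =ᵐ[S.mu] w₂) : S.Represents w₂ l := fun z => by
  have hmul : (fun x => w₁ x * V.fn z x) =ᵐ[S.mu] fun x => w₂ x * V.fn z x :=
    h.mono fun x hx => congrArg (· * V.fn z x) hx
  exact ⟨(hl z).1.congr hmul, (integral_congr_ae hmul).symm.trans (hl z).2⟩

lemma exists_represents_gBar_sub (hS : S.Admissible) {C : ℝ} (hC : S.SobolevBound C)
    (ha₁ : MemLp a₁ ∞ S.mu) (ha₂ : MemLp a₂ ∞ S.mu) :
    ∃ M : ℝ, 0 ≤ M ∧ ∀ v w : S.V, ∃ l : S.V',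
      S.Represents (fun x => gBar a₁ a₂ x (V.fn v x) - gBar a₁ a₂ x (V.fn w x)) l ∧
      ‖l‖ ≤ M * ((1 + ‖S.inclH v‖ + ‖S.inclH w‖) * ‖v - w‖) := by
  have := hS.isFiniteMeasure
  obtain ⟨C₂, hC₂, hmul⟩ := hC.exists_lpNorm_mul_le hS
  set A := lpNorm a₁ ∞ S.mu + lpNorm a₂ ∞ S.mu
  have hA : 0 ≤ A := add_nonneg lpNorm_nonneg lpNorm_nonneg
  set L := lpNorm (fun _ : E d => (1 : ℝ)) 2 S.mu
  have hL : 0 ≤ L := lpNorm_nonneg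
  refine ⟨A * (1 + L) * C₂, by positivity, fun v w => ?_⟩
  have hg : MemLp (fun x => gBar a₁ a₂ x (V.fn v x) - gBar a₁ a₂ x (V.fn w x)) 2 S.mu :=
    (memLp_gBar ha₁ ha₂ (hC.memLp_four hS v)).sub (memLp_gBar ha₁ ha₂ (hC.memLp_four hS w))
  refine ⟨_, represents_of_memLp hg,
    norm_le_of_represents (represents_of_memLp hg) (by positivity) fun z => ?_⟩
  have hprod : (fun x => V.fn (v - w) x * V.fn z x) =ᵐ[S.mu]
      fun x => (V.fn v x - V.fn w x) * V.fn z x := by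
    filter_upwards [V.fn_sub v w] with x hx
    rw [hx]
  obtain ⟨hmem, hle⟩ := hmul (v - w) z
  have hbound := abs_integral_gBar_sub_mul_le ha₁ ha₂ (V.memLp_fn v) (V.memLp_fn w)
    (hmem.ae_eq hprod)
  have hfn (u : S.V) : lpNorm (V.fn u) 2 S.mu = ‖S.inclH u‖ := lpNorm_coeFn _
  rw [← lpNorm_congr_ae hprod, hfn, hfn] at hbound
  calc _ ≤ A * ((L + ‖S.inclH v‖ + ‖S.inclH w‖) * (C₂ * (‖v - w‖ * ‖z‖))) :=
        hbound.trans (by gcongr)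
    _ ≤ A * ((1 + L) * (1 + ‖S.inclH v‖ + ‖S.inclH w‖) * (C₂ * (‖v - w‖ * ‖z‖))) := by
        gcongr
        have : 0 ≤ L * (‖S.inclH v‖ + ‖S.inclH w‖) := by positivity
        linarith
    _ = _ := by ring

lemma exists_represents_gBar (hS : S.Admissible) {C : ℝ} (hC : S.SobolevBound C)
    (ha₁ : MemLp a₁ ∞ S.mu) (ha₂ : MemLp a₂ ∞ S.mu) :
    ∃ M : ℝ, 0 ≤ M ∧ ∀ v : S.V, ∃ l : S.V',
      S.Represents (fun x => gBar a₁ a₂ x (V.fn v x)) l ∧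
      ‖l‖ ≤ M * ((1 + ‖S.inclH v‖) * ‖v‖) := by
  obtain ⟨M, hM, hsub⟩ := exists_represents_gBar_sub hS hC ha₁ ha₂
  refine ⟨M, hM, fun v => ?_⟩
  obtain ⟨l, hl, hnorm⟩ := hsub v 0
  have hfn_zero : V.fn (0 : S.V) =ᵐ[S.mu] 0 := by
    rw [V.fn, map_zero]
    exact Lp.coeFn_zero ..
  refine ⟨l, hl.congr_ae ?_, by simpa using hnorm⟩
  filter_upwards [hfn_zero] with x hx
  rw [hx, Pi.zero_apply, gBar_zero, sub_zero]

lemma DomA.normH_le_normDA (v : S.DomA) : v.normH ≤ v.normDA :=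
  v.normH_le_normV.trans v.normV_le_normDA

lemma growthG_gBar (hS : S.Admissible) {C : ℝ} (hC : S.SobolevBound C)
    (ha₁ : MemLp a₁ ∞ S.mu) (ha₂ : MemLp a₂ ∞ S.mu) (ha₂nn : ∀ᵐ x ∂S.mu, 0 ≤ a₂ x) :
    S.GrowthG (gBar a₁ a₂) := by
  have := hS.isFiniteMeasure
  obtain ⟨M, -, hrep⟩ := exists_represents_gBar hS hC ha₁ ha₂
  set A := lpNorm a₁ ∞ S.mu + lpNorm a₂ ∞ S.mu
  have hA : 0 ≤ A := add_nonneg lpNorm_nonneg lpNorm_nonneg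
  refine ⟨4 * M ^ 2 + A, by positivity, fun v => ?_⟩
  have hH := v.normH_nonneg
  have := v.normV_nonneg
  have hD := v.normDA_nonneg
  obtain ⟨l, hl, hnorm⟩ := hrep v.toV
  refine ⟨l, hl, ?_, ?_⟩
  · refine (sq_le_of_le_one_add_mul (ContinuousLinearMap.opNorm_nonneg _) hH v.normH_le_normV
      hnorm).trans ?_
    change _ ≤ (4 * M ^ 2 + A) * v.normV ^ 2 * (1 + v.normH ^ 2 * v.normV ^ 2)
    gcongr
    exact le_add_of_nonneg_right hA
  · have hg : MemLp (fun x => gBar a₁ a₂ x (v.fn x)) 2 S.mu :=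
      memLp_gBar ha₁ ha₂ (hC.memLp_four hS v.toV)
    have hneg := neg_integral_gBar_add_sub_mul_le (q := fun _ => 0) ha₁ ha₂ ha₂nn v.memLp_fn
      (by simpa only [zero_add, gBar_zero, sub_zero] using hg)
    simp only [zero_add, gBar_zero, sub_zero, v.lpNorm_fn] at hneg
    calc -(l v.toV) ≤ A * v.normH ^ 2 := (hl v.toV).2 ▸ hneg
      _ = A * (v.normH * v.normH) := by rw [sq]
      _ ≤ (4 * M ^ 2 + A) * (v.normDA * v.normV) := by
          gcongr
          exacts [le_add_of_nonneg_left (by positivity), v.normH_le_normDA, v.normH_le_normV]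
      _ = _ := by ring

lemma difG_gBar (hS : S.Admissible) {C : ℝ} (hC : S.SobolevBound C)
    (ha₁ : MemLp a₁ ∞ S.mu) (ha₂ : MemLp a₂ ∞ S.mu) : S.DifG (gBar a₁ a₂) := by
  obtain ⟨M, hM, hsub⟩ := exists_represents_gBar_sub hS hC ha₁ ha₂
  refine ⟨2 * M, by positivity, fun v w _ _ => ?_⟩
  obtain ⟨l, hl, hnorm⟩ := hsub v.toV w.toV
  refine ⟨l, hl, hnorm.trans ?_⟩
  have hv : v.normH ≤ √(v.normV ^ 2 + w.normV ^ 2) :=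
    v.normH_le_normV.trans (Real.le_sqrt_of_sq_le (le_add_of_nonneg_right (sq_nonneg _)))
  have hw : w.normH ≤ √(v.normV ^ 2 + w.normV ^ 2) :=
    w.normH_le_normV.trans (Real.le_sqrt_of_sq_le (le_add_of_nonneg_left (sq_nonneg _)))
  rw [difBound]
  set p := √(v.normV ^ 2 + w.normV ^ 2)
  set q := √(v.normDA ^ 2 + w.normDA ^ 2)
  have : 0 ≤ p := Real.sqrt_nonneg _
  have : 0 ≤ q := Real.sqrt_nonneg _
  calc M * ((1 + v.normH + w.normH) * ‖v.toV - w.toV‖)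
      ≤ M * (2 * ((1 + p) * (1 + q)) * ‖v.toV - w.toV‖) := by
        gcongr
        have : 0 ≤ q + p * q := by positivity
        linarith
    _ = _ := by ring

end ControlEstimates

section Target

lemma EssBdd.exists_bound (hS : S.Admissible) {y : ℝ → E d → ℝ} (hy : S.EssBdd y) :
    ∃ Y : ℝ, 0 ≤ Y ∧ ∀ᵐ t ∂(volume.restrict (Ioi (0 : ℝ))),
      AEStronglyMeasurable (y t) S.mu ∧ ∀ᵐ x ∂S.mu, |y t x| ≤ Y := by
  have := hS.isFiniteMeasure
  refine ⟨lpNorm (Function.uncurry y) ∞ ((volume.restrict (Ioi (0 : ℝ))).prod S.mu),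
    lpNorm_nonneg, ?_⟩
  exact hy.1.prodMk_left.and (Measure.ae_ae_of_ae_prod (ae_le_lpNorm_exponent_top hy))

lemma boundNg_gBar (hS : S.Admissible) {C : ℝ} (hC : S.SobolevBound C)
    (ha₁ : MemLp a₁ ∞ S.mu) (ha₂ : MemLp a₂ ∞ S.mu) (ha₂nn : ∀ᵐ x ∂S.mu, 0 ≤ a₂ x) {n : ℕ}
    (hn : 0 < n) {y : ℝ → E d → ℝ} (hy : S.EssBdd y) : S.BoundNg n (gBar a₁ a₂) y := by
  have := hS.isFiniteMeasure
  obtain ⟨Y, -, hyb⟩ := hy.exists_bound hS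
  have hA : 0 ≤ lpNorm a₁ ∞ S.mu + lpNorm a₂ ∞ S.mu := add_nonneg lpNorm_nonneg lpNorm_nonneg
  refine ⟨_, fun _ => 2, fun _ => 0, hA, fun _ => by norm_num, ?_⟩
  filter_upwards [hyb] with t ⟨hyt, hytY⟩ z
  have hy4 : MemLp (y t) 4 S.mu := .of_bound hyt Y hytY
  have hg : MemLp (fun x => gBar a₁ a₂ x (y t x + z.fn x) - gBar a₁ a₂ x (y t x)) 2 S.mu :=
    (memLp_gBar ha₁ ha₂ (hy4.add (hC.memLp_four hS z.toV))).sub (memLp_gBar ha₁ ha₂ hy4)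
  refine ⟨⟨_, fun u => ⟨hg.integrable_mul u.memLp_fn, (abs_integral_mul_le hg u.memLp_fn).trans
    (mul_le_mul_of_nonneg_left (u.lpNorm_fn.trans_le u.normH_le_normDA) lpNorm_nonneg)⟩⟩, ?_⟩
  refine (neg_integral_gBar_add_sub_mul_le ha₁ ha₂ ha₂nn z.memLp_fn hg).trans
    (mul_le_mul_of_nonneg_left ?_ hA)
  simp only [z.lpNorm_fn, Real.rpow_two, Real.rpow_zero, mul_one, Finset.sum_const,
    Finset.card_univ, Fintype.card_fin, nsmul_eq_mul]
  exact le_mul_of_one_le_left (sq_nonneg _) (by exact_mod_cast hn)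

lemma lpNorm_sq_pow_four_le (hS : S.Admissible) {C : ℝ} (hC : S.SobolevBound C) (z : S.DomA) :
    lpNorm (fun x => z.fn x ^ 2) 2 S.mu ^ 4 ≤ C ^ 6 * (z.normH ^ 5 * z.normDA ^ 3) := by
  have := hC.1
  have := z.normH_nonneg
  have hquartic : lpNorm (fun x => z.fn x ^ 2) 2 S.mu ^ 2 ≤ z.normH * (C ^ 3 * z.normV ^ 3) := by
    have hsq : MemLp (fun x => z.fn x ^ 2) 2 S.mu := z.memLp_comp hS hC (continuous_pow 2) 2
    calc lpNorm (fun x => z.fn x ^ 2) 2 S.mu ^ 2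
        = ∫ x, z.fn x * (z.fn x * z.fn x * z.fn x) ∂S.mu := by
          rw [sq_lpNorm_two hsq]
          congr with x
          ring
      _ ≤ lpNorm z.fn 2 S.mu * (C ^ 3 * (z.normV * z.normV * z.normV)) :=
          (le_abs_self _).trans
            (hC.abs_integral_mul_mul_mul_le z.memLp_fn z.toV z.toV z.toV)
      _ = _ := by rw [z.lpNorm_fn]; ring
  calc lpNorm (fun x => z.fn x ^ 2) 2 S.mu ^ 4
      = (lpNorm (fun x => z.fn x ^ 2) 2 S.mu ^ 2) ^ 2 := by ring
    _ ≤ (z.normH * (C ^ 3 * z.normV ^ 3)) ^ 2 := pow_le_pow_left₀ (sq_nonneg _) hquartic 2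
    _ = C ^ 6 * z.normH ^ 2 * (z.normV ^ 2) ^ 3 := by ring
    _ ≤ C ^ 6 * z.normH ^ 2 * (z.normH * z.normDA) ^ 3 := by
        gcongr
        exact z.normV_sq_le
    _ = _ := by ring

lemma lpNorm_sq_le (hS : S.Admissible) {C : ℝ} (hC : S.SobolevBound C) (z : S.DomA) :
    lpNorm (fun x => z.fn x ^ 2) 2 S.mu ≤
      (1 + C) ^ 2 * (z.normH ^ (5 / 4 : ℝ) * z.normDA ^ (3 / 4 : ℝ)) := by
  have hC0 := hC.1
  have hH := z.normH_nonneg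
  have hD := z.normDA_nonneg
  have hrpow : (z.normH ^ (5 / 4 : ℝ) * z.normDA ^ (3 / 4 : ℝ)) ^ 4 =
      z.normH ^ 5 * z.normDA ^ 3 := by
    rw [mul_pow, ← Real.rpow_mul_natCast hH, ← Real.rpow_mul_natCast hD]
    norm_num
  refine le_of_pow_le_pow_left₀ (n := 4) four_ne_zero (by positivity) ?_
  calc lpNorm (fun x => z.fn x ^ 2) 2 S.mu ^ 4
      ≤ C ^ 6 * (z.normH ^ 5 * z.normDA ^ 3) := lpNorm_sq_pow_four_le hS hC z
    _ ≤ (1 + C) ^ 8 * (z.normH ^ 5 * z.normDA ^ 3) := by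
        gcongr
        calc C ^ 6 ≤ (1 + C) ^ 6 := by gcongr; linarith
          _ ≤ (1 + C) ^ 8 := pow_le_pow_right₀ (by linarith) (by norm_num)
    _ = _ := by rw [← hrpow]; ring

lemma abs_pairA0_bounded_mul_le {c w : E d → ℝ} {R : ℝ} (hR : 0 ≤ R)
    (hc : AEStronglyMeasurable c S.mu) (hcR : ∀ᵐ x ∂S.mu, |c x| ≤ R) (hw : MemLp w 2 S.mu)
    (v : S.DomA) : |S.pairA0 (fun x => c x * w x) v| ≤ 2 * R * lpNorm w 2 S.mu * v.normDA := by
  have hcw : MemLp (fun x => c x * w x) 2 S.mu := hw.mul' (memLp_top_of_bound hc R hcR)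
  have hle : lpNorm (fun x => c x * w x) 2 S.mu ≤ R * lpNorm w 2 S.mu := by
    rw [← abs_of_nonneg hR, ← lpNorm_const_mul]
    refine lpNorm_mono_ae (hw.const_mul R) ?_
    filter_upwards [hcR] with x hx
    rw [norm_mul, norm_mul, Real.norm_of_nonneg hR]
    exact mul_le_mul_of_nonneg_right hx (norm_nonneg _)
  calc |S.pairA0 (fun x => c x * w x) v|
      ≤ lpNorm (fun x => c x * w x) 2 S.mu * (2 * v.normDA) := abs_pairA0_le hcw v
    _ ≤ R * lpNorm w 2 S.mu * (2 * v.normDA) :=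
        mul_le_mul_of_nonneg_right hle (mul_nonneg zero_le_two v.normDA_nonneg)
    _ = _ := by ring

lemma doubleWellNL_add_sub (τ s t : ℝ) : doubleWellNL τ (s + t) - doubleWellNL τ s =
    4 * τ * (t ^ 3 + (3 * s * t ^ 2 + (3 * s ^ 2 - 1) * t)) := by
  rw [doubleWellNL, doubleWellNL]
  ring

lemma neg_pairA0_doubleWellNL_add_sub_le (hS : S.Admissible) {C : ℝ} (hC : S.SobolevBound C)
    {τ : ℝ} (hτ : 0 ≤ τ) {y : E d → ℝ} (hy : AEStronglyMeasurable y S.mu) {Y : ℝ} (hY : 0 ≤ Y)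
    (hyY : ∀ᵐ x ∂S.mu, |y x| ≤ Y) (z : S.DomA) :
    -(S.pairA0 (fun x => doubleWellNL τ (y x + z.fn x) - doubleWellNL τ (y x)) z) ≤
      4 * τ * (6 * Y * lpNorm (fun x => z.fn x ^ 2) 2 S.mu +
        2 * (3 * Y ^ 2 + 1) * z.normH) * z.normDA := by
  have hcube : MemLp (fun x => z.fn x ^ 3) 2 S.mu := z.memLp_comp hS hC (continuous_pow 3) 2
  have hsq : MemLp (fun x => z.fn x ^ 2) 2 S.mu := z.memLp_comp hS hC (continuous_pow 2) 2
  have hc₂ : AEStronglyMeasurable (fun x => 3 * y x) S.mu := hy.const_mul 3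
  have hc₁ : AEStronglyMeasurable (fun x => 3 * y x ^ 2 - 1) S.mu :=
    ((hy.pow 2).const_mul 3).sub aestronglyMeasurable_const
  have hc₂Y : ∀ᵐ x ∂S.mu, |3 * y x| ≤ 3 * Y := hyY.mono fun x hx => by
    rw [abs_mul, abs_of_pos three_pos]
    gcongr
  have hc₁Y : ∀ᵐ x ∂S.mu, |3 * y x ^ 2 - 1| ≤ 3 * Y ^ 2 + 1 := hyY.mono fun x hx => by
    have hle : y x ^ 2 ≤ Y ^ 2 := sq_le_sq' (abs_le.1 hx).1 (abs_le.1 hx).2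
    exact abs_le.2 ⟨by linarith [sq_nonneg (y x), sq_nonneg Y], by linarith⟩
  have hquadratic : MemLp (fun x => 3 * y x * z.fn x ^ 2) 2 S.mu :=
    hsq.mul' (memLp_top_of_bound hc₂ _ hc₂Y)
  have hlinear : MemLp (fun x => (3 * y x ^ 2 - 1) * z.fn x) 2 S.mu :=
    z.memLp_fn.mul' (memLp_top_of_bound hc₁ _ hc₁Y)
  have hsum : MemLp (fun x => 3 * y x * z.fn x ^ 2 + (3 * y x ^ 2 - 1) * z.fn x) 2 S.mu :=
    hquadratic.add hlinear
  have hquadratic_le := abs_pairA0_bounded_mul_le (by positivity) hc₂ hc₂Y hsq z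
  have hlinear_le := abs_pairA0_bounded_mul_le (by positivity) hc₁ hc₁Y z.memLp_fn z
  rw [z.lpNorm_fn] at hlinear_le
  simp only [doubleWellNL_add_sub, pairA0_const_mul]
  rw [pairA0_add hcube hsum, pairA0_add hquadratic hlinear, ← mul_neg,
    mul_assoc (4 * τ)]
  refine mul_le_mul_of_nonneg_left ?_ (by positivity)
  linarith [pairA0_cube_nonneg hS hC z, (abs_le.1 hquadratic_le).1, (abs_le.1 hlinear_le).1]

lemma boundNf_doubleWell (hS : S.Admissible) {C : ℝ} (hC : S.SobolevBound C) {τ : ℝ}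
    (hτ : 0 ≤ τ) {y : ℝ → E d → ℝ} (hy : S.EssBdd y) : S.BoundNf 2 (doubleWellNL τ) y := by
  have := hS.isFiniteMeasure
  have hC0 := hC.1
  obtain ⟨K, -, hagmon⟩ := DomA.exists_abs_fn_le hS hC
  obtain ⟨Y, hY, hyb⟩ := hy.exists_bound hS
  refine ⟨8 * τ * (3 * Y ^ 2 + 1 + 3 * Y * (1 + C) ^ 2), ![1, 5 / 4], ![1, 7 / 4], by positivity,
    fun i => by fin_cases i <;> norm_num, ?_⟩
  filter_upwards [hyb] with t ⟨hyt, hytY⟩ z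
  have hf := (contDiff_doubleWellNL τ).continuous
  have hbdd : ∀ᵐ x ∂S.mu, |y t x + z.fn x| ≤ Y + K * √(z.normV * z.normDA) := by
    filter_upwards [hytY, hagmon z] with x hyx hzx
    exact (abs_add_le _ _).trans (add_le_add hyx hzx)
  refine ⟨(memLp_comp_of_ae_bounded (hyt.add z.memLp_fn.1) hbdd hf 2).sub
    (memLp_comp_of_ae_bounded hyt hytY hf 2), ?_⟩
  have hH := z.normH_nonneg
  have hD := z.normDA_nonneg
  have hrpow : z.normDA ^ (7 / 4 : ℝ) = z.normDA ^ (3 / 4 : ℝ) * z.normDA := by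
    rw [← Real.rpow_add_one' hD (by norm_num)]
    norm_num
  simp only [Fin.sum_univ_two, Matrix.cons_val_zero, Matrix.cons_val_one, Real.rpow_one, hrpow]
  set X := z.normH ^ (5 / 4 : ℝ) * z.normDA ^ (3 / 4 : ℝ) with hX
  have : 0 ≤ X := by positivity
  calc _ ≤ _ := neg_pairA0_doubleWellNL_add_sub_le hS hC hτ hyt hY hytY z
    _ ≤ 4 * τ * (6 * Y * ((1 + C) ^ 2 * X) + 2 * (3 * Y ^ 2 + 1) * z.normH) * z.normDA := by
        gcongr
        exact lpNorm_sq_le hS hC z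
    _ = 8 * τ * (3 * Y * (1 + C) ^ 2 * X + (3 * Y ^ 2 + 1) * z.normH) * z.normDA := by ring
    _ ≤ 8 * τ * ((3 * Y ^ 2 + 1 + 3 * Y * (1 + C) ^ 2) * (z.normH + X)) * z.normDA := by
        gcongr
        have : 0 ≤ (3 * Y ^ 2 + 1) * X + 3 * Y * (1 + C) ^ 2 * z.normH := by positivity
        linarith
    _ = _ := by rw [hX]; ring

end Target

section ExternalForce

lemma represents_gBar_iff (ha₀ : MemLp a₀ 2 S.mu) (v : S.DomA) (l : S.V') :
    S.Represents (fun x => gBar a₁ a₂ x (v.fn x)) l ↔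
      S.Represents (fun x => gClass a₀ a₁ a₂ x (v.fn x)) (S.ofH (ha₀.toLp a₀) + l) := by
  refine forall_congr' fun z => ?_
  obtain ⟨hint₀, heq₀⟩ := represents_of_memLp ha₀ z
  have hint_iff : Integrable (fun x => gBar a₁ a₂ x (v.fn x) * V.fn z x) S.mu ↔
      Integrable (fun x => a₀ x * V.fn z x + gBar a₁ a₂ x (v.fn x) * V.fn z x) S.mu :=
    (integrable_add_iff_integrable_right hint₀).symm
  simp only [gClass_eq, add_mul, add_apply, ← hint_iff]
  refine and_congr_right fun hint => ?_
  rw [integral_add hint₀ hint, heq₀, add_right_inj]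

lemma AssumptionH.sub_const {h : ℝ → S.V' × S.V'} (hh : S.AssumptionH h) (l : S.V') :
    S.AssumptionH fun t => ((h t).1 - l, (h t).2) := fun T hT =>
  ⟨(hh T hT).1.sub (memLp_const l), (hh T hT).2⟩

end ExternalForce

end Setting

end CahnHilliard

end

theorem mainTheorem4_general {d : ℕ} (hd1 : 1 ≤ d) (hd3 : d ≤ 3)
    {S : CahnHilliard.Setting d} (hS : S.Admissible) {τ : ℝ} (hτ : 0 ≤ τ)
    {a₀ a₁ a₂ : CahnHilliard.E d → ℝ}
    (ha₀ : MemLp a₀ 2 S.mu) (ha₁ : MemLp a₁ ∞ S.mu) (ha₂ : MemLp a₂ ∞ S.mu)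
    (ha₂nn : ∀ᵐ x ∂S.mu, 0 ≤ a₂ x) :
    (S.AssumptionFGV (CahnHilliard.doubleWell τ) (CahnHilliard.doubleWellNL τ)
        (CahnHilliard.gBar a₁ a₂) ∧
      S.AssumptionNdif (CahnHilliard.doubleWellNL τ) (CahnHilliard.gBar a₁ a₂) ∧
      (∀ y : ℝ → CahnHilliard.E d → ℝ, S.EssBdd y →
        S.AssumptionNfNg (CahnHilliard.doubleWellNL τ) (CahnHilliard.gBar a₁ a₂) y)) ∧
    (S.AssumptionNdif (CahnHilliard.doubleWellNL τ) (CahnHilliard.gClass a₀ a₁ a₂) ∧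
      (∀ y : ℝ → CahnHilliard.E d → ℝ, S.EssBdd y →
        S.AssumptionNfNg (CahnHilliard.doubleWellNL τ) (CahnHilliard.gClass a₀ a₁ a₂) y)) ∧
    ((∀ (v : S.DomA) (l : S.V'),
        S.Represents (fun x => CahnHilliard.gBar a₁ a₂ x (v.fn x)) l ↔
          S.Represents (fun x => CahnHilliard.gClass a₀ a₁ a₂ x (v.fn x))
            (S.ofH (ha₀.toLp a₀) + l)) ∧
      (∀ h : ℝ → S.V' × S.V', S.AssumptionH h →
        S.AssumptionH (fun t => ((h t).1 - S.ofH (ha₀.toLp a₀), (h t).2)))) := by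
  obtain ⟨C, hC⟩ := CahnHilliard.Setting.exists_sobolevBound hd1 hd3 hS
  have hNdif : S.AssumptionNdif (CahnHilliard.doubleWellNL τ) (CahnHilliard.gBar a₁ a₂) :=
    ⟨CahnHilliard.Setting.difF_doubleWell hS hC τ, CahnHilliard.Setting.difG_gBar hS hC ha₁ ha₂⟩
  have hNfNg (y : ℝ → CahnHilliard.E d → ℝ) (hy : S.EssBdd y) :
      S.AssumptionNfNg (CahnHilliard.doubleWellNL τ) (CahnHilliard.gBar a₁ a₂) y :=
    ⟨2, two_pos, CahnHilliard.Setting.boundNf_doubleWell hS hC hτ hy,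
      CahnHilliard.Setting.boundNg_gBar hS hC ha₁ ha₂ ha₂nn two_pos hy⟩
  refine ⟨⟨⟨CahnHilliard.Setting.growthF_doubleWell hS hC hτ,
    CahnHilliard.Setting.growthG_gBar hS hC ha₁ ha₂ ha₂nn⟩, hNdif, hNfNg⟩, ?_,
    CahnHilliard.Setting.represents_gBar_iff ha₀, fun _ hh => hh.sub_const _⟩
  -- (N-dif) and (NfNg) involve the control nonlinearity only through its differences.
  simp only [CahnHilliard.Setting.AssumptionNdif, CahnHilliard.Setting.AssumptionNfNg,
    CahnHilliard.Setting.DifG, CahnHilliard.Setting.BoundNg,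
    CahnHilliard.gClass_sub] at hNdif hNfNg ⊢
  exact ⟨hNdif, hNfNg⟩

theorem mainTheorem4 (d : ℕ) (hd1 : 1 ≤ d) (hd3 : d ≤ 3)
    (S : CahnHilliard.Setting d) (hS : S.Admissible)
    (τ : ℝ) (hτ : 0 < τ)
    (a₀ a₁ a₂ : CahnHilliard.E d → ℝ)
    (ha₀ : MemLp a₀ 2 S.mu) (ha₁ : MemLp a₁ ∞ S.mu) (ha₂ : MemLp a₂ ∞ S.mu)
    (ha₁pos : ∀ᵐ x ∂S.mu, 0 < a₁ x) (ha₂pos : ∀ᵐ x ∂S.mu, 0 < a₂ x) :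
    -- the assumptions for the double-well nonlinearity and for `g - a₀`
    (S.AssumptionFGV (CahnHilliard.doubleWell τ) (CahnHilliard.doubleWellNL τ)
        (CahnHilliard.gBar a₁ a₂) ∧
      S.AssumptionNdif (CahnHilliard.doubleWellNL τ) (CahnHilliard.gBar a₁ a₂) ∧
      (∀ y : ℝ → CahnHilliard.E d → ℝ, S.AssumptionYrBdd y →
        S.AssumptionNfNg (CahnHilliard.doubleWellNL τ) (CahnHilliard.gBar a₁ a₂) y) ∧
      (∀ y : ℝ → CahnHilliard.E d → ℝ, S.EssBdd y →
        ∃ n : ℕ, 0 < n ∧ S.BoundNg n (CahnHilliard.gBar a₁ a₂) y)) ∧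
    -- the two assumptions on differences for `g` itself
    (S.AssumptionNdif (CahnHilliard.doubleWellNL τ) (CahnHilliard.gClass a₀ a₁ a₂) ∧
      (∀ y : ℝ → CahnHilliard.E d → ℝ, S.AssumptionYrBdd y →
        S.AssumptionNfNg (CahnHilliard.doubleWellNL τ) (CahnHilliard.gClass a₀ a₁ a₂) y) ∧
      (∀ y : ℝ → CahnHilliard.E d → ℝ, S.EssBdd y →
        ∃ n : ℕ, 0 < n ∧ S.BoundNg n (CahnHilliard.gClass a₀ a₁ a₂) y)) ∧
    -- `a₀` can be moved into the external force: `g(v) = a₀ + (g - a₀)(v)` in `V'`, and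
    -- `(h₁ - a₀, h₂)` is an admissible external force whenever `(h₁, h₂)` is
    ((∀ (v : S.DomA) (l : S.V'),
        S.Represents (fun x => CahnHilliard.gBar a₁ a₂ x (v.fn x)) l ↔
          S.Represents (fun x => CahnHilliard.gClass a₀ a₁ a₂ x (v.fn x))
            (S.ofH (ha₀.toLp a₀) + l)) ∧
      (∀ h : ℝ → S.V' × S.V', S.AssumptionH h →
        S.AssumptionH (fun t => ((h t).1 - S.ofH (ha₀.toLp a₀), (h t).2)))) := by
  obtain ⟨⟨hFGV, hNdif, hNfNg⟩, ⟨hNdif', hNfNg'⟩, hforce⟩ :=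
    mainTheorem4_general hd1 hd3 hS hτ.le ha₀ ha₁ ha₂ (ha₂pos.mono fun _ => le_of_lt)
  have boundNg_of_nfNg {g : CahnHilliard.E d → ℝ → ℝ} {y : ℝ → CahnHilliard.E d → ℝ}
      (h : S.AssumptionNfNg (CahnHilliard.doubleWellNL τ) g y) :
      ∃ n : ℕ, 0 < n ∧ S.BoundNg n g y :=
    h.imp fun _ hn => ⟨hn.1, hn.2.2⟩
  exact ⟨⟨hFGV, hNdif, fun y hy => hNfNg y hy.1, fun y hy => boundNg_of_nfNg (hNfNg y hy)⟩,
    ⟨hNdif', fun y hy => hNfNg' y hy.1, fun y hy => boundNg_of_nfNg (hNfNg' y hy)⟩, hforce⟩
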